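/- For $N,m,k\in\mathbb N$, $m\ge 1$, let $\mathcal L_{N,m,k}=\{kx+y : x,y\in\mathbb Z/m\mathbb Z,\ xy=N\}\subseteq\mathbb Z/m\mathbb Z$. Let $N$ be an odd composite number, $\Lambda\in\mathbb N$, and let $B_1<B_2$ be natural numbers such that, with $r$ running over primes, $$m_1=\prod_{2<r\le B_1}r,\qquad m_2=\prod_{B_1<r\le B_2}r,\qquad M=m_1m_2>\Lambda .$$ Let $a,b\in\mathbb N$ with $a,b<N$ and $\gcd(ab,MN)=1$. Put $L=\lceil 2\sqrt{abN}\rceil$, and for $m\mid M$ let $\bar{\mathcal L}_m=\{s-L \bmod m: s\in\mathcal L_{N,m,ab}\}$, identified with a set of integers in $[0,m)$. Let $$N_1=\{(x\,m_2^{-1}\bmod m_1)\,m_2 : x\in\bar{\mathcal L}_{m_1}\},\qquad N_2=\{(x\,m_1^{-1}\bmod m_2)\,m_1 : x\in\bar{\mathcal L}_{m_2}\},\qquad \bar{\mathcal L}=\{s\in\bar{\mathcal L}_M: s<\Lambda\},$$ $$\Lambda_{a,b}=\min\Big\{\frac{(au-bv)^2}{4\sqrt{abN}} : u,v\in\mathbb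 N,\ N=uv,\ u,v\ne 1\Big\}.$$ Consider the following algorithm for the input $N,\Lambda$ and the choices $B_1,B_2,a,b$. 1. Compute the primes $r\le B_2$ dividing $M$ by trial division, and $m_1,m_2,M$. Compute $g=\gcd(N,M)$. If $1<g<N$, return $g$. If $g=N$, return a prime $r\mid M$ that divides $N$. 2. Otherwise compute $L$, $k=ab\bmod M$, and for every prime $r\mid M$ the set $\bar{\mathcal L}_r$ from its definition. 3. Compute $\bar{\mathcal L}_{m_1}$ and $\bar{\mathcal L}_{m_2}$ from the sets $\bar{\mathcal L}_r$ by Chinese remaindering: for $m=m_1,m_2$, with $M_r=\frac mr\cdot\big((\frac mr)^{-1}\bmod r\big)$ for the primes $r\mid m$, run through all sums $\sum_{r\mid m} a_rM_r\bmod m$ with $a_r\in\bar{\mathcal L}_r$ in the order of an odometer, each obtained from the preceding one by adding precomputed distances (differences of cyclically consecutive elements of $\bar{\mathcal L}_r$, times $M_r$). 4. Compute the lists $N_1$ and $N_2$ and sort them (merge sort). 5. For every $\alpha_1\in N_1$ and every $\alpha_2\in N_2$ with $0\le\alpha_2<\Lambda-\alpha_1$ or $M-\alpha_1\le\alpha_2<M+\Lambda-\alpha_1$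 (these ranges of the sorted list $N_2$ are found by binary search), let $\alpha=(\alpha_1+\alpha_2)\bmod M$; if $(\alpha+L)^2-4abN=y^2$ for some integer $y\ge 0$ and $\gcd(\alpha+L-y,N)$ is a proper factor of $N$, return it. 6. If no proper factor was found, return "$\Lambda$ is too small". Then the following hold. (i) If $\Lambda>\Lambda_{a,b}$, the algorithm returns a proper factor of $N$, that is, a divisor $d$ of $N$ with $1<d<N$. (ii) Its runtime is $\widetilde O(|N_1|+|N_2|+|\bar{\mathcal L}|)$ bit operations, up to factors polynomial in $\log N$ and $\log\Lambda$. Precisely, there are absolute constants $C,c$ such that for all $N,\Lambda,B_1,B_2,a,b$ as above the number of bit operations is at most $$C\,S\,(\log N+\log\Lambda+\log S)^c,\qquad S=|N_1|+|N_2|+|\bar{\mathcal L}|,$$ with the convention $\log 0=0$ (for $\Lambda=0$). Here bit operations are counted on a random access machine with logarithmic cost: addition, subtraction and comparison of integers cost the sum, multiplication and division with remainder the product of the binary lengths of the operands, and a memory access costs the length of the number moved plus, in an array, that of the address. -/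

import Mathlib

/-! ## The sieve sets -/

namespace HypSieve

/-- The modular hyperbola `{(x, y) : x y = N}` in `(ℤ/m)²`. -/
def hyperbola (N m : ℕ) : Set (ZMod m × ZMod m) :=
  {p | p.1 * p.2 = (N : ZMod m)}

/-- The sieve set `{k x + y : (x, y) on the modular hyperbola}`. -/
def sieve (N m k : ℕ) : Set (ZMod m) :=
  {s | ∃ p ∈ hyperbola N m, s = (k : ZMod m) * p.1 + p.2}

/-- `L = ⌈2 √(abN)⌉`. -/
noncomputable def shift (N a b : ℕ) : ℕ := ⌈2 * Real.sqrt ((a : ℝ) * b * N)⌉₊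

/-- The shifted sieve set `{s - L : s ∈ sieve}` for the linear forms `a u + b v`, where `k = a b`. -/
noncomputable def shiftedSieve (N m a b : ℕ) : Set (ZMod m) :=
  {t | ∃ s ∈ sieve N m (a * b), t = s - (shift N a b : ZMod m)}

/-- The product of all primes `r` with `lo < r ≤ hi`. -/
def primeProd (lo hi : ℕ) : ℕ := ∏ r ∈ (Finset.Ioc lo hi).filter Nat.Prime, r

/-- `{j m' : j = x m'⁻¹ mod m, x in the shifted sieve set modulo m}`, a set of integers in
`[0, m m')`. It is the set `N₁` for `(m, m') = (m₁, m₂)` and `N₂` for `(m, m') = (m₂, m₁)`. -/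
noncomputable def weights (N m m' a b : ℕ) : Set ℕ :=
  {w | ∃ x ∈ shiftedSieve N m a b, w = (x * (m' : ZMod m)⁻¹).val * m'}

/-- Least nonnegative residues below `Λ` of the shifted sieve set modulo `M`. -/
noncomputable def smallSieve (N M a b Λ : ℕ) : Set ℕ :=
  {s | s < Λ ∧ ∃ x ∈ shiftedSieve N M a b, s = x.val}

/-- `Λ_{a,b}`: the minimum of `(au - bv)² / (4 √(abN))` over the nontrivial decompositions
`N = u v`. (For composite `N` this set is finite and nonempty, so that `sInf` is its minimum.) -/
noncomputable def fermatBound (N a b : ℕ) : ℝ :=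
  sInf {x : ℝ | ∃ u v : ℕ, N = u * v ∧ u ≠ 1 ∧ v ≠ 1 ∧
    x = ((a : ℝ) * u - b * v) ^ 2 / (4 * Real.sqrt ((a : ℝ) * b * N))}

end HypSieve

/-! ## Programs with a count of bit operations

A random access machine under logarithmic (bit) cost. The data are natural numbers in binary, lists
of them that are read and written sequentially, and arrays with random access. All arithmetic,
comparisons and memory accesses of the programs below go through the primitives of this section.
Addition, subtraction and comparison cost the total length of the operands, multiplication
and division the product of the lengths (the schoolbook methods), a memory access costs the length
of the number that is moved and, for an array, that of the address.
Greatest common divisors, modular inverses, square roots, sorting and searching are programs. -/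

/-- The result of a computation together with the number of bit operations it took. -/
structure Timed (α : Type) where
  val : α
  cost : ℕ

namespace Timed

instance : Monad Timed where
  pure x := ⟨x, 0⟩
  bind p f := ⟨(f p.val).val, p.cost + (f p.val).cost⟩

/-- Length of a number in memory: its binary digits and one end marker. -/
def len (n : ℕ) : ℕ := n.size + 1

def add (x y : ℕ) : Timed ℕ := ⟨x + y, len x + len y⟩
/-- Truncated subtraction. -/
def sub (x y : ℕ) : Timed ℕ := ⟨x - y, len x + len y⟩
def mul (x y : ℕ) : Timed ℕ := ⟨x * y, len x * len y⟩
def quo (x y : ℕ) : Timed ℕ := ⟨x / y, len x * len y⟩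
def rem (x y : ℕ) : Timed ℕ := ⟨x % y, len x * len y⟩
def lt (x y : ℕ) : Timed Bool := ⟨decide (x < y), len x + len y⟩
def eq (x y : ℕ) : Timed Bool := ⟨decide (x = y), len x + len y⟩
/-- Read the number `x` at the head of a list, or test and update the counter `x` of a loop. -/
def read (x : ℕ) : Timed Unit := ⟨(), len x⟩
/-- Write the number `x` at the head of a list. -/
def cons (x : ℕ) (l : List ℕ) : Timed (List ℕ) := ⟨x :: l, len x⟩
/-- Random access to an array. -/
def get (A : Array ℕ) (i : ℕ) : Timed ℕ := ⟨A.getD i 0, len i + len (A.getD i 0)⟩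
/-- Append an entry to an array. -/
def push (A : Array ℕ) (x : ℕ) : Timed (Array ℕ) := ⟨A.push x, len A.size + len x⟩
/-- Read the length of an array. -/
def length (A : Array ℕ) : Timed ℕ := ⟨A.size, len A.size⟩

end Timed

/-! ## The time-space tradeoff algorithm

In some of the recursions a first argument `fuel` bounds the depth, only so that they are
structural; the initial values are large enough for the bound never to be reached. -/

namespace Tradeoff

open Timed

/-! ### Arithmetic -/

/-- Euclid's algorithm. -/
def gcdAux : (fuel : ℕ) → ℕ → ℕ → Timed ℕ
  | 0, x, _ => pure x
  | f + 1, x, y => do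
    if (← eq y 0) then pure x
    else
      let z ← rem x y
      gcdAux f y z

def gcd (x y : ℕ) : Timed ℕ := gcdAux (y + 1) x y

/-- The extended Euclidean algorithm for remainders `r₀, r₁` and cofactors `t₀, t₁` modulo `m`. -/
def invAux (m : ℕ) : (fuel : ℕ) → (r₀ r₁ t₀ t₁ : ℕ) → Timed ℕ
  | 0, _, _, t₀, _ => pure t₀
  | f + 1, r₀, r₁, t₀, t₁ => do
    if (← eq r₁ 0) then pure t₀
    else
      let q ← quo r₀ r₁
      let r₂ ← rem r₀ r₁
      let p ← mul q t₁
      let p' ← rem p m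
      let n ← sub m p'
      let s ← add t₀ n
      let t₂ ← rem s m
      invAux m f r₁ r₂ t₁ t₂

/-- The inverse of `x` modulo `m`, for coprime `x` and `m`. -/
def inv (x m : ℕ) : Timed ℕ := do
  let r ← rem x m
  invAux m (m + 1) m r 0 1

/-- `⌊√n⌋`, two binary digits of `n` at a time. -/
def sqrtAux : (fuel : ℕ) → ℕ → Timed ℕ
  | 0, _ => pure 0
  | f + 1, n => do
    if (← eq n 0) then pure 0
    else
      let n' ← quo n 4
      let s ← sqrtAux f n'
      let s₀ ← mul 2 s
      let s₁ ← add s₀ 1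
      let q ← mul s₁ s₁
      if (← lt n q) then pure s₀ else pure s₁

def sqrt (n : ℕ) : Timed ℕ := sqrtAux n n

/-- `⌈√n⌉`. -/
def sqrtUp (n : ℕ) : Timed ℕ := do
  let s ← sqrt n
  let q ← mul s s
  if (← eq q n) then pure s else add s 1

/-! ### The moduli -/

/-- Is `n` divisible by no number in `[2, d]`? -/
def noDivisor (n : ℕ) : (d : ℕ) → Timed Bool
  | 0 => pure true
  | 1 => pure true
  | d + 2 => do
    let s ← rem n (d + 2)
    if (← eq s 0) then pure false
    else
      read (d + 2)
      noDivisor n (d + 1)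

def isPrime (n : ℕ) : Timed Bool := do
  if (← lt n 2) then pure false
  else
    let d ← sub n 1
    noDivisor n d

/-- The primes `r` with `lo < r ≤ n`, in descending order. -/
def primesIn (lo : ℕ) : (n : ℕ) → Timed (List ℕ)
  | 0 => pure []
  | n + 1 => do
    read (n + 1)
    if (← lt lo (n + 1)) then
      let p ← isPrime (n + 1)
      let l ← primesIn lo n
      if p then cons (n + 1) l else pure l
    else pure []

def prod : List ℕ → Timed ℕ
  | [] => pure 1
  | x :: l => do
    read x
    let p ← prod l
    mul x p

/-- The first number in the list that divides `N`. -/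
def firstDivisor (N : ℕ) : List ℕ → Timed (Option ℕ)
  | [] => pure none
  | x :: l => do
    read x
    let s ← rem N x
    if (← eq s 0) then pure (some x) else firstDivisor N l

/-! ### The sieve modulo a prime -/

/-- Is there `y' < y` with `x y' ≡ N` and `k x + y' ≡ t + L` modulo `r`? -/
def existsY (r N k L t x : ℕ) : (y : ℕ) → Timed Bool
  | 0 => pure false
  | y + 1 => do
    read (y + 1)
    let p ← mul x y
    let p' ← rem p r
    let n ← rem N r
    let q ← mul k x
    let q' ← add q y
    let q'' ← rem q' r
    let u ← add t L
    let u' ← rem u r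
    if (← eq p' n) && (← eq q'' u') then pure true
    else existsY r N k L t x y

/-- Are there `x' < x` and `y < r` with `x' y ≡ N` and `k x' + y ≡ t + L` modulo `r`? -/
def existsXY (r N k L t : ℕ) : (x : ℕ) → Timed Bool
  | 0 => pure false
  | x + 1 => do
    read (x + 1)
    if (← existsY r N k L t x r) then pure true else existsXY r N k L t x

/-- The `t' < t` that lie in the shifted sieve set modulo `r`. -/
def residuesBelow (r N k L : ℕ) : (t : ℕ) → Timed (List ℕ)
  | 0 => pure []
  | t + 1 => do
    read (t + 1)
    let e ← existsXY r N k L t r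
    let l ← residuesBelow r N k L t
    if e then cons t l else pure l

/-- The shifted sieve set modulo `r`, as a list, for each `r` in the given list. -/
def residues (N k L : ℕ) : List ℕ → Timed (List (ℕ × List ℕ))
  | [] => pure []
  | r :: l => do
    read r
    let A ← residuesBelow r N k L r
    let R ← residues N k L l
    pure ((r, A) :: R)

/-! ### Chinese remaindering -/

/-- One residue class system: the current index, the number `κ` of residues, and the distances
`Δ₀, …, Δ_{κ-1}`. -/
structure Wheel where
  idx : ℕ
  num : ℕ
  dist : Array ℕ

/-- For a list `a₁, a₂, …` and a number `p`, append to `D` the distances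
`(a₁ - p) c mod m, (a₂ - a₁) c mod m, …`; here all `aᵢ, p < r` and `m ∣ r c`. -/
def distances (r c m : ℕ) : (p : ℕ) → List ℕ → Array ℕ → Timed (Array ℕ)
  | _, [], D => pure D
  | p, x :: l, D => do
    read x
    let n ← sub r p
    let s ← add x n
    let q ← mul s c
    let q' ← rem q m
    let D' ← push D q'
    distances r c m x l D'

/-- The last element of the list `p :: l`. -/
def lastOf : (p : ℕ) → List ℕ → Timed ℕ
  | p, [] => pure p
  | _, x :: l => do
    read x
    lastOf x l

/-- The precomputation: the start value `∑ a_{i,1} Mᵢ mod m`, the number `∏ κᵢ` of elements, and the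
wheels. -/
def wheels (m : ℕ) : List (ℕ × List ℕ) → Timed (ℕ × ℕ × List Wheel)
  | [] => pure (0, 1, [])
  | (_, []) :: _ => pure (0, 0, [])
  | (r, a :: A) :: R => do
    read r
    read a
    let h ← quo m r
    let i ← inv h r
    let c ← mul h i
    let z ← lastOf a A
    let D ← distances r c m z (a :: A) #[]
    let κ ← length D
    let (x, n, W) ← wheels m R
    let p ← mul a c
    let s ← add p x
    let x' ← rem s m
    let n' ← mul κ n
    pure (x', n', ⟨0, κ, D⟩ :: W)

/-- Advance the first wheel by one, and the following wheel as long as the index returns to `0`;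
add all distances passed to `x`, modulo `m`. -/
def turn (m : ℕ) : (x : ℕ) → List Wheel → Timed (ℕ × List Wheel)
  | x, [] => pure (x, [])
  | x, w :: W => do
    let i ← add w.idx 1
    let i' ← rem i w.num
    let d ← get w.dist i'
    let s ← add x d
    let x' ← rem s m
    if (← eq i' 0) then
      let (x'', W') ← turn m x' W
      pure (x'', ⟨i', w.num, w.dist⟩ :: W')
    else pure (x', ⟨i', w.num, w.dist⟩ :: W)

/-- The next `n` elements after `x`. -/
def cycle (m : ℕ) : (n : ℕ) → (x : ℕ) → List Wheel → Timed (List ℕ)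
  | 0, _, _ => pure []
  | n + 1, x, W => do
    read (n + 1)
    let (x', W') ← turn m x W
    let l ← cycle m n x' W'
    cons x' l

/-- The set of residues modulo `m` that is determined, by the Chinese Remainder Theorem, by sets of
residues modulo the pairwise coprime factors of `m`. -/
def chinese (m : ℕ) (R : List (ℕ × List ℕ)) : Timed (List ℕ) := do
  let (x, n, W) ← wheels m R
  if (← eq n 0) then pure []
  else
    let n' ← sub n 1
    let l ← cycle m n' x W
    cons x l

/-! ### Sorting and searching -/

def split : List ℕ → Timed (List ℕ × List ℕ)
  | [] => pure ([], [])
  | [x] => do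
    read x
    let l ← cons x []
    pure (l, [])
  | x :: y :: l => do
    read x
    read y
    let (l₁, l₂) ← split l
    let l₁' ← cons x l₁
    let l₂' ← cons y l₂
    pure (l₁', l₂')

def merge : List ℕ → List ℕ → Timed (List ℕ)
  | [], l => pure l
  | l, [] => pure l
  | x :: l, y :: l' => do
    read x
    read y
    if (← lt y x) then
      let t ← merge (x :: l) l'
      cons y t
    else
      let t ← merge l (y :: l')
      cons x t
termination_by l l' => l.length + l'.length

/-- Merge sort. -/
def sortAux : (fuel : ℕ) → List ℕ → Timed (List ℕ)
  | 0, l => pure l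
  | _ + 1, [] => pure []
  | _ + 1, [x] => pure [x]
  | f + 1, x :: y :: l => do
    let (l₁, l₂) ← split (x :: y :: l)
    let s₁ ← sortAux f l₁
    let s₂ ← sortAux f l₂
    merge s₁ s₂

def sort (l : List ℕ) : Timed (List ℕ) := sortAux l.length l

def toArray : List ℕ → Array ℕ → Timed (Array ℕ)
  | [], A => pure A
  | x :: l, A => do
    read x
    let A' ← push A x
    toArray l A'

/-- Binary search: the number of entries `< t` of a sorted array, known to lie in `[lo, hi]`. -/
def searchAux (A : Array ℕ) (t : ℕ) : (fuel : ℕ) → (lo hi : ℕ) → Timed ℕ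
  | 0, lo, _ => pure lo
  | f + 1, lo, hi => do
    if (← lt lo hi) then
      let s ← add lo hi
      let i ← quo s 2
      let x ← get A i
      if (← lt x t) then
        let i' ← add i 1
        searchAux A t f i' hi
      else searchAux A t f lo i
    else pure lo

def search (A : Array ℕ) (t : ℕ) : Timed ℕ := do
  let n ← length A
  searchAux A t A.size 0 n

/-! ### The algorithm -/

/-- The list of all `j m'` with `j = x i mod m`, for `x` in the given list. -/
def weightList (m m' i : ℕ) : List ℕ → Timed (List ℕ)
  | [] => pure []
  | x :: l => do
    read x
    let p ← mul x i
    let j ← rem p m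
    let w ← mul j m'
    let t ← weightList m m' i l
    cons w t

/-- If `(α + L)² - f` is a square `y²`, compute `gcd(α + L - y, N)` and return it if it is a proper
factor of `N`; here `f = 4abN`. -/
def try_ (N f L α : ℕ) : Timed (Option ℕ) := do
  let t ← add α L
  let q ← mul t t
  let d ← sub q f
  let y ← sqrt d
  let y2 ← mul y y
  if (← eq y2 d) then
    let v ← sub t y
    let g ← gcd v N
    if (← lt 1 g) && (← lt g N) then pure (some g) else pure none
  else pure none

/-- Try `α = α₁ + α₂ mod M` for the `n` entries `α₂` of the array `A` from the index `i` on, until a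
proper factor is found. -/
def scan (N f L M α₁ : ℕ) (A : Array ℕ) : (n i : ℕ) → Timed (Option ℕ)
  | 0, _ => pure none
  | n + 1, i => do
    read (n + 1)
    let α₂ ← get A i
    let s ← add α₁ α₂
    let α ← rem s M
    match (← try_ N f L α) with
    | some d => pure (some d)
    | none =>
      let i' ← add i 1
      scan N f L M α₁ A n i'

/-- For each `α₁` in the list, scan the entries `α₂` of the sorted array `A` with
`0 ≤ α₂ < Λ - α₁`, then those with `M - α₁ ≤ α₂ < M + Λ - α₁`, until a proper factor is found. -/
def meet (N f L M Λ : ℕ) (A : Array ℕ) : List ℕ → Timed (Option ℕ)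
  | [] => pure none
  | α₁ :: l => do
    read α₁
    let t₁ ← sub Λ α₁
    let n₁ ← search A t₁
    match (← scan N f L M α₁ A n₁ 0) with
    | some d => pure (some d)
    | none =>
      let t₂ ← sub M α₁
      let i₂ ← search A t₂
      let s ← add M Λ
      let t₃ ← sub s α₁
      let i₃ ← search A t₃
      let n₂ ← sub i₃ i₂
      match (← scan N f L M α₁ A n₂ i₂) with
      | some d => pure (some d)
      | none => meet N f L M Λ A l

/-- The time-space tradeoff algorithm for the input `N, Λ` and the choices `B₁, B₂, a, b`. The
output `none` stands for `Λ is too small`. In the degenerate case that `N` divides `M`, where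
`gcd(N, M) = N`, a prime of the list that divides `N` is returned. -/
def factor (N Λ B₁ B₂ a b : ℕ) : Timed (Option ℕ) := do
  let P₁ ← primesIn 2 B₁
  let P₂ ← primesIn B₁ B₂
  let m₁ ← prod P₁
  let m₂ ← prod P₂
  let M ← mul m₁ m₂
  let g ← gcd N M
  if (← lt 1 g) then
    if (← lt g N) then pure (some g)
    else
      match (← firstDivisor N P₁) with
      | some d => pure (some d)
      | none => firstDivisor N P₂
  else
    let ab ← mul a b
    let abN ← mul ab N
    let f ← mul 4 abN
    let L ← sqrtUp f
    let k ← rem ab M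
    let R₁ ← residues N k L P₁
    let R₂ ← residues N k L P₂
    let X₁ ← chinese m₁ R₁
    let X₂ ← chinese m₂ R₂
    let i₁ ← inv m₂ m₁
    let W₁ ← weightList m₁ m₂ i₁ X₁
    let N₁ ← sort W₁
    let i₂ ← inv m₁ m₂
    let W₂ ← weightList m₂ m₁ i₂ X₂
    let N₂ ← sort W₂
    let A ← toArray N₂ #[]
    meet N f L M Λ A N₁

end Tradeoff

/-! If `N = u v`, then `a u + b v - L` lies in the shifted sieve set modulo `M` (take `x = u / b`
and `y = b v`), and `2 √(s t) ≤ s + t ≤ 2 √(s t) + (s - t)² / (4 √(s t))` with `s = a u` and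
`t = b v` puts it into `[0, Λ)` for some `u`, `v` as soon as `Λ > Λ_{a,b}`. This `α` is congruent
to the sum of an element of `N₁` and one of `N₂`, so it is tried; then
`(α + L)² - 4abN = (a u - b v)²`, and `α + L - |a u - b v|` is `2 a u` or `2 b v`, whose gcd with
`N` is `u` or `v`.

As for the running time, the Chinese Remainder Theorem makes the tried pairs distinct elements of
the sieve set modulo `M` below `Λ`. Modulo a prime `r` the map `x ↦ k x + N / x` takes no value
more than twice, so that the sieve set has at least `(r - 1) / 2` elements, which is at least
`r ^ (1 / 3)` unless `r ∣ 6`. Hence `M ≤ 36 S ^ 6`, and all numbers have length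
`O(log N + log S)`. Trial division takes `O(B₂ ^ 4)` steps, which is `O(S)` because by Bertrand's
postulate the product of the primes up to `B₂` grows faster than every power of `B₂`. -/

namespace Timed

/-! ## Lengths -/

variable {x y n ℓ : ℕ}

lemma len_pos (x : ℕ) : 1 ≤ len x := Nat.le_add_left 1 _

@[simp] lemma len_zero : len 0 = 1 := rfl
@[simp] lemma len_one : len 1 = 2 := rfl
@[simp] lemma len_two : len 2 = 3 := rfl
@[simp] lemma len_four : len 4 = 4 := rfl

lemma len_mono (h : x ≤ y) : len x ≤ len y := Nat.add_le_add_right (Nat.size_le_size h) 1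

lemma len_le_of_lt_two_pow (h : x < 2 ^ n) : len x ≤ n + 1 :=
  Nat.add_le_add_right (Nat.size_le.2 h) 1

lemma lt_two_pow_of_len_le (h : len x ≤ ℓ) : x < 2 ^ ℓ :=
  Nat.size_le.1 ((Nat.le_succ _).trans h)

lemma len_mul_le (x y : ℕ) : len (x * y) ≤ len x + len y := by
  have h : x * y < 2 ^ (x.size + y.size) := by
    rw [pow_add]
    exact Nat.mul_lt_mul'' (Nat.lt_size_self x) (Nat.lt_size_self y)
  have := len_le_of_lt_two_pow h
  simp only [len] at *
  omega

lemma len_add_le (x y : ℕ) : len (x + y) ≤ len x + len y := by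
  have h : x + y < 2 ^ (x.size + y.size + 1) := by
    have hx := (Nat.lt_size_self x).trans_le
      (Nat.pow_le_pow_right two_pos (Nat.le_add_right x.size y.size))
    have hy := (Nat.lt_size_self y).trans_le
      (Nat.pow_le_pow_right two_pos (Nat.le_add_left y.size x.size))
    rw [pow_succ]
    omega
  have := len_le_of_lt_two_pow h
  simp only [len] at *
  omega

lemma len_div_le (x y : ℕ) : len (x / y) ≤ len x := len_mono (Nat.div_le_self x y)

lemma len_mod_le (x y : ℕ) : len (x % y) ≤ len x := len_mono (Nat.mod_le x y)

lemma len_sub_le (x y : ℕ) : len (x - y) ≤ len x := len_mono (Nat.sub_le x y)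

/-! ## Values -/

variable {α β : Type}

@[simp] lemma val_pure (x : α) : (pure x : Timed α).val = x := rfl
@[simp] lemma val_bind (p : Timed α) (f : α → Timed β) : (p >>= f).val = (f p.val).val := rfl
@[simp] lemma val_ite (c : Prop) {_ : Decidable c} (p q : Timed α) :
    (if c then p else q).val = if c then p.val else q.val := apply_ite _ _ _ _
@[simp] lemma val_add (x y : ℕ) : (add x y).val = x + y := rfl
@[simp] lemma val_sub (x y : ℕ) : (sub x y).val = x - y := rfl
@[simp] lemma val_mul (x y : ℕ) : (mul x y).val = x * y := rfl
@[simp] lemma val_quo (x y : ℕ) : (quo x y).val = x / y := rfl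
@[simp] lemma val_rem (x y : ℕ) : (rem x y).val = x % y := rfl
@[simp] lemma val_lt (x y : ℕ) : (lt x y).val = decide (x < y) := rfl
@[simp] lemma val_eq (x y : ℕ) : (eq x y).val = decide (x = y) := rfl
@[simp] lemma val_cons (x : ℕ) (l : List ℕ) : (cons x l).val = x :: l := rfl
@[simp] lemma val_get (A : Array ℕ) (i : ℕ) : (get A i).val = A.getD i 0 := rfl
@[simp] lemma val_push (A : Array ℕ) (x : ℕ) : (push A x).val = A.push x := rfl
@[simp] lemma val_length (A : Array ℕ) : (length A).val = A.size := rfl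

/-! ## Costs -/

/-- `p` takes at most `n` steps on words of length `ℓ`. A step stands for `2 * ℓ ^ 2` bit
operations, which is enough for any primitive operation on numbers of length at most `ℓ`. -/
def RunsIn (p : Timed α) (ℓ n : ℕ) : Prop := p.cost ≤ n * (2 * ℓ ^ 2)

namespace RunsIn

variable {p q : Timed α} {f : α → Timed β} {k : ℕ}

lemma mono (h : p.RunsIn ℓ n) (hnk : n ≤ k) : p.RunsIn ℓ k :=
  h.trans (Nat.mul_le_mul_right _ hnk)

protected lemma pure (x : α) : (pure x : Timed α).RunsIn ℓ n := Nat.zero_le _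

lemma bind (hp : p.RunsIn ℓ k) (hf : (f p.val).RunsIn ℓ n) : (p >>= f).RunsIn ℓ (n + k) := by
  have : p.cost + (f p.val).cost ≤ k * (2 * ℓ ^ 2) + n * (2 * ℓ ^ 2) := Nat.add_le_add hp hf
  rwa [RunsIn, add_comm n k, add_mul]

lemma ite {c : Prop} [Decidable c] (hp : c → p.RunsIn ℓ n) (hq : ¬ c → q.RunsIn ℓ n) :
    (if c then p else q).RunsIn ℓ n := by
  split_ifs with h
  exacts [hp h, hq h]

lemma of_cost_le_add (hx : len x ≤ ℓ) (hy : len y ≤ ℓ) (h : p.cost ≤ len x + len y) :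
    p.RunsIn ℓ 1 := by
  have : 1 ≤ ℓ := (len_pos x).trans hx
  unfold RunsIn
  nlinarith

lemma of_cost_le_mul (hx : len x ≤ ℓ) (hy : len y ≤ ℓ) (h : p.cost ≤ len x * len y) :
    p.RunsIn ℓ 1 := by
  have := Nat.mul_le_mul hx hy
  unfold RunsIn
  nlinarith

section

variable {f : ℕ → Timed α} {g : Bool → Timed α}

protected lemma add (hx : len x ≤ ℓ) (hy : len y ≤ ℓ) (h : (f (x + y)).RunsIn ℓ n) :
    (Timed.add x y >>= f).RunsIn ℓ (n + 1) :=
  bind (of_cost_le_add hx hy le_rfl) h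

protected lemma sub (hx : len x ≤ ℓ) (hy : len y ≤ ℓ) (h : (f (x - y)).RunsIn ℓ n) :
    (Timed.sub x y >>= f).RunsIn ℓ (n + 1) :=
  bind (of_cost_le_add hx hy le_rfl) h

protected lemma mul (hx : len x ≤ ℓ) (hy : len y ≤ ℓ) (h : (f (x * y)).RunsIn ℓ n) :
    (Timed.mul x y >>= f).RunsIn ℓ (n + 1) :=
  bind (of_cost_le_mul hx hy le_rfl) h

protected lemma quo (hx : len x ≤ ℓ) (hy : len y ≤ ℓ) (h : (f (x / y)).RunsIn ℓ n) :
    (Timed.quo x y >>= f).RunsIn ℓ (n + 1) :=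
  bind (of_cost_le_mul hx hy le_rfl) h

protected lemma rem (hx : len x ≤ ℓ) (hy : len y ≤ ℓ) (h : (f (x % y)).RunsIn ℓ n) :
    (Timed.rem x y >>= f).RunsIn ℓ (n + 1) :=
  bind (of_cost_le_mul hx hy le_rfl) h

protected lemma lt (hx : len x ≤ ℓ) (hy : len y ≤ ℓ) (h : (g (x < y)).RunsIn ℓ n) :
    (Timed.lt x y >>= g).RunsIn ℓ (n + 1) :=
  bind (of_cost_le_add hx hy le_rfl) h

protected lemma eq (hx : len x ≤ ℓ) (hy : len y ≤ ℓ) (h : (g (x = y)).RunsIn ℓ n) :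
    (Timed.eq x y >>= g).RunsIn ℓ (n + 1) :=
  bind (of_cost_le_add hx hy le_rfl) h

lemma ite_lt (hx : len x ≤ ℓ) (hy : len y ≤ ℓ) (hp : x < y → p.RunsIn ℓ n)
    (hq : y ≤ x → q.RunsIn ℓ n) :
    (Timed.lt x y >>= fun c => if c = true then p else q).RunsIn ℓ (n + 1) :=
  .lt hx hy (.ite (fun h => hp (by simpa using h)) fun h => hq (by simpa using h))

lemma ite_eq (hx : len x ≤ ℓ) (hy : len y ≤ ℓ) (hp : x = y → p.RunsIn ℓ n)
    (hq : x ≠ y → q.RunsIn ℓ n) :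
    (Timed.eq x y >>= fun c => if c = true then p else q).RunsIn ℓ (n + 1) :=
  .eq hx hy (.ite (fun h => hp (by simpa using h)) fun h => hq (by simpa using h))

protected lemma read {f : Unit → Timed α} (hx : len x ≤ ℓ) (h : (f ()).RunsIn ℓ n) :
    (Timed.read x >>= f).RunsIn ℓ (n + 1) :=
  bind (of_cost_le_add hx hx (Nat.le_add_left _ _)) h

protected lemma cons {f : List ℕ → Timed α} {l : List ℕ} (hx : len x ≤ ℓ)
    (h : (f (x :: l)).RunsIn ℓ n) : (Timed.cons x l >>= f).RunsIn ℓ (n + 1) :=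
  bind (of_cost_le_add hx hx (Nat.le_add_left _ _)) h

variable {A : Array ℕ} {i : ℕ}

protected lemma get (hi : len i ≤ ℓ) (hx : len (A.getD i 0) ≤ ℓ)
    (h : (f (A.getD i 0)).RunsIn ℓ n) : (Timed.get A i >>= f).RunsIn ℓ (n + 1) :=
  bind (of_cost_le_add hi hx le_rfl) h

protected lemma push {f : Array ℕ → Timed α} (hA : len A.size ≤ ℓ) (hx : len x ≤ ℓ)
    (h : (f (A.push x)).RunsIn ℓ n) : (Timed.push A x >>= f).RunsIn ℓ (n + 1) :=
  bind (of_cost_le_add hA hx le_rfl) h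

protected lemma length (hA : len A.size ≤ ℓ) (h : (f A.size).RunsIn ℓ n) :
    (Timed.length A >>= f).RunsIn ℓ (n + 1) :=
  bind (of_cost_le_add hA hA (Nat.le_add_left _ _)) h

end

lemma last_add (hx : len x ≤ ℓ) (hy : len y ≤ ℓ) : (Timed.add x y).RunsIn ℓ 1 :=
  of_cost_le_add hx hy le_rfl

lemma last_mul (hx : len x ≤ ℓ) (hy : len y ≤ ℓ) : (Timed.mul x y).RunsIn ℓ 1 :=
  of_cost_le_mul hx hy le_rfl

lemma last_cons (hx : len x ≤ ℓ) (l : List ℕ) : (Timed.cons x l).RunsIn ℓ 1 :=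
  of_cost_le_add hx hx (Nat.le_add_left _ _)

end RunsIn

end Timed

namespace Tradeoff

open Timed

/-! ## Euclid's algorithm -/

section

variable {ℓ : ℕ}

lemma gcdAux_val : ∀ {f x y : ℕ}, y < f → (gcdAux f x y).val = Nat.gcd x y
  | 0, _, _, h => absurd h (Nat.not_lt_zero _)
  | f + 1, x, y, h => by
    rw [gcdAux]
    by_cases hy : y = 0
    · simp [hy]
    · have := Nat.mod_lt x (Nat.pos_of_ne_zero hy)
      simp only [val_bind, val_eq, hy, decide_false, Bool.false_eq_true, if_false, val_rem]
      rw [gcdAux_val (by omega), Nat.gcd_comm, ← Nat.gcd_rec, Nat.gcd_comm]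

lemma gcd_val (x y : ℕ) : (gcd x y).val = Nat.gcd x y := gcdAux_val (Nat.lt_succ_self y)

lemma two_mul_mod_le {x y : ℕ} (hy : 0 < y) (hyx : y ≤ x) : 2 * (x % y) ≤ x := by
  have hlt := Nat.mod_lt x hy
  have hdiv := Nat.div_add_mod x y
  have hquo : y ≤ y * (x / y) := Nat.le_mul_of_pos_right y (Nat.div_pos hyx hy)
  omega

/-- The product of two consecutive remainders is the potential that makes Euclid's algorithm end
after a logarithmic number of divisions. -/
lemma mul_mod_lt_two_pow {x y n : ℕ} (hy : 0 < y) (hyx : y ≤ x) (h : x * y < 2 ^ (n + 1)) :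
    y * (x % y) < 2 ^ n := by
  have := Nat.mul_le_mul_left y (two_mul_mod_le hy hyx)
  rw [pow_succ] at h
  nlinarith

lemma gcdAux_runsIn : ∀ {f n x y : ℕ}, y ≤ x → x * y < 2 ^ n → len x ≤ ℓ →
    (gcdAux f x y).RunsIn ℓ (2 * n + 1)
  | 0, _, _, _, _, _, _ => .pure _
  | f + 1, n, x, y, hyx, h, hx => by
    have hy : len y ≤ ℓ := (len_mono hyx).trans hx
    have h0 : len 0 ≤ ℓ := (len_mono (Nat.zero_le x)).trans hx
    rw [gcdAux]
    refine .ite_eq hy h0 (fun _ => .pure _) fun hy0 => ?_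
    have hpos : 0 < y := Nat.pos_of_ne_zero hy0
    obtain _ | n := n
    · exact absurd h (Nat.not_lt.2 (Nat.mul_pos (hpos.trans_le hyx) hpos))
    · exact .rem hx hy (gcdAux_runsIn (Nat.mod_lt x hpos).le (mul_mod_lt_two_pow hpos hyx h) hy)

lemma gcd_runsIn {x y : ℕ} (hx : len x ≤ ℓ) (hy : len y ≤ ℓ) :
    (gcd x y).RunsIn ℓ (4 * ℓ + 3) := by
  have h0 : len 0 ≤ ℓ := (len_mono (Nat.zero_le x)).trans hx
  rw [gcd, gcdAux]
  refine .mono (.ite_eq hy h0 (fun _ => .pure _) fun hy0 => .rem hx hy ?_) le_rfl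
  have hlt : x % y < y := Nat.mod_lt x (Nat.pos_of_ne_zero hy0)
  refine (gcdAux_runsIn (n := ℓ + ℓ) hlt.le ?_ hy).mono (by omega)
  rw [pow_add]
  exact Nat.mul_lt_mul'' (lt_two_pow_of_len_le hy) (hlt.trans (lt_two_pow_of_len_le hy))

/-! ## Modular inverses -/

lemma cofactor_modEq {m x q r₀ r₁ t₀ t₁ : ℕ} (hm : 0 < m) (h₀ : t₀ * x ≡ q * r₁ + r₀ [MOD m])
    (h₁ : t₁ * x ≡ r₁ [MOD m]) : (t₀ + (m - q * t₁ % m)) % m * x ≡ r₀ [MOD m] := by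
  have hle : q * t₁ % m ≤ m := (Nat.mod_lt _ hm).le
  rw [← ZMod.natCast_eq_natCast_iff] at h₀ h₁ ⊢
  push_cast at h₀ h₁
  rw [Nat.cast_mul, ZMod.natCast_mod, Nat.cast_add, Nat.cast_sub hle]
  simp only [ZMod.natCast_mod, ZMod.natCast_self]
  push_cast
  linear_combination h₀ - (q : ZMod m) * h₁

lemma invAux_val {x m : ℕ} (hm : 0 < m) : ∀ {f r₀ r₁ t₀ t₁ : ℕ}, r₁ < f →
    t₀ * x ≡ r₀ [MOD m] → t₁ * x ≡ r₁ [MOD m] →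
    (invAux m f r₀ r₁ t₀ t₁).val * x ≡ Nat.gcd r₀ r₁ [MOD m]
  | 0, _, _, _, _, h, _, _ => absurd h (Nat.not_lt_zero _)
  | f + 1, r₀, r₁, t₀, t₁, h, h₀, h₁ => by
    rw [invAux]
    by_cases hr : r₁ = 0
    · simpa [hr] using h₀
    · simp only [val_bind, val_eq, hr, decide_false, Bool.false_eq_true, if_false, val_rem, val_quo,
        val_mul, val_sub, val_add]
      have hlt := Nat.mod_lt r₀ (Nat.pos_of_ne_zero hr)
      rw [Nat.gcd_comm, Nat.gcd_rec, Nat.gcd_comm]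
      refine invAux_val hm (by omega) h₁ (cofactor_modEq hm ?_ h₁)
      rwa [mul_comm (r₀ / r₁), Nat.div_add_mod]

lemma invAux_lt {m : ℕ} (hm : 0 < m) : ∀ {f r₀ r₁ t₀ t₁ : ℕ}, t₀ < m → (t₁ < m ∨ r₁ = 0) →
    (invAux m f r₀ r₁ t₀ t₁).val < m
  | 0, _, _, _, _, h₀, _ => h₀
  | f + 1, r₀, r₁, t₀, t₁, h₀, h₁ => by
    rw [invAux]
    by_cases hr : r₁ = 0
    · simpa [hr] using h₀
    · simp only [val_bind, val_eq, hr, decide_false, Bool.false_eq_true, if_false, val_rem, val_quo,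
        val_mul, val_sub, val_add]
      exact invAux_lt hm (h₁.resolve_right hr) (.inl (Nat.mod_lt _ hm))

lemma inv_val_mul_modEq_one {x m : ℕ} (hm : 0 < m) (h : Nat.Coprime x m) :
    (inv x m).val * x ≡ 1 [MOD m] := by
  have hgcd : Nat.gcd m (x % m) = 1 := by rwa [Nat.gcd_comm, ← Nat.gcd_rec, Nat.gcd_comm]
  rw [← hgcd]
  simp only [inv, val_bind, val_rem]
  refine invAux_val hm ((Nat.mod_lt x hm).trans (Nat.lt_succ_self m)) ?_ ?_
  · simpa using ((Nat.modEq_zero_iff_dvd (n := m)).2 dvd_rfl).symm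
  · simpa using (Nat.mod_modEq x m).symm

lemma inv_lt {m : ℕ} (x : ℕ) (hm : 0 < m) : (inv x m).val < m := by
  simp only [inv, val_bind, val_rem]
  refine invAux_lt hm hm ?_
  rcases Nat.lt_or_ge 1 m with h | h
  · exact .inl h
  · exact .inr (by have := Nat.mod_lt x hm; omega)

lemma invAux_runsIn {m : ℕ} (hm : 0 < m) (hl : 2 * len m ≤ ℓ) :
    ∀ {f n r₀ r₁ t₀ t₁ : ℕ}, r₁ ≤ r₀ → r₀ * r₁ < 2 ^ n → r₀ ≤ m → t₀ ≤ m → t₁ ≤ m →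
    (invAux m f r₀ r₁ t₀ t₁).RunsIn ℓ (8 * n + 1)
  | 0, _, _, _, _, _, _, _, _, _, _ => .pure _
  | f + 1, n, r₀, r₁, t₀, t₁, hr, h, h₀, ht₀, ht₁ => by
    have lm := len_pos m
    have lr₀ := len_mono h₀
    have lr₁ := len_mono (hr.trans h₀)
    have lt₀ := len_mono ht₀
    have lt₁ := len_mono ht₁
    rw [invAux]
    refine .ite_eq (by omega) (by rw [len_zero]; omega) (fun _ => .pure _) fun hr0 => ?_
    have hpos : 0 < r₁ := Nat.pos_of_ne_zero hr0
    obtain _ | n := n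
    · exact absurd h (Nat.not_lt.2 (Nat.mul_pos (hpos.trans_le hr) hpos))
    have lq := len_div_le r₀ r₁
    have lp := len_mul_le (r₀ / r₁) t₁
    have lp' := len_mono (Nat.mod_lt (r₀ / r₁ * t₁) hm).le
    have ln := len_sub_le m (r₀ / r₁ * t₁ % m)
    have ls := len_add_le t₀ (m - r₀ / r₁ * t₁ % m)
    refine .quo ?_ ?_ <| .rem ?_ ?_ <| .mul ?_ ?_ <| .rem ?_ ?_ <| .sub ?_ ?_ <| .add ?_ ?_ <|
      .rem ?_ ?_ <| invAux_runsIn hm hl (Nat.mod_lt r₀ hpos).le (mul_mod_lt_two_pow hpos hr h)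
        (hr.trans h₀) ht₁ (Nat.mod_lt _ hm).le
    all_goals omega

lemma inv_runsIn {x m : ℕ} (hm : 0 < m) (hx : len x ≤ ℓ) (hl : 2 * len m ≤ ℓ) :
    (inv x m).RunsIn ℓ (16 * ℓ + 2) := by
  have hml : len m ≤ ℓ := by omega
  have hlt := Nat.mod_lt x hm
  have h2 : m * (x % m) < 2 ^ (ℓ + ℓ) := by
    rw [pow_add]
    exact Nat.mul_lt_mul'' (lt_two_pow_of_len_le hml) (hlt.trans (lt_two_pow_of_len_le hml))
  rw [inv]
  refine .mono (.rem hx hml <| invAux_runsIn hm ?_ hlt.le h2 le_rfl (Nat.zero_le m) hm) (by omega)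
  omega

/-! ## Square roots -/

lemma sqrtAux_val : ∀ {f n : ℕ}, n ≤ f → (sqrtAux f n).val = Nat.sqrt n
  | 0, n, h => by simp [sqrtAux, Nat.le_zero.1 h]
  | f + 1, n, h => by
    rw [sqrtAux]
    by_cases hn : n = 0
    · simp [hn]
    · simp only [val_bind, val_eq, hn, decide_false, Bool.false_eq_true, if_false, val_quo, val_mul,
        val_add, val_lt, val_ite, val_pure, decide_eq_true_eq]
      rw [sqrtAux_val (by omega)]
      have hle := Nat.sqrt_le (n / 4)
      have hlt : n / 4 < (Nat.sqrt (n / 4) + 1) * (Nat.sqrt (n / 4) + 1) :=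
        Nat.lt_succ_sqrt (n / 4)
      have hdiv : 4 * (n / 4) ≤ n := Nat.mul_div_le n 4
      have hdiv' : n < 4 * (n / 4) + 4 := by omega
      split_ifs with hc <;> rw [Nat.eq_sqrt] <;> constructor <;> nlinarith

lemma sqrt_val (n : ℕ) : (sqrt n).val = Nat.sqrt n := sqrtAux_val le_rfl

lemma two_mul_sqrtAux_add_one_le : ∀ {f n : ℕ}, 0 < n → 2 * (sqrtAux f (n / 4)).val + 1 ≤ n
  | 0, _, hn => hn
  | f + 1, n, hn => by
    rw [sqrtAux]
    by_cases h4 : n / 4 = 0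
    · simp only [val_bind, val_eq, h4, decide_true, if_true, val_pure]
      exact hn
    · simp only [val_bind, val_eq, h4, decide_false, Bool.false_eq_true, if_false, val_quo, val_mul,
        val_add, val_lt, val_ite, val_pure, decide_eq_true_eq]
      have := two_mul_sqrtAux_add_one_le (f := f) (Nat.pos_of_ne_zero h4)
      split_ifs <;> omega

lemma sqrtAux_runsIn : ∀ {f k n : ℕ}, n < 2 ^ k → 2 * len n + 4 ≤ ℓ →
    (sqrtAux f n).RunsIn ℓ (6 * k + 1)
  | 0, _, _, _, _ => .pure _
  | f + 1, k, n, h, hl => by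
    rw [sqrtAux]
    refine .ite_eq (by omega) (by rw [len_zero]; omega) (fun _ => .pure _) fun hn => ?_
    have hpos : 0 < n := Nat.pos_of_ne_zero hn
    obtain _ | k := k
    · omega
    have hs := two_mul_sqrtAux_add_one_le (f := f) hpos
    have ih : (sqrtAux f (n / 4)).RunsIn ℓ (6 * k + 1) :=
      sqrtAux_runsIn (by rw [pow_succ] at h; omega) (by have := len_div_le n 4; omega)
    have ls : len (sqrtAux f (n / 4)).val ≤ len n := len_mono (by omega)
    have ls₀ : len (2 * (sqrtAux f (n / 4)).val) ≤ len n := len_mono (by omega)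
    have ls₁ := len_mono hs
    have lq := len_mul_le (2 * (sqrtAux f (n / 4)).val + 1) (2 * (sqrtAux f (n / 4)).val + 1)
    have := len_one
    have := len_two
    have := len_four
    refine .mono (.quo ?_ ?_ <| .bind ih <| .mul ?_ ?_ <| .add ?_ ?_ <| .mul ?_ ?_ <|
      .ite_lt ?_ ?_ (fun _ => .pure _ (n := 0)) fun _ => .pure _) (by omega)
    all_goals omega

lemma sqrt_runsIn {n : ℕ} (hl : 2 * len n + 4 ≤ ℓ) : (sqrt n).RunsIn ℓ (6 * ℓ + 1) :=
  sqrtAux_runsIn (lt_two_pow_of_len_le (by omega)) hl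

lemma sqrtUp_eq_ceil (n : ℕ) : (sqrtUp n).val = ⌈√(n : ℝ)⌉₊ := by
  have hval : (sqrtUp n).val =
      if Nat.sqrt n * Nat.sqrt n = n then Nat.sqrt n else Nat.sqrt n + 1 := by
    simp [sqrtUp, sqrt_val]
  have hle : (Nat.sqrt n : ℝ) * Nat.sqrt n ≤ n := by exact_mod_cast Nat.sqrt_le n
  have hlt : (n : ℝ) < (Nat.sqrt n + 1) * (Nat.sqrt n + 1) := by
    exact_mod_cast Nat.lt_succ_sqrt n
  rw [hval]
  split_ifs with h
  · have heq : (Nat.sqrt n : ℝ) * Nat.sqrt n = n := by exact_mod_cast h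
    rw [← heq, Real.sqrt_mul_self (Nat.cast_nonneg _), Nat.ceil_natCast]
  · symm
    rw [Nat.ceil_eq_iff (Nat.add_one_ne_zero _), Nat.add_sub_cancel]
    constructor
    · apply Real.lt_sqrt_of_sq_lt
      rw [sq]
      exact lt_of_le_of_ne hle (by exact_mod_cast h)
    · push_cast
      rw [Real.sqrt_le_left (by positivity), sq]
      exact hlt.le

lemma sqrtUp_eq_shift (N a b : ℕ) : (sqrtUp (4 * (a * b * N))).val = HypSieve.shift N a b := by
  rw [sqrtUp_eq_ceil, HypSieve.shift]
  push_cast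
  rw [Real.sqrt_mul zero_le_four, show (4 : ℝ) = 2 ^ 2 by norm_num, Real.sqrt_sq zero_le_two]

lemma sqrtUp_le (n : ℕ) : (sqrtUp n).val ≤ n := by
  rw [sqrtUp_eq_ceil, Nat.ceil_le, Real.sqrt_le_left n.cast_nonneg]
  exact_mod_cast Nat.le_self_pow two_ne_zero n

lemma sqrtUp_runsIn {n : ℕ} (hl : 2 * len n + 4 ≤ ℓ) : (sqrtUp n).RunsIn ℓ (6 * ℓ + 4) := by
  have ls := len_mono (Nat.sqrt_le_self n)
  have lq := len_mono (Nat.sqrt_le n)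
  have := len_one
  rw [sqrtUp]
  refine .mono (.bind (sqrt_runsIn hl) ?_) (by omega : 3 + (6 * ℓ + 1) ≤ _)
  rw [sqrt_val]
  refine .mul ?_ ?_ <| .ite_eq ?_ ?_ (fun _ => .pure _) fun _ => .last_add ?_ ?_
  all_goals omega

end

/-! ## Primes -/

section

variable {ℓ : ℕ}

lemma noDivisor_val (n : ℕ) :
    ∀ d : ℕ, (noDivisor n d).val = true ↔ ∀ e, 2 ≤ e → e ≤ d → ¬ e ∣ n
  | 0 => iff_of_true rfl fun e he he' => absurd (he.trans he') (by decide)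
  | 1 => iff_of_true rfl fun e he he' => absurd (he.trans he') (by decide)
  | d + 2 => by
    rw [noDivisor]
    simp only [val_bind, val_eq, val_rem, val_ite, val_pure, decide_eq_true_eq,
      ← Nat.dvd_iff_mod_eq_zero]
    split_ifs with h
    · simp only [false_iff]
      exact fun H => H _ (by omega) le_rfl h
    · rw [noDivisor_val n (d + 1)]
      refine ⟨fun H e he he' => ?_, fun H e he he' => H e he (by omega)⟩
      obtain hlt | rfl := he'.lt_or_eq
      exacts [H e he (by omega), h]

lemma isPrime_val (n : ℕ) : (isPrime n).val = decide n.Prime := by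
  rw [isPrime]
  simp only [val_bind, val_lt, val_ite, val_pure, decide_eq_true_eq, val_sub]
  split_ifs with h
  · exact (decide_eq_false fun hp => h.not_ge hp.two_le).symm
  · rw [Bool.eq_iff_iff, noDivisor_val, decide_eq_true_eq, Nat.prime_def_lt']
    exact ⟨fun H => ⟨by omega, fun e he he' => H e he (by omega)⟩,
      fun H e he he' => H.2 e he (by omega)⟩

lemma noDivisor_runsIn {n : ℕ} (hn : len n ≤ ℓ) : ∀ {d : ℕ}, d < n →
    (noDivisor n d).RunsIn ℓ (3 * d)
  | 0, _ => .pure _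
  | 1, _ => .pure _
  | d + 2, h => by
    have ld := (len_mono h.le).trans hn
    have l0 := (len_mono (Nat.zero_le n)).trans hn
    rw [noDivisor]
    exact .mono (.rem hn ld <| .ite_eq ((len_mod_le _ _).trans hn) l0 (fun _ => .pure _) fun _ =>
      .read ld <| noDivisor_runsIn hn (by omega)) (by omega)

lemma isPrime_runsIn {n : ℕ} (hl : len n + 3 ≤ ℓ) : (isPrime n).RunsIn ℓ (3 * (n + 1)) := by
  have := len_one
  have := len_two
  rw [isPrime]
  refine .mono (.ite_lt ?_ ?_ (fun _ => .pure _) fun h => .sub ?_ ?_ <|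
    noDivisor_runsIn ?_ (by omega)) (by omega : 3 * (n - 1) + 1 + 1 ≤ _)
  all_goals omega

lemma primesIn_val (lo : ℕ) : ∀ n : ℕ, (primesIn lo n).val =
    ((List.range (n + 1)).filter fun r => lo < r ∧ r.Prime).reverse
  | 0 => by simp [primesIn, Nat.not_prime_zero]
  | n + 1 => by
    rw [primesIn, List.range_succ, List.filter_append, List.reverse_append]
    simp only [val_bind, val_lt, val_ite, val_pure, decide_eq_true_eq, isPrime_val, val_cons,
      primesIn_val lo n, List.filter_cons, List.filter_nil]
    split_ifs with hlo hp hboth hboth hboth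
    · rfl
    · exact absurd ⟨hlo, hp⟩ hboth
    · exact absurd hboth.2 hp
    · rfl
    · exact absurd hboth.1 hlo
    · symm
      simp only [List.reverse_nil, List.nil_append, List.reverse_eq_nil_iff, List.filter_eq_nil_iff,
        List.mem_range, decide_eq_true_eq]
      omega

lemma mem_primesIn {lo n r : ℕ} : r ∈ (primesIn lo n).val ↔ lo < r ∧ r ≤ n ∧ r.Prime := by
  rw [primesIn_val]
  simp only [List.mem_reverse, List.mem_filter, List.mem_range, Nat.lt_succ_iff, decide_eq_true_eq]
  tauto

lemma nodup_primesIn (lo n : ℕ) : (primesIn lo n).val.Nodup := by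
  rw [primesIn_val]
  exact List.nodup_reverse.2 (List.nodup_range.filter _)

lemma prod_val : ∀ l : List ℕ, (prod l).val = l.prod
  | [] => rfl
  | x :: l => by rw [prod, List.prod_cons, ← prod_val l]; rfl

lemma prod_primesIn (lo n : ℕ) : (primesIn lo n).val.prod = HypSieve.primeProd lo n := by
  have h : (Finset.Ioc lo n).filter Nat.Prime = (primesIn lo n).val.toFinset := by
    ext r
    simp only [Finset.mem_filter, Finset.mem_Ioc, List.mem_toFinset, mem_primesIn, and_assoc]
  rw [HypSieve.primeProd, h, List.prod_toFinset _ (nodup_primesIn lo n), List.map_id']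

lemma primesIn_runsIn {B lo : ℕ} (hl : len B + 3 ≤ ℓ) (hlo : lo ≤ B) : ∀ {n : ℕ}, n ≤ B →
    (primesIn lo n).RunsIn ℓ (n * (3 * (B + 2)))
  | 0, _ => .pure _
  | n + 1, h => by
    have ln := len_mono h
    have llo := len_mono hlo
    have ih := primesIn_runsIn hl hlo (n := n) (by omega)
    rw [primesIn]
    refine .mono (.read ?_ <| .ite_lt ?_ ?_ (fun _ => .bind (isPrime_runsIn ?_) <| .bind ih <|
      .ite (fun _ => .last_cons ?_ _) fun _ => .pure _) fun _ => .pure _)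
      (by linarith : 1 + n * (3 * (B + 2)) + 3 * (n + 1 + 1) + 1 + 1 ≤ _)
    all_goals omega

lemma prod_runsIn : ∀ {l : List ℕ}, (∀ x ∈ l, 0 < x) → len l.prod ≤ ℓ →
    (prod l).RunsIn ℓ (2 * l.length)
  | [], _, _ => .pure _
  | x :: l, h, hl => by
    rw [List.forall_mem_cons] at h
    rw [List.prod_cons] at hl
    have lx := len_mono (Nat.le_mul_of_pos_right x (List.prod_pos h.2))
    have lp := len_mono (Nat.le_mul_of_pos_left l.prod h.1)
    rw [prod]
    refine .mono (.read (by omega) <| .bind (prod_runsIn h.2 (by omega)) <| .last_mul (by omega) ?_)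
      (by rw [List.length_cons]; omega)
    rw [prod_val]
    omega

lemma firstDivisor_val (N : ℕ) : ∀ l : List ℕ, (firstDivisor N l).val = l.find? (· ∣ N)
  | [] => rfl
  | x :: l => by
    rw [firstDivisor]
    simp only [val_bind, val_rem, val_eq, val_ite, val_pure, decide_eq_true_eq,
      firstDivisor_val N l, List.find?_cons, ← Nat.dvd_iff_mod_eq_zero]
    split_ifs with h <;> simp [h]

lemma firstDivisor_runsIn {N : ℕ} (hN : len N ≤ ℓ) : ∀ {l : List ℕ}, (∀ x ∈ l, len x ≤ ℓ) →
    (firstDivisor N l).RunsIn ℓ (3 * l.length)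
  | [], _ => .pure _
  | x :: l, h => by
    rw [List.forall_mem_cons] at h
    have l0 := (len_mono (Nat.zero_le N)).trans hN
    rw [firstDivisor]
    exact .mono (.read h.1 <| .rem hN h.1 <| .ite_eq ((len_mod_le _ _).trans hN) l0
      (fun _ => .pure _) fun _ => firstDivisor_runsIn hN h.2) (by rw [List.length_cons]; omega)

/-! ## The sieve modulo a prime -/

/-- `t` represents an element of the shifted sieve set modulo `m` for the factor `k` and the shift
`L`: the congruences `x y ≡ N` and `k x + y ≡ t + L` are solvable. -/
def InSieve (m N k L t : ℕ) : Prop :=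
  ∃ x y : ℕ, x * y ≡ N [MOD m] ∧ k * x + y ≡ t + L [MOD m]

lemma existsY_val (r N k L t x : ℕ) : ∀ y : ℕ, (existsY r N k L t x y).val = true ↔
    ∃ y' < y, x * y' ≡ N [MOD r] ∧ k * x + y' ≡ t + L [MOD r]
  | 0 => by simp [existsY]
  | y + 1 => by
    rw [existsY, Nat.exists_lt_succ_right, ← existsY_val r N k L t x y]
    simp only [val_bind, val_mul, val_rem, val_add, val_eq, val_ite, val_pure, Bool.and_eq_true,
      decide_eq_true_eq, Nat.ModEq]
    split_ifs with h <;> simp [h]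

lemma existsXY_val (r N k L t : ℕ) : ∀ x : ℕ, (existsXY r N k L t x).val = true ↔
    ∃ x' < x, ∃ y < r, x' * y ≡ N [MOD r] ∧ k * x' + y ≡ t + L [MOD r]
  | 0 => by simp [existsXY]
  | x + 1 => by
    rw [existsXY, Nat.exists_lt_succ_right, ← existsXY_val r N k L t x, ← existsY_val]
    simp only [val_bind, val_ite, val_pure]
    split_ifs with h <;> simp [h]

lemma existsXY_self_val {r : ℕ} (hr : 0 < r) (N k L t : ℕ) :
    (existsXY r N k L t r).val = true ↔ InSieve r N k L t := by
  rw [existsXY_val]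
  constructor
  · rintro ⟨x, _, y, _, h⟩
    exact ⟨x, y, h⟩
  · rintro ⟨x, y, hxy, hkxy⟩
    exact ⟨x % r, Nat.mod_lt _ hr, y % r, Nat.mod_lt _ hr,
      ((Nat.mod_modEq x r).mul (Nat.mod_modEq y r)).trans hxy,
      (((Nat.mod_modEq x r).mul_left k).add (Nat.mod_modEq y r)).trans hkxy⟩

lemma residuesBelow_val (r N k L : ℕ) : ∀ t : ℕ, (residuesBelow r N k L t).val =
    ((List.range t).filter fun s => (existsXY r N k L s r).val).reverse
  | 0 => rfl
  | t + 1 => by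
    rw [residuesBelow, List.range_succ, List.filter_append, List.reverse_append]
    simp only [val_bind, val_ite, val_pure, val_cons, residuesBelow_val r N k L t, List.filter_cons,
      List.filter_nil]
    split_ifs <;> rfl

lemma mem_residuesBelow {r : ℕ} (hr : 0 < r) {N k L t s : ℕ} :
    s ∈ (residuesBelow r N k L t).val ↔ s < t ∧ InSieve r N k L s := by
  simp only [residuesBelow_val, List.mem_reverse, List.mem_filter, List.mem_range,
    existsXY_self_val hr]

lemma nodup_residuesBelow (r N k L t : ℕ) : (residuesBelow r N k L t).val.Nodup := by
  rw [residuesBelow_val]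
  exact List.nodup_reverse.2 (List.nodup_range.filter _)

lemma residues_val (N k L : ℕ) : ∀ l : List ℕ,
    (residues N k L l).val = l.map (fun r => (r, (residuesBelow r N k L r).val))
  | [] => rfl
  | r :: l => by rw [residues, List.map_cons, ← residues_val N k L l]; rfl

lemma existsY_runsIn {r N k L t x : ℕ} (ht : t < r) (hx : x < r)
    (hl : 3 * len r + len N + len k + len L ≤ ℓ) : ∀ {y : ℕ}, y ≤ r →
    (existsY r N k L t x y).RunsIn ℓ (11 * y)
  | 0, _ => .pure _
  | y + 1, h => by
    have lt := len_mono ht.le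
    have lx := len_mono hx.le
    have ly := len_mono (Nat.le_of_succ_le h)
    have ly' := len_mono h
    have lxy := len_mul_le x y
    have lkx := len_mul_le k x
    have lkxy := len_add_le (k * x) y
    have ltL := len_add_le t L
    have lxy' := len_mod_le (x * y) r
    have lN := len_mod_le N r
    have lkxy' := len_mod_le (k * x + y) r
    have ltL' := len_mod_le (t + L) r
    rw [existsY]
    refine .mono (.read ?_ <| .mul ?_ ?_ <| .rem ?_ ?_ <| .rem ?_ ?_ <| .mul ?_ ?_ <| .add ?_ ?_ <|
      .rem ?_ ?_ <| .add ?_ ?_ <| .rem ?_ ?_ <| .eq ?_ ?_ <| .eq ?_ ?_ <| .ite (fun _ => .pure _)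
        fun _ => existsY_runsIn ht hx hl (Nat.le_of_succ_le h)) (by omega)
    all_goals omega

lemma existsXY_runsIn {r N k L t : ℕ} (ht : t < r)
    (hl : 3 * len r + len N + len k + len L ≤ ℓ) : ∀ {x : ℕ}, x ≤ r →
    (existsXY r N k L t x).RunsIn ℓ (x * (11 * (r + 1)))
  | 0, _ => .pure _
  | x + 1, h => by
    have lx := len_mono h
    rw [existsXY]
    exact .mono (.read (by omega) <| .bind (existsY_runsIn ht h hl le_rfl) <|
      .ite (fun _ => .pure _) fun _ => existsXY_runsIn ht hl (Nat.le_of_succ_le h)) (by linarith)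

lemma residuesBelow_runsIn {r N k L : ℕ} (hl : 3 * len r + len N + len k + len L ≤ ℓ) :
    ∀ {t : ℕ}, t ≤ r → (residuesBelow r N k L t).RunsIn ℓ (t * (11 * (r + 1) ^ 2))
  | 0, _ => .pure _
  | t + 1, h => by
    have lt := len_mono h
    have lt' := len_mono (Nat.le_of_succ_le h)
    rw [residuesBelow]
    exact .mono (.read (by omega) <| .bind (existsXY_runsIn h hl le_rfl) <|
      .bind (residuesBelow_runsIn hl (Nat.le_of_succ_le h)) <|
      .ite (fun _ => .last_cons (by omega) _) fun _ => .pure _) (by nlinarith)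

lemma residues_runsIn {B N k L : ℕ} (hl : 3 * len B + len N + len k + len L ≤ ℓ) :
    ∀ {l : List ℕ}, (∀ r ∈ l, r ≤ B) → (residues N k L l).RunsIn ℓ (l.length * (11 * (B + 1) ^ 3))
  | [], _ => .pure _
  | r :: l, h => by
    rw [List.forall_mem_cons] at h
    have lr := len_mono h.1
    have hB : r * (r + 1) ^ 2 + 1 ≤ (B + 1) ^ 3 :=
      le_trans (by nlinarith) (Nat.pow_le_pow_left (Nat.succ_le_succ h.1) 3)
    rw [residues]
    exact .mono (.read (by omega) <| .bind (residuesBelow_runsIn (by omega) le_rfl) <|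
      .bind (residues_runsIn hl h.2) <| .pure _ (n := 0)) (by rw [List.length_cons]; nlinarith)

end

/-! ## Chinese remaindering of the sieve -/

section InSieve

variable {m m' N k k' L t t' : ℕ}

lemma InSieve.of_dvd (h : InSieve m N k L t) (hm : m' ∣ m) : InSieve m' N k L t := by
  obtain ⟨x, y, hxy, hkxy⟩ := h
  exact ⟨x, y, hxy.of_dvd hm, hkxy.of_dvd hm⟩

lemma InSieve.mul (co : m.Coprime m') (h : InSieve m N k L t) (h' : InSieve m' N k L t) :
    InSieve (m * m') N k L t := by
  obtain ⟨x, y, hxy, hkxy⟩ := h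
  obtain ⟨x', y', hxy', hkxy'⟩ := h'
  obtain ⟨X, hX, hX'⟩ := Nat.chineseRemainder co x x'
  obtain ⟨Y, hY, hY'⟩ := Nat.chineseRemainder co y y'
  simp only [InSieve, ← Nat.modEq_and_modEq_iff_modEq_mul co]
  exact ⟨X, Y, ⟨(hX.mul hY).trans hxy, (hX'.mul hY').trans hxy'⟩,
    ((hX.mul_left k).add hY).trans hkxy, ((hX'.mul_left k).add hY').trans hkxy'⟩

lemma InSieve.congr (h : InSieve m N k L t) (ht : t ≡ t' [MOD m]) : InSieve m N k L t' := by
  obtain ⟨x, y, hxy, hkxy⟩ := h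
  exact ⟨x, y, hxy, hkxy.trans (ht.add_right L)⟩

lemma InSieve.congr_coeff (h : InSieve m N k L t) (hk : k ≡ k' [MOD m]) : InSieve m N k' L t := by
  obtain ⟨x, y, hxy, hkxy⟩ := h
  exact ⟨x, y, hxy, ((hk.symm.mul_right x).add_right y).trans hkxy⟩

lemma exists_inSieve (hm : 0 < m) (N k L : ℕ) : ∃ t < m, InSieve m N k L t := by
  refine ⟨(k + N + (m * L - L)) % m, Nat.mod_lt _ hm, InSieve.congr ⟨1, N, ?_, ?_⟩
    (Nat.mod_modEq _ _).symm⟩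
  · rw [one_mul]
  · rw [add_assoc (k + N), Nat.sub_add_cancel (Nat.le_mul_of_pos_left L hm), mul_one]
    simp [Nat.ModEq]

lemma inSieve_prod_iff : ∀ {l : List ℕ}, l.Pairwise Nat.Coprime →
    (InSieve l.prod N k L t ↔ ∀ r ∈ l, InSieve r N k L t)
  | [], _ => by
    simp only [List.prod_nil, List.not_mem_nil, false_implies, implies_true, iff_true]
    exact ⟨0, 0, Nat.modEq_one, Nat.modEq_one⟩
  | r :: l, h => by
    rw [List.pairwise_cons] at h
    rw [List.prod_cons, List.forall_mem_cons, ← inSieve_prod_iff h.2]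
    exact ⟨fun H => ⟨H.of_dvd (dvd_mul_right _ _), H.of_dvd (dvd_mul_left _ _)⟩,
      fun H => H.1.mul (Nat.coprime_list_prod_right_iff.2 h.1) H.2⟩

end InSieve

/-! ## The odometer -/

/-- The coefficient `M_r` of the Chinese Remainder Theorem, congruent to `1` modulo `r` and to `0`
modulo `m / r`. -/
def coef (m r : ℕ) : ℕ := m / r * (inv (m / r) r).val

/-- The distances of consecutive elements of `p :: l`, times `c`, modulo `m`. They are taken to be
in `[0, 2r)`, so that no negative numbers occur. -/
def steps (r c m : ℕ) : ℕ → List ℕ → List ℕ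
  | _, [] => []
  | p, x :: l => (x + (r - p)) * c % m :: steps r c m x l

/-- The distances of cyclically consecutive elements of `A`, times `M_r`, modulo `m`. -/
def dists (m r : ℕ) (A : List ℕ) : Array ℕ := (steps r (coef m r) m (A.getLastD 0) A).toArray

/-- The sum `∑ a_r M_r` where the indices of the `a_r` in their lists are the digits of `j` in the
mixed radix system given by the lengths of the lists. -/
def combination (m : ℕ) : List (ℕ × List ℕ) → ℕ → ℕ
  | [], _ => 0
  | (r, A) :: R, j => A.getD (j % A.length) 0 * coef m r + combination m R (j / A.length)

/-- The position of the wheels of the odometer after `j` turns. -/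
def wheelsAt (m : ℕ) : List (ℕ × List ℕ) → ℕ → List Wheel
  | [], _ => []
  | (r, A) :: R, j => ⟨j % A.length, A.length, dists m r A⟩ :: wheelsAt m R (j / A.length)

/-- The number of sums `∑ a_r M_r`. -/
def numCombinations (R : List (ℕ × List ℕ)) : ℕ := (R.map fun p => p.2.length).prod

/-- The lists of `R` are nonempty and consist of residues to moduli that divide `m`. -/
structure Admissible (m : ℕ) (R : List (ℕ × List ℕ)) : Prop where
  ne_nil : ∀ p ∈ R, p.2 ≠ []
  lt : ∀ p ∈ R, ∀ a ∈ p.2, a < p.1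
  dvd : ∀ p ∈ R, p.1 ∣ m

lemma Admissible.tail {m : ℕ} {p : ℕ × List ℕ} {R : List (ℕ × List ℕ)}
    (h : Admissible m (p :: R)) : Admissible m R :=
  ⟨(List.forall_mem_cons.1 h.ne_nil).2, (List.forall_mem_cons.1 h.lt).2,
    (List.forall_mem_cons.1 h.dvd).2⟩

lemma Admissible.numCombinations_pos {m : ℕ} {R : List (ℕ × List ℕ)} (h : Admissible m R) :
    0 < numCombinations R := by
  refine List.prod_pos fun n hn => ?_
  obtain ⟨p, hp, rfl⟩ := List.mem_map.1 hn
  exact List.length_pos_of_ne_nil (h.ne_nil p hp)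

@[simp] lemma length_steps (r c m : ℕ) :
    ∀ (p : ℕ) (l : List ℕ), (steps r c m p l).length = l.length
  | _, [] => rfl
  | _, x :: l => congrArg (· + 1) (length_steps r c m x l)

lemma getD_steps (r c m : ℕ) : ∀ (p : ℕ) (l : List ℕ) (i : ℕ), i < l.length →
    (steps r c m p l).getD i 0 = (l.getD i 0 + (r - (p :: l).getD i 0)) * c % m
  | _, _ :: _, 0, _ => rfl
  | _, x :: l, i + 1, h => getD_steps r c m x l i (Nat.lt_of_succ_lt_succ h)

lemma lastOf_val : ∀ (p : ℕ) (l : List ℕ), (lastOf p l).val = l.getLastD p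
  | _, [] => rfl
  | p, x :: l => by rw [lastOf, val_bind, lastOf_val x l, List.getLastD_cons]

lemma getLastD_eq_getD_length : ∀ (p : ℕ) (l : List ℕ), l.getLastD p = (p :: l).getD l.length 0
  | _, [] => rfl
  | p, x :: l => by
    rw [List.getLastD_cons, getLastD_eq_getD_length x l, List.length_cons, List.getD_cons_succ]

lemma distances_val (r c m : ℕ) : ∀ (p : ℕ) (l : List ℕ) (D : Array ℕ),
    (distances r c m p l D).val = D ++ (steps r c m p l).toArray
  | _, [], D => by simp [distances, steps]
  | p, x :: l, D => by
    rw [distances]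
    simp only [val_bind, val_sub, val_add, val_mul, val_rem, val_push, distances_val r c m x l]
    simp [steps]

lemma dvd_mul_coef {m r : ℕ} (h : r ∣ m) : m ∣ r * coef m r := by
  rw [coef, ← mul_assoc, Nat.mul_div_cancel' h]
  exact dvd_mul_right _ _

lemma add_one_mod_div {κ : ℕ} (hκ : 0 < κ) (j : ℕ) :
    ((j + 1) % κ = 0 ∧ (j + 1) / κ = j / κ + 1 ∧ j % κ = κ - 1) ∨
      ((j + 1) % κ = j % κ + 1 ∧ (j + 1) / κ = j / κ) := by
  have hlt := Nat.mod_lt j hκ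
  have hj := Nat.mod_add_div j κ
  obtain h | h := (Nat.succ_le_of_lt hlt).eq_or_lt
  · have := (Nat.div_mod_unique hκ (a := j + 1) (c := 0) (d := j / κ + 1)).2 ⟨by linarith, hκ⟩
    exact .inl ⟨this.2, this.1, by omega⟩
  · have := (Nat.div_mod_unique hκ (a := j + 1) (c := j % κ + 1) (d := j / κ)).2 ⟨by linarith, h⟩
    exact .inr ⟨this.2, this.1⟩

lemma getD_getLastD_cons {A : List ℕ} (hA : A ≠ []) (j : ℕ) :
    (A.getLastD 0 :: A).getD ((j + 1) % A.length) 0 = A.getD (j % A.length) 0 := by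
  obtain ⟨hmod, -, hj⟩ | ⟨hmod, -⟩ := add_one_mod_div (List.length_pos_of_ne_nil hA) j
  · obtain ⟨a, A', rfl⟩ := List.exists_cons_of_ne_nil hA
    rw [hmod, hj, List.getD_cons_zero, List.getLastD_cons, getLastD_eq_getD_length]
    rfl
  · rw [hmod, List.getD_cons_succ]

lemma getD_mod_length_mem {A : List ℕ} (hA : A ≠ []) (j : ℕ) :
    A.getD (j % A.length) 0 ∈ A := by
  have hlt := Nat.mod_lt j (List.length_pos_of_ne_nil hA)
  rw [List.getD_eq_getElem _ _ hlt]
  exact List.getElem_mem hlt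

lemma getD_dists {m r : ℕ} {A : List ℕ} (hA : A ≠ []) (j : ℕ) :
    (dists m r A).getD ((j + 1) % A.length) 0 =
      (A.getD ((j + 1) % A.length) 0 + (r - A.getD (j % A.length) 0)) * coef m r % m := by
  rw [← getD_getLastD_cons hA j,
    ← getD_steps r _ m _ _ _ (Nat.mod_lt (j + 1) (List.length_pos_of_ne_nil hA))]
  simp [dists]

lemma add_getD_dists_modEq {m r : ℕ} {A : List ℕ} (hA : A ≠ []) (hr : ∀ a ∈ A, a < r) (hm : r ∣ m)
    (j : ℕ) :
    A.getD (j % A.length) 0 * coef m r + (dists m r A).getD ((j + 1) % A.length) 0 ≡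
      A.getD ((j + 1) % A.length) 0 * coef m r [MOD m] := by
  have hle := (hr _ (getD_mod_length_mem hA j)).le
  rw [getD_dists hA]
  refine ((Nat.mod_modEq _ m).add_left _).trans ?_
  rw [← add_mul, add_left_comm, Nat.add_sub_cancel' hle, add_mul]
  exact ((Nat.modEq_zero_iff_dvd.2 (dvd_mul_coef hm)).add_left _).trans (by rw [add_zero])

lemma turn_val {m : ℕ} (hm : 0 < m) : ∀ {R : List (ℕ × List ℕ)} {e x j : ℕ}, Admissible m R →
    x < m → x ≡ e + combination m R j [MOD m] →
    (turn m x (wheelsAt m R j)).val.2 = wheelsAt m R (j + 1) ∧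
    (turn m x (wheelsAt m R j)).val.1 < m ∧
    (turn m x (wheelsAt m R j)).val.1 ≡ e + combination m R (j + 1) [MOD m]
  | [], _, _, _, _, hx, h => ⟨rfl, hx, h⟩
  | (r, A) :: R, e, x, j, hR, _, h => by
    have hA : A ≠ [] := hR.ne_nil _ List.mem_cons_self
    have hstep := add_getD_dists_modEq hA (List.forall_mem_cons.1 hR.lt).1
      (List.forall_mem_cons.1 hR.dvd).1 j
    have hlt := Nat.mod_lt (x + (dists m r A).getD ((j + 1) % A.length) 0) hm
    have hx' : (x + (dists m r A).getD ((j + 1) % A.length) 0) % m ≡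
        (e + A.getD ((j + 1) % A.length) 0 * coef m r) + combination m R (j / A.length)
          [MOD m] := by
      refine (Nat.mod_modEq _ _).trans ((h.add_right _).trans ?_)
      convert (hstep.add_left e).add_right (combination m R (j / A.length)) using 1
      rw [combination]
      ring
    simp only [wheelsAt, combination, turn, val_bind, val_add, val_rem, val_get, val_eq, val_ite,
      Nat.mod_add_mod, decide_eq_true_eq, ← add_assoc]
    obtain ⟨hmod, hdiv, -⟩ | ⟨hmod, hdiv⟩ := add_one_mod_div (List.length_pos_of_ne_nil hA) j
    · rw [if_pos hmod, hdiv]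
      obtain ⟨hW, hxm, hxe⟩ := turn_val hm hR.tail hlt hx'
      exact ⟨congrArg _ hW, hxm, hxe⟩
    · rw [if_neg (by omega), hdiv]
      exact ⟨rfl, hlt, hx'⟩

lemma cycle_val {m : ℕ} (hm : 0 < m) {R : List (ℕ × List ℕ)} (hR : Admissible m R) :
    ∀ {n x j : ℕ}, x < m → x ≡ combination m R j [MOD m] →
    (cycle m n x (wheelsAt m R j)).val =
      (List.range n).map fun i => combination m R (j + 1 + i) % m
  | 0, _, _, _, _ => rfl
  | n + 1, x, j, hx, h => by
    obtain ⟨hW, hlt, hmod⟩ := turn_val hm (e := 0) hR hx (by rwa [zero_add])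
    rw [zero_add] at hmod
    simp only [cycle, val_bind, val_cons]
    rw [hW, cycle_val hm hR hlt hmod, List.range_succ_eq_map, List.map_cons, List.map_map]
    congr 1
    · exact (Nat.mod_eq_of_lt hlt).symm.trans hmod
    · exact List.map_congr_left fun i _ => by simp only [Function.comp]; congr 2; omega

lemma wheels_val {m : ℕ} : ∀ {R : List (ℕ × List ℕ)}, Admissible m R →
    (wheels m R).val = (combination m R 0 % m, numCombinations R, wheelsAt m R 0)
  | [], _ => by simp [wheels, combination, numCombinations, wheelsAt]
  | (r, []) :: R, h => absurd rfl (h.ne_nil (r, []) List.mem_cons_self)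
  | (r, a :: A) :: R, h => by
    simp only [wheels, val_bind, val_quo, val_mul, lastOf_val, distances_val, val_length,
      wheels_val h.tail, val_add, val_rem, val_pure]
    simp only [combination, numCombinations, wheelsAt, dists, coef, List.getLastD_cons]
    simp

lemma chinese_val {m : ℕ} (hm : 0 < m) {R : List (ℕ × List ℕ)} (hR : Admissible m R) :
    (chinese m R).val = (List.range (numCombinations R)).map fun j => combination m R j % m := by
  have hne := hR.numCombinations_pos.ne'
  obtain ⟨n, hn⟩ := Nat.exists_eq_succ_of_ne_zero hne
  simp only [chinese, val_bind, wheels_val hR, val_eq, decide_eq_true_eq, hne, if_false, val_sub,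
    val_cons]
  rw [cycle_val hm hR (Nat.mod_lt _ hm) (Nat.mod_modEq _ _), hn, List.range_succ_eq_map,
    List.map_cons, List.map_map]
  congr 1
  exact List.map_congr_left fun i _ => by simp only [Function.comp]; congr 2; omega

/-- The coefficients `M_r` behave like idempotents of the Chinese Remainder Theorem. -/
structure Separated (m : ℕ) (R : List (ℕ × List ℕ)) : Prop where
  coef_modEq : ∀ p ∈ R, coef m p.1 ≡ 1 [MOD p.1]
  pairwise : R.Pairwise fun p q => p.1 ∣ coef m q.1 ∧ q.1 ∣ coef m p.1

lemma Separated.tail {m : ℕ} {p : ℕ × List ℕ} {R : List (ℕ × List ℕ)}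
    (h : Separated m (p :: R)) : Separated m R :=
  ⟨(List.forall_mem_cons.1 h.coef_modEq).2, (List.pairwise_cons.1 h.pairwise).2⟩

lemma dvd_combination {m r : ℕ} : ∀ {R : List (ℕ × List ℕ)} {j : ℕ}, (∀ p ∈ R, r ∣ coef m p.1) →
    r ∣ combination m R j
  | [], _, _ => dvd_zero r
  | (_, _) :: _, _, h =>
    dvd_add ((List.forall_mem_cons.1 h).1.mul_left _) (dvd_combination (List.forall_mem_cons.1 h).2)

section Separated

variable {m r : ℕ} {A : List ℕ} {R : List (ℕ × List ℕ)}

lemma Separated.combination_modEq_head (h : Separated m ((r, A) :: R)) (j : ℕ) :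
    combination m ((r, A) :: R) j ≡ A.getD (j % A.length) 0 [MOD r] := by
  have hr : coef m r ≡ 1 [MOD r] := h.coef_modEq (r, A) List.mem_cons_self
  have hdvd : r ∣ combination m R (j / A.length) :=
    dvd_combination fun p hp => ((List.pairwise_cons.1 h.pairwise).1 p hp).1
  rw [combination]
  simpa using (hr.mul_left (A.getD (j % A.length) 0)).add (Nat.modEq_zero_iff_dvd.2 hdvd)

lemma Separated.combination_modEq_tail (h : Separated m ((r, A) :: R)) (j : ℕ) {p : ℕ × List ℕ}
    (hp : p ∈ R) :
    combination m ((r, A) :: R) j ≡ combination m R (j / A.length) [MOD p.1] := by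
  have hdvd : p.1 ∣ A.getD (j % A.length) 0 * coef m r :=
    (((List.pairwise_cons.1 h.pairwise).1 p hp).2).mul_left _
  rw [combination]
  exact ((Nat.modEq_zero_iff_dvd.2 hdvd).add_right _).trans (by rw [zero_add])

end Separated

lemma exists_mem_combination_modEq {m : ℕ} : ∀ {R : List (ℕ × List ℕ)} {j : ℕ},
    Admissible m R → Separated m R → ∀ p ∈ R, ∃ a ∈ p.2, combination m R j ≡ a [MOD p.1]
  | (_, A) :: R, j, hR, hs, p, hp => by
    obtain rfl | hp := List.mem_cons.1 hp
    · exact ⟨_, getD_mod_length_mem (hR.ne_nil _ List.mem_cons_self) j, hs.combination_modEq_head j⟩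
    · obtain ⟨a, ha, h⟩ := exists_mem_combination_modEq (j := j / A.length) hR.tail hs.tail p hp
      exact ⟨a, ha, (hs.combination_modEq_tail j hp).trans h⟩

lemma exists_combination_modEq {m y : ℕ} : ∀ {R : List (ℕ × List ℕ)},
    Separated m R → (∀ p ∈ R, y % p.1 ∈ p.2) →
    ∃ j < numCombinations R, ∀ p ∈ R, combination m R j ≡ y [MOD p.1]
  | [], _, _ => ⟨0, one_pos, fun _ hp => absurd hp List.not_mem_nil⟩
  | (r, A) :: R, hs, hy => by
    rw [List.forall_mem_cons] at hy
    obtain ⟨j, hj, h⟩ := exists_combination_modEq hs.tail hy.2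
    obtain ⟨i, hi : i < A.length, hiy : A[i] = y % r⟩ := List.getElem_of_mem hy.1
    obtain ⟨hdiv, hmod⟩ := (Nat.div_mod_unique (by omega : 0 < A.length)
      (a := i + A.length * j) (c := i) (d := j)).2 ⟨rfl, hi⟩
    refine ⟨i + A.length * j, ?_, List.forall_mem_cons.2 ⟨?_, fun p hp => ?_⟩⟩
    · have := Nat.mul_le_mul_left A.length (Nat.succ_le_of_lt hj)
      simp only [numCombinations, List.map_cons, List.prod_cons] at this ⊢
      linarith
    · refine (hs.combination_modEq_head _).trans ?_
      rw [hmod, List.getD_eq_getElem _ _ hi, hiy]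
      exact Nat.mod_modEq _ _
    · rw [← hdiv] at h
      exact (hs.combination_modEq_tail _ hp).trans (h p hp)

lemma combination_injective {m : ℕ} : ∀ {R : List (ℕ × List ℕ)} {j j' : ℕ},
    Admissible m R → Separated m R → (∀ p ∈ R, p.2.Nodup) →
    j < numCombinations R → j' < numCombinations R →
    (∀ p ∈ R, combination m R j ≡ combination m R j' [MOD p.1]) → j = j'
  | [], _, _, _, _, _, hj, hj', _ => (Nat.lt_one_iff.1 hj).trans (Nat.lt_one_iff.1 hj').symm
  | (r, A) :: R, j, j', hR, hs, hnd, hj, hj', h => by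
    rw [List.forall_mem_cons] at hnd h
    have hA : A ≠ [] := hR.ne_nil _ List.mem_cons_self
    have hlt := (List.forall_mem_cons.1 hR.lt).1
    have hdiv : j / A.length = j' / A.length :=
      combination_injective hR.tail hs.tail hnd.2 (Nat.div_lt_of_lt_mul hj)
        (Nat.div_lt_of_lt_mul hj') fun p hp => (hs.combination_modEq_tail j hp).symm.trans
          ((h.2 p hp).trans (hs.combination_modEq_tail j' hp))
    have hmem : A.getD (j % A.length) 0 = A.getD (j' % A.length) 0 :=
      ((hs.combination_modEq_head j).symm.trans
        (h.1.trans (hs.combination_modEq_head j'))).eq_of_lt_of_lt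
        (hlt _ (getD_mod_length_mem hA j)) (hlt _ (getD_mod_length_mem hA j'))
    have hpos := List.length_pos_of_ne_nil hA
    have hmod : j % A.length = j' % A.length := by
      rwa [List.getD_eq_getElem _ _ (Nat.mod_lt j hpos),
        List.getD_eq_getElem _ _ (Nat.mod_lt j' hpos), hnd.1.getElem_inj_iff] at hmem
    rw [← Nat.div_add_mod j A.length, ← Nat.div_add_mod j' A.length, hdiv, hmod]

/-! ## The sieve modulo a product of primes -/

section Residues

variable {l : List ℕ}

lemma admissible_residues (hl : ∀ r ∈ l, 0 < r) (N k L : ℕ) :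
    Admissible l.prod (residues N k L l).val := by
  rw [residues_val]
  refine ⟨List.forall_mem_map.2 fun r hr => ?_, List.forall_mem_map.2 fun r hr a ha => ?_,
    List.forall_mem_map.2 fun r hr => List.dvd_prod hr⟩
  · obtain ⟨t, ht⟩ := exists_inSieve (hl r hr) N k L
    exact List.ne_nil_of_mem ((mem_residuesBelow (hl r hr)).2 ht)
  · exact ((mem_residuesBelow (hl r hr)).1 ha).1

lemma nodup_of_mem_residues {N k L : ℕ} : ∀ p ∈ (residues N k L l).val, p.2.Nodup := by
  rw [residues_val]
  exact List.forall_mem_map.2 fun r _ => nodup_residuesBelow r N k L r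

lemma coprime_prod_div (co : l.Pairwise Nat.Coprime) {r : ℕ} (hr : 0 < r) (h : r ∈ l) :
    (l.prod / r).Coprime r := by
  have hperm := List.perm_cons_erase h
  have hco := (List.pairwise_cons.1 (hperm.pairwise co Nat.Coprime.symm)).1
  rw [hperm.prod_eq, List.prod_cons, Nat.mul_div_cancel_left _ hr]
  exact Nat.coprime_list_prod_left_iff.2 fun r' hr' => (hco r' hr').symm

lemma dvd_prod_div {r r' : ℕ} (h : r ∈ l) (h' : r' ∈ l) (co : r.Coprime r') :
    r ∣ l.prod / r' :=
  Nat.dvd_div_of_mul_dvd <|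
    co.symm.mul_dvd_of_dvd_of_dvd (List.dvd_prod h') (List.dvd_prod h)

lemma separated_residues (co : l.Pairwise Nat.Coprime) (hl : ∀ r ∈ l, 0 < r) (N k L : ℕ) :
    Separated l.prod (residues N k L l).val := by
  rw [residues_val]
  refine ⟨List.forall_mem_map.2 fun r hr => ?_, List.pairwise_map.2 ?_⟩
  · rw [coef, mul_comm]
    exact inv_val_mul_modEq_one (hl r hr) (coprime_prod_div co (hl r hr) hr)
  · exact co.imp_of_mem fun hr hr' h =>
      ⟨(dvd_prod_div hr hr' h).mul_right _, (dvd_prod_div hr' hr h.symm).mul_right _⟩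

lemma modEq_prod_iff {a b : ℕ} (co : l.Pairwise Nat.Coprime) :
    a ≡ b [MOD l.prod] ↔ ∀ r ∈ l, a ≡ b [MOD r] := by
  simpa using Nat.modEq_list_map_prod_iff (a := a) (b := b) (s := id) (l := l) co

lemma mem_chinese_residues (co : l.Pairwise Nat.Coprime) (hl : ∀ r ∈ l, 0 < r) {N k L t : ℕ} :
    t ∈ (chinese l.prod (residues N k L l).val).val ↔ t < l.prod ∧ InSieve l.prod N k L t := by
  have hm : 0 < l.prod := List.prod_pos hl
  have hR := admissible_residues hl N k L
  have hs := separated_residues co hl N k L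
  rw [chinese_val hm hR, List.mem_map, inSieve_prod_iff co]
  rw [residues_val] at *
  constructor
  · rintro ⟨j, -, rfl⟩
    refine ⟨Nat.mod_lt _ hm, fun r hr => ?_⟩
    obtain ⟨a, ha, h⟩ := exists_mem_combination_modEq (j := j) hR hs _ (List.mem_map_of_mem hr)
    exact ((mem_residuesBelow (hl r hr)).1 ha).2.congr
      (h.symm.trans ((Nat.mod_modEq _ l.prod).symm.of_dvd (List.dvd_prod hr)))
  · rintro ⟨ht, h⟩
    obtain ⟨j, hj, hjt⟩ := exists_combination_modEq (y := t) hs <|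
      List.forall_mem_map.2 fun r hr => (mem_residuesBelow (hl r hr)).2
        ⟨Nat.mod_lt _ (hl r hr), (h r hr).congr (Nat.mod_modEq _ _).symm⟩
    refine ⟨j, List.mem_range.2 hj, ?_⟩
    rw [← Nat.mod_eq_of_lt ht]
    exact (modEq_prod_iff co).2 (List.forall_mem_map.1 hjt)

lemma nodup_chinese_residues (co : l.Pairwise Nat.Coprime) (hl : ∀ r ∈ l, 0 < r) (N k L : ℕ) :
    (chinese l.prod (residues N k L l).val).val.Nodup := by
  have hR := admissible_residues hl N k L
  rw [chinese_val (List.prod_pos hl) hR]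
  refine List.Nodup.map_on (fun j hj j' hj' h => ?_) List.nodup_range
  exact combination_injective hR (separated_residues co hl N k L) nodup_of_mem_residues
    (List.mem_range.1 hj) (List.mem_range.1 hj') fun p hp => Nat.ModEq.of_dvd (hR.dvd p hp) h

lemma numCombinations_residues (N k L : ℕ) (l : List ℕ) :
    numCombinations (residues N k L l).val =
      (l.map fun r => (residuesBelow r N k L r).val.length).prod := by
  rw [numCombinations, residues_val, List.map_map, Function.comp_def]

lemma length_chinese_residues (hl : ∀ r ∈ l, 0 < r) (N k L : ℕ) :
    (chinese l.prod (residues N k L l).val).val.length =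
      (l.map fun r => (residuesBelow r N k L r).val.length).prod := by
  rw [chinese_val (List.prod_pos hl) (admissible_residues hl N k L), List.length_map,
    List.length_range, numCombinations_residues]

end Residues

/-! ## The cost of Chinese remaindering -/

section

variable {ℓ : ℕ}

lemma length_le_of_forall_lt {A : List ℕ} {r : ℕ} (hA : A.Nodup) (h : ∀ a ∈ A, a < r) :
    A.length ≤ r := by
  rw [← List.toFinset_card_of_nodup hA, ← Finset.card_range r]
  exact Finset.card_le_card fun a ha => Finset.mem_range.2 (h a (List.mem_toFinset.1 ha))

lemma coef_le {m r : ℕ} (hr : 0 < r) : coef m r ≤ m :=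
  (Nat.mul_le_mul_left _ (inv_lt (m / r) hr).le).trans (Nat.div_mul_le_self m r)

lemma distances_runsIn {r c m : ℕ} (hm : 0 < m) (hr : r ≤ m) (hc : c ≤ m) (hl : 3 * len m ≤ ℓ) :
    ∀ {p : ℕ} {l : List ℕ} {D : Array ℕ}, p ≤ r → (∀ a ∈ l, a < r) → D.size + l.length ≤ m →
    (distances r c m p l D).RunsIn ℓ (l.length * 6)
  | _, [], _, _, _, _ => .pure _
  | p, x :: l, D, hp, h, hD => by
    rw [List.forall_mem_cons] at h
    rw [List.length_cons] at hD
    have lr := len_mono hr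
    have lc := len_mono hc
    have lx := len_mono (h.1.le.trans hr)
    have lp := len_mono (hp.trans hr)
    have ln := len_sub_le r p
    have ls := len_add_le x (r - p)
    have lq := len_mul_le (x + (r - p)) c
    have lq' := len_mono (Nat.mod_lt ((x + (r - p)) * c) hm).le
    have lD := len_mono (by omega : D.size ≤ m)
    rw [distances, List.length_cons]
    refine .mono (.read ?_ <| .sub ?_ ?_ <| .add ?_ ?_ <| .mul ?_ ?_ <| .rem ?_ ?_ <| .push ?_ ?_ <|
      distances_runsIn hm hr hc hl h.1.le h.2 (by rw [Array.size_push]; omega)) (by omega)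
    all_goals omega

lemma lastOf_runsIn : ∀ {p : ℕ} {l : List ℕ}, (∀ a ∈ l, len a ≤ ℓ) →
    (lastOf p l).RunsIn ℓ l.length
  | _, [], _ => .pure _
  | _, _ :: _, h => by
    rw [List.forall_mem_cons] at h
    exact .read h.1 (lastOf_runsIn h.2)

lemma numCombinations_le {m : ℕ} {R : List (ℕ × List ℕ)} (hR : Admissible m R)
    (hnd : ∀ p ∈ R, p.2.Nodup) : numCombinations R ≤ (R.map Prod.fst).prod :=
  List.prod_map_le_prod_map₀ _ _ (fun _ _ => Nat.zero_le _)
    fun p hp => length_le_of_forall_lt (hnd p hp) (hR.lt p hp)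

lemma size_distances (r c m p : ℕ) (l : List ℕ) (D : Array ℕ) :
    (distances r c m p l D).val.size = D.size + l.length := by
  simp [distances_val]

lemma wheels_runsIn {m B : ℕ} (hm : 0 < m) (hl : 4 * len m ≤ ℓ) : ∀ {R : List (ℕ × List ℕ)},
    Admissible m R → (∀ p ∈ R, p.2.Nodup) → (R.map Prod.fst).prod ≤ m →
    (∀ p ∈ R, 0 < p.1 ∧ p.1 ≤ B) → (wheels m R).RunsIn ℓ (R.length * (16 * ℓ + 18 + 7 * B))
  | [], _, _, _, _ => .pure _
  | (r, []) :: R, h, _, _, _ => absurd rfl (h.ne_nil (r, []) List.mem_cons_self)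
  | (r, a :: A) :: R, h, hnd, hp, hB => by
    rw [List.forall_mem_cons] at hB hnd
    rw [List.map_cons, List.prod_cons] at hp
    obtain ⟨⟨hr : 0 < r, hle : r ≤ B⟩, hB'⟩ := hB
    have hlt : ∀ x ∈ a :: A, x < r := (List.forall_mem_cons.1 h.lt).1
    have hrm : r ≤ m := Nat.le_of_dvd hm (List.forall_mem_cons.1 h.dvd).1
    have hRm : (R.map Prod.fst).prod ≤ m := (Nat.le_mul_of_pos_left _ hr).trans hp
    have ih := wheels_runsIn hm hl h.tail hnd.2 hRm hB'
    have hlen : A.length + 1 ≤ r := length_le_of_forall_lt hnd.1 hlt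
    have ha := hlt a List.mem_cons_self
    have hc : m / r * (inv (m / r) r).val ≤ m := coef_le hr
    have lr := len_mono hrm
    have la := len_mono (ha.le.trans hrm)
    have lh := len_div_le m r
    have li := len_mono ((inv_lt (m / r) hr).le.trans hrm)
    have lc := len_mono hc
    have ln := len_mono ((numCombinations_le h.tail hnd.2).trans hRm)
    have lx := len_mono (Nat.mod_lt (combination m R 0) hm).le
    have lκ := len_mono (hlen.trans hrm)
    have lp := len_mul_le a (m / r * (inv (m / r) r).val)
    have ls := len_add_le (a * (m / r * (inv (m / r) r).val)) (combination m R 0 % m)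
    have hlast := lastOf_runsIn (ℓ := ℓ) (p := a) (l := A) fun x hx => by
      have := len_mono ((hlt x (List.mem_cons_of_mem _ hx)).le.trans hrm)
      omega
    have hdist := distances_runsIn (p := A.getLastD a) (l := a :: A) (D := #[]) hm hrm hc
      (by omega : 3 * len m ≤ ℓ) (hlt _ List.getLastD_mem_cons).le hlt
      (by simpa using hlen.trans hrm)
    rw [wheels, List.length_cons]
    refine .mono (.read ?_ <| .read ?_ <| .quo ?_ ?_ <| .bind (inv_runsIn hr ?_ ?_) <|
      .mul ?_ ?_ <| .bind hlast (n := 4 + R.length * (16 * ℓ + 18 + 7 * B) + 1 +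
        (A.length + 1) * 6) ?rest) ?bound
    case rest =>
      rw [lastOf_val]
      refine .bind hdist <| .length (by rw [size_distances]; simpa using by omega) <| .bind ih ?_
      rw [wheels_val h.tail, size_distances]
      refine .mul ?_ ?_ <| .add ?_ ?_ <| .rem ?_ ?_ <| .mul ?_ ?_ <| .pure _ (n := 0)
      all_goals simpa using by omega
    case bound => linarith [hlen.trans hle]
    all_goals omega

lemma getD_dists_le {m r : ℕ} (hm : 0 < m) {A : List ℕ} (hA : A ≠ []) (j : ℕ) :
    (dists m r A).getD ((j + 1) % A.length) 0 ≤ m := by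
  rw [getD_dists hA]
  exact (Nat.mod_lt _ hm).le

lemma turn_runsIn {m : ℕ} (hm : 0 < m) (hl : 3 * len m ≤ ℓ) :
    ∀ {R : List (ℕ × List ℕ)} {x j : ℕ}, Admissible m R → (∀ p ∈ R, p.2.Nodup) → x < m →
    (turn m x (wheelsAt m R j)).RunsIn ℓ (R.length * 6)
  | [], _, _, _, _, _ => .pure _
  | (r, A) :: R, x, j, hR, hnd, hx => by
    rw [List.forall_mem_cons] at hnd
    have hA : A ≠ [] := hR.ne_nil _ List.mem_cons_self
    have hκ := List.length_pos_of_ne_nil hA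
    have hAm : A.length ≤ m :=
      (length_le_of_forall_lt hnd.1 (List.forall_mem_cons.1 hR.lt).1).trans
        (Nat.le_of_dvd hm (List.forall_mem_cons.1 hR.dvd).1)
    have hi := Nat.mod_lt j hκ
    have ih := turn_runsIn hm hl (j := j / A.length) hR.tail hnd.2
      (Nat.mod_lt (x + (dists m r A).getD ((j + 1) % A.length) 0) hm)
    have l0 := len_mono (Nat.zero_le m)
    have l1 := len_mono (Nat.one_le_iff_ne_zero.2 hm.ne')
    have li := len_mono (hi.le.trans hAm)
    have li1 := len_mono (by omega : j % A.length + 1 ≤ m)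
    have lκ := len_mono hAm
    have li' := len_mono ((Nat.mod_lt (j + 1) hκ).le.trans hAm)
    have ld := len_mono (getD_dists_le (r := r) hm hA j)
    have lx := len_mono hx.le
    have ls := len_add_le x ((dists m r A).getD ((j + 1) % A.length) 0)
    rw [wheelsAt, turn, List.length_cons]
    dsimp only
    refine .mono (.add ?_ ?_ <| .rem ?_ ?_ <| ?rest) (by omega : R.length * 6 + 4 + 1 + 1 ≤ _)
    case rest =>
      rw [Nat.mod_add_mod]
      refine .get ?_ ?_ <| .add ?_ ?_ <| .rem ?_ ?_ <| .ite_eq ?_ ?_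
        (fun _ => .mono (.bind ih (.pure _ (n := 0))) (Nat.zero_add _).le) fun _ => .pure _
      all_goals omega
    all_goals omega

lemma cycle_runsIn {m : ℕ} (hm : 0 < m) (hl : 3 * len m ≤ ℓ) {R : List (ℕ × List ℕ)}
    (hR : Admissible m R) (hnd : ∀ p ∈ R, p.2.Nodup) :
    ∀ {n x j : ℕ}, n ≤ m → x < m → x ≡ combination m R j [MOD m] →
    (cycle m n x (wheelsAt m R j)).RunsIn ℓ (n * (6 * R.length + 2))
  | 0, _, _, _, _, _ => .pure _
  | n + 1, x, j, hn, hx, h => by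
    obtain ⟨hW, hlt, hmod⟩ := turn_val hm (e := 0) hR hx (by rwa [zero_add])
    rw [zero_add] at hmod
    have ln := len_mono hn
    have lx := len_mono hlt.le
    rw [cycle]
    refine .mono (.read ?_ <| .bind (turn_runsIn hm hl hR hnd hx) ?rest)
      (by linarith : n * (6 * R.length + 2) + 1 + R.length * 6 + 1 ≤ _)
    case rest =>
      dsimp only
      rw [hW, add_comm (n * _)]
      exact .bind (cycle_runsIn hm hl hR hnd (by omega) hlt hmod) <|
        .last_cons (by omega) _
    all_goals omega

lemma chinese_runsIn {m B : ℕ} (hm : 0 < m) (hl : 4 * len m ≤ ℓ) {R : List (ℕ × List ℕ)}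
    (hR : Admissible m R) (hnd : ∀ p ∈ R, p.2.Nodup) (hp : (R.map Prod.fst).prod ≤ m)
    (hB : ∀ p ∈ R, 0 < p.1 ∧ p.1 ≤ B) :
    (chinese m R).RunsIn ℓ (R.length * (16 * ℓ + 18 + 7 * B) +
      numCombinations R * (6 * R.length + 2) + 3) := by
  have hle := (numCombinations_le hR hnd).trans hp
  have hx := Nat.mod_lt (combination m R 0) hm
  have hcycle := cycle_runsIn (n := numCombinations R - 1) (j := 0) hm
    (by omega : 3 * len m ≤ ℓ) hR hnd (by omega) hx (Nat.mod_modEq _ _)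
  have hn := Nat.mul_le_mul_right (6 * R.length + 2) (Nat.sub_le (numCombinations R) 1)
  have l0 := len_mono (Nat.zero_le m)
  have l1 := len_mono (Nat.one_le_iff_ne_zero.2 hm.ne')
  have ln := len_mono hle
  have lx := len_mono hx.le
  rw [chinese]
  refine .mono (.bind (wheels_runsIn hm hl hR hnd hp hB) ?_)
    (by omega : numCombinations R * (6 * R.length + 2) + 3 + _ ≤ _)
  rw [wheels_val hR]
  dsimp only
  refine .ite_eq ?_ ?_ (fun _ => .pure _) fun _ => .sub ?_ ?_ <| .mono
    (.bind hcycle (.last_cons ?_ _)) (by omega)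
  all_goals omega

end

/-! ## Sorting -/

section

variable {ℓ : ℕ}

lemma split_perm : ∀ l : List ℕ, ((split l).val.1 ++ (split l).val.2).Perm l
  | [] => by simp [split]
  | [x] => by simp [split]
  | x :: y :: l => (List.perm_middle.trans ((split_perm l).cons y)).cons x

lemma length_split : ∀ l : List ℕ,
    (split l).val.1.length = (l.length + 1) / 2 ∧ (split l).val.2.length = l.length / 2
  | [] => by simp [split]
  | [x] => by simp [split]
  | x :: y :: l => by
    have ih := length_split l
    simp only [split, val_bind, val_cons, val_pure, List.length_cons]
    omega

lemma split_runsIn : ∀ {l : List ℕ}, (∀ x ∈ l, len x ≤ ℓ) → (split l).RunsIn ℓ (l.length * 2)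
  | [], _ => .pure _
  | [x], h => by
    have hx := h x List.mem_cons_self
    exact .read hx <| .cons hx <| .pure _ (n := 0)
  | x :: y :: l, h => by
    simp only [List.forall_mem_cons] at h
    rw [split, List.length_cons, List.length_cons]
    exact .mono (.read h.1 <| .read h.2.1 <| .bind (split_runsIn h.2.2) <| .cons h.1 <|
      .cons h.2.1 <| .pure _ (n := 0)) (by omega)

lemma merge_perm (l l' : List ℕ) : (merge l l').val.Perm (l ++ l') := by
  fun_induction merge l l' with
  | case1 l => simp
  | case2 l => simp
  | case3 x l y l' ih₁ ih₂ =>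
    simp only [val_bind, val_lt, decide_eq_true_eq, val_ite, val_cons]
    split_ifs
    · exact (ih₁.cons y).trans List.perm_middle.symm
    · exact ih₂.cons x

lemma pairwise_merge {l l' : List ℕ} (h : l.Pairwise (· ≤ ·)) (h' : l'.Pairwise (· ≤ ·)) :
    (merge l l').val.Pairwise (· ≤ ·) := by
  fun_induction merge l l' with
  | case1 l => exact h'
  | case2 l => exact h
  | case3 x l y l' ih₁ ih₂ =>
    obtain ⟨hx, hl⟩ := List.pairwise_cons.1 h
    obtain ⟨hy, hl'⟩ := List.pairwise_cons.1 h'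
    simp only [val_bind, val_lt, decide_eq_true_eq, val_ite, val_cons]
    split_ifs with hyx
    · refine (ih₁ h hl').cons fun z hz => ?_
      rw [(merge_perm _ _).mem_iff, List.mem_append, List.mem_cons] at hz
      obtain (rfl | hz) | hz := hz
      exacts [hyx.le, hyx.le.trans (hx z hz), hy z hz]
    · refine (ih₂ hl h').cons fun z hz => ?_
      rw [(merge_perm _ _).mem_iff, List.mem_append, List.mem_cons] at hz
      obtain hz | rfl | hz := hz
      exacts [hx z hz, not_lt.1 hyx, (not_lt.1 hyx).trans (hy z hz)]

lemma merge_runsIn {l l' : List ℕ} (h : ∀ x ∈ l, len x ≤ ℓ) (h' : ∀ x ∈ l', len x ≤ ℓ) :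
    (merge l l').RunsIn ℓ ((l.length + l'.length) * 4) := by
  fun_induction merge l l' with
  | case1 l => exact .pure _
  | case2 l => exact .pure _
  | case3 x l y l' ih₁ ih₂ =>
    have hl := List.forall_mem_cons.1 h
    have hl' := List.forall_mem_cons.1 h'
    simp only [List.length_cons] at ih₁ ih₂ ⊢
    refine .mono (.read hl.1 <| .read hl'.1 <| .ite_lt hl'.1 hl.1 (fun _ => ?_) fun _ => ?_)
      (by omega : (l.length + l'.length) * 4 + 5 + 3 ≤ _)
    · exact .mono (.bind (ih₁ h hl'.2) (.last_cons hl'.1 _)) (by omega)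
    · exact .mono (.bind (ih₂ hl.2 h') (.last_cons hl.1 _)) (by omega)

lemma sortAux_perm : ∀ (f : ℕ) (l : List ℕ), (sortAux f l).val.Perm l
  | 0, l => .refl l
  | _ + 1, [] => .refl _
  | _ + 1, [_] => .refl _
  | f + 1, x :: y :: l => (merge_perm _ _).trans
      (((sortAux_perm f _).append (sortAux_perm f _)).trans (split_perm (x :: y :: l)))

lemma pairwise_sortAux : ∀ {f : ℕ} {l : List ℕ}, l.length ≤ f →
    (sortAux f l).val.Pairwise (· ≤ ·)
  | 0, l, h => by
    rw [List.length_eq_zero_iff.1 (Nat.le_zero.1 h)]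
    exact .nil
  | _ + 1, [], _ => .nil
  | _ + 1, [_], _ => List.pairwise_singleton _ _
  | f + 1, x :: y :: l, h => by
    have hs := length_split (x :: y :: l)
    simp only [List.length_cons] at h hs
    exact pairwise_merge (pairwise_sortAux (hs.1.trans_le (by omega)))
      (pairwise_sortAux (hs.2.trans_le (by omega)))

lemma sortAux_runsIn : ∀ {f d : ℕ} {l : List ℕ}, l.length ≤ 2 ^ d → (∀ x ∈ l, len x ≤ ℓ) →
    (sortAux f l).RunsIn ℓ (l.length * (d * 6))
  | 0, _, _, _, _ => .pure _
  | _ + 1, _, [], _, _ => .pure _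
  | _ + 1, _, [_], _, _ => .pure _
  | f + 1, 0, x :: y :: l, h, _ => by simp at h
  | f + 1, d + 1, x :: y :: l, h, hl => by
    have hs := length_split (x :: y :: l)
    have hp := split_perm (x :: y :: l)
    have hsplit := split_runsIn hl
    rw [sortAux]
    generalize x :: y :: l = l₀ at *
    have h₁ : ∀ z ∈ (split l₀).val.1, len z ≤ ℓ :=
      fun z hz => hl z (hp.mem_iff.1 (List.mem_append_left _ hz))
    have h₂ : ∀ z ∈ (split l₀).val.2, len z ≤ ℓ :=
      fun z hz => hl z (hp.mem_iff.1 (List.mem_append_right _ hz))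
    have p₁ := sortAux_perm f (split l₀).val.1
    have p₂ := sortAux_perm f (split l₀).val.2
    have hmerge := merge_runsIn (fun z hz => h₁ z (p₁.mem_iff.1 hz))
      fun z hz => h₂ z (p₂.mem_iff.1 hz)
    rw [p₁.length_eq, p₂.length_eq] at hmerge
    rw [pow_succ] at h
    have hlen : l₀.length = (split l₀).val.1.length + (split l₀).val.2.length := by omega
    refine .mono (.bind hsplit <| .bind (sortAux_runsIn (d := d) (hs.1.trans_le (by omega)) h₁) <|
      .bind (sortAux_runsIn (d := d) (hs.2.trans_le (by omega)) h₂) hmerge) (le_of_eq ?_)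
    rw [hlen]
    ring

lemma sort_perm (l : List ℕ) : (sort l).val.Perm l := sortAux_perm _ _

lemma pairwise_sort (l : List ℕ) : (sort l).val.Pairwise (· ≤ ·) := pairwise_sortAux le_rfl

lemma sort_runsIn {d : ℕ} {l : List ℕ} (h : l.length ≤ 2 ^ d) (hl : ∀ x ∈ l, len x ≤ ℓ) :
    (sort l).RunsIn ℓ (l.length * (d * 6)) := sortAux_runsIn h hl

/-! ## Searching -/

lemma toArray_val : ∀ (l : List ℕ) (A : Array ℕ), (toArray l A).val = A ++ l.toArray
  | [], A => by simp [toArray]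
  | x :: l, A => by simp [toArray, toArray_val l]

lemma toArray_runsIn : ∀ {l : List ℕ} {A : Array ℕ}, (∀ x ∈ l, len x ≤ ℓ) →
    len (A.size + l.length) ≤ ℓ → (toArray l A).RunsIn ℓ (l.length * 2)
  | [], _, _, _ => .pure _
  | x :: l, A, h, hA => by
    rw [List.forall_mem_cons] at h
    rw [List.length_cons] at hA ⊢
    have hsize : len A.size ≤ ℓ := (len_mono (Nat.le_add_right _ _)).trans hA
    exact .mono (.read h.1 <| .push hsize h.1 <| toArray_runsIn h.2
      (by rwa [Array.size_push, add_assoc, add_comm 1])) (by omega)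

lemma lt_countP_iff {t : ℕ} : ∀ {s : List ℕ} {i : ℕ}, s.Pairwise (· ≤ ·) → i < s.length →
    (i < s.countP (· < t) ↔ s.getD i 0 < t)
  | [], _, _, hi => absurd hi (Nat.not_lt_zero _)
  | x :: s, i, hs, hi => by
    obtain ⟨hx, hs⟩ := List.pairwise_cons.1 hs
    by_cases hxt : x < t
    · cases i with
      | zero => simp [hxt]
      | succ i => simpa [hxt] using lt_countP_iff hs (Nat.lt_of_succ_lt_succ hi)
    · have hge : ∀ y ∈ x :: s, t ≤ y :=
        List.forall_mem_cons.2 ⟨not_lt.1 hxt, fun y hy => (not_lt.1 hxt).trans (hx y hy)⟩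
      rw [List.countP_eq_zero.2 (by simpa using hge), List.getD_eq_getElem _ _ hi]
      exact iff_of_false (Nat.not_lt_zero _) (not_lt.2 (hge _ (List.getElem_mem hi)))

lemma searchAux_val {s : List ℕ} (hs : s.Pairwise (· ≤ ·)) {t : ℕ} : ∀ {f lo hi : ℕ},
    lo ≤ s.countP (· < t) → s.countP (· < t) ≤ hi → hi ≤ s.length → hi - lo ≤ f →
    (searchAux s.toArray t f lo hi).val = s.countP (· < t)
  | 0, lo, hi, hlo, hhi, _, hf => by
    rw [searchAux, val_pure]
    omega
  | f + 1, lo, hi, hlo, hhi, hlen, hf => by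
    simp only [searchAux, val_bind, val_lt, decide_eq_true_eq, val_add, val_quo, val_get, val_ite,
      val_pure, Array.getD_eq_getD_getElem?, List.getElem?_toArray, ← List.getD_eq_getElem?_getD]
    split_ifs with hne hmid
    · exact searchAux_val hs ((lt_countP_iff hs (by omega)).2 hmid) hhi hlen (by omega)
    · have hle := mt (lt_countP_iff hs (by omega)).1 hmid
      exact searchAux_val hs hlo (not_lt.1 hle) (by omega) (by omega)
    · omega

lemma search_val {s : List ℕ} (hs : s.Pairwise (· ≤ ·)) (t : ℕ) :
    (search s.toArray t).val = s.countP (· < t) :=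
  searchAux_val hs (Nat.zero_le _) List.countP_le_length le_rfl le_rfl

lemma searchAux_runsIn {A : Array ℕ} {t : ℕ} (hA : ∀ i, len (A.getD i 0) ≤ ℓ) (ht : len t ≤ ℓ)
    (hl : 2 * len A.size + 3 ≤ ℓ) : ∀ {f d lo hi : ℕ}, hi - lo < 2 ^ d → lo ≤ A.size →
    hi ≤ A.size → (searchAux A t f lo hi).RunsIn ℓ ((d + 1) * 6)
  | 0, _, _, _, _, _, _ => .pure _
  | f + 1, 0, lo, hi, h, hlo, hhi => by
    have llo := len_mono hlo
    have lhi := len_mono hhi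
    exact .mono (.ite_lt (by omega) (by omega) (by omega) fun _ => .pure _ (n := 0)) (by omega)
  | f + 1, d + 1, lo, hi, h, hlo, hhi => by
    have llo := len_mono hlo
    have lhi := len_mono hhi
    rw [pow_succ] at h
    have hup := searchAux_runsIn hA ht hl (f := f) (d := d) (lo := (lo + hi) / 2 + 1) (hi := hi)
    have hdown := searchAux_runsIn hA ht hl (f := f) (d := d) (lo := lo) (hi := (lo + hi) / 2)
    have lmid := len_mono (by omega : (lo + hi) / 2 ≤ A.size)
    have ls := len_add_le lo hi
    have l₁ := len_one
    have l₂ := len_two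
    refine .mono (.ite_lt ?_ ?_ (fun hne => .add ?_ ?_ <| .quo ?_ ?_ <| .get ?_ (hA _) <|
      .ite_lt (hA _) ht (fun _ => .add ?_ ?_ <| hup ?_ ?_ hhi)
        fun _ => .mono (hdown ?_ hlo ?_) (Nat.le_succ _)) fun _ => .pure _)
      (by omega : (d + 1) * 6 + 6 ≤ _)
    all_goals omega

lemma search_runsIn {A : Array ℕ} {t : ℕ} (hA : ∀ i, len (A.getD i 0) ≤ ℓ) (ht : len t ≤ ℓ)
    (hl : 2 * len A.size + 3 ≤ ℓ) : (search A t).RunsIn ℓ (6 * ℓ + 7) := by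
  have hsize : len A.size ≤ ℓ := by omega
  exact .mono (.length hsize <| searchAux_runsIn hA ht hl
    ((Nat.sub_le _ _).trans_lt (lt_two_pow_of_len_le hsize)) (Nat.zero_le _) le_rfl) (by omega)

end

/-! ## The final loops -/

section

variable {ℓ : ℕ}

lemma weightList_val (m m' i : ℕ) : ∀ l : List ℕ,
    (weightList m m' i l).val = l.map fun x => x * i % m * m'
  | [] => rfl
  | x :: l => by simp [weightList, weightList_val m m' i l]

lemma weightList_runsIn {m m' i : ℕ} (hm : 0 < m) (hi : i ≤ m) (hl : 2 * len m + len m' ≤ ℓ) :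
    ∀ {l : List ℕ}, (∀ x ∈ l, x < m) → (weightList m m' i l).RunsIn ℓ (l.length * 5)
  | [], _ => .pure _
  | x :: l, h => by
    rw [List.forall_mem_cons] at h
    have lx := len_mono h.1.le
    have li := len_mono hi
    have lp := len_mul_le x i
    have lr := len_mono (Nat.mod_lt (x * i) hm).le
    have lw := len_mul_le (x * i % m) m'
    rw [weightList, List.length_cons]
    refine .mono (.read ?_ <| .mul ?_ ?_ <| .rem ?_ ?_ <| .mul ?_ ?_ <|
      .bind (weightList_runsIn hm hi hl h.2) <| .last_cons ?_ _) (by omega)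
    all_goals omega

lemma try_val (N f L α : ℕ) : (try_ N f L α).val =
    if ((α + L) * (α + L) - f).sqrt * ((α + L) * (α + L) - f).sqrt = (α + L) * (α + L) - f then
      if 1 < Nat.gcd (α + L - ((α + L) * (α + L) - f).sqrt) N ∧
          Nat.gcd (α + L - ((α + L) * (α + L) - f).sqrt) N < N then
        some (Nat.gcd (α + L - ((α + L) * (α + L) - f).sqrt) N)
      else none
    else none := by
  simp only [try_, val_bind, val_add, val_mul, val_sub, sqrt_val, val_eq, decide_eq_true_eq,
    val_ite, gcd_val, val_lt, Bool.and_eq_true, val_pure]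

lemma try_eq_some {N f L α d : ℕ} (h : (try_ N f L α).val = some d) : d ∣ N ∧ 1 < d ∧ d < N := by
  rw [try_val] at h
  split_ifs at h with _ hproper
  obtain rfl := Option.some_inj.1 h
  exact ⟨Nat.gcd_dvd_right _ _, hproper⟩

lemma try_ne_none {N f L α y : ℕ} (hy : (α + L) * (α + L) - f = y * y)
    (h₁ : 1 < Nat.gcd (α + L - y) N) (h₂ : Nat.gcd (α + L - y) N < N) :
    (try_ N f L α).val ≠ none := by
  rw [try_val, hy, Nat.sqrt_eq, if_pos rfl, if_pos ⟨h₁, h₂⟩]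
  exact Option.some_ne_none _

lemma try_runsIn {N f L α : ℕ} (hN : len N ≤ ℓ) (hf : len f ≤ ℓ)
    (hl : 4 * (len α + len L) + 4 ≤ ℓ) : (try_ N f L α).RunsIn ℓ (10 * ℓ + 12) := by
  have lt := len_add_le α L
  have lq := len_mul_le (α + L) (α + L)
  have ld := len_sub_le ((α + L) * (α + L)) f
  rw [try_]
  refine .mono (.add ?_ ?_ <| .mul ?_ ?_ <| .sub ?_ ?_ <| .bind (sqrt_runsIn ?_) ?rest)
    (by omega : 4 * ℓ + 8 + (6 * ℓ + 1) + 1 + 1 + 1 ≤ _)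
  case rest =>
    rw [sqrt_val]
    generalize (α + L) * (α + L) - f = d at *
    have ly := len_mono d.sqrt_le_self
    have ly₂ := len_mono d.sqrt_le
    have lv := len_sub_le (α + L) d.sqrt
    have l₁ := len_one
    have lg : len (Nat.gcd (α + L - d.sqrt) N) ≤ ℓ := by
      obtain rfl | hpos := N.eq_zero_or_pos
      · rw [Nat.gcd_zero_right]
        omega
      · exact (len_mono (Nat.gcd_le_right _ hpos)).trans hN
    refine .mul ?_ ?_ <| .ite_eq ?_ ?_ (fun _ => .sub ?_ ?_ <| .mono
      (.bind (gcd_runsIn ?_ hN) ?proper) (by omega : 2 + _ ≤ _)) fun _ => .pure _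
    case proper =>
      rw [gcd_val]
      exact .lt (by omega) lg <| .lt lg hN <| .ite (fun _ => .pure _ (n := 0)) fun _ => .pure _
    all_goals omega
  all_goals omega

lemma scan_eq_some {N f L M α₁ d : ℕ} {A : Array ℕ} : ∀ {n i : ℕ},
    (scan N f L M α₁ A n i).val = some d → d ∣ N ∧ 1 < d ∧ d < N
  | 0, _, h => by simp [scan] at h
  | n + 1, i, h => by
    simp only [scan, val_bind, val_get, val_add, val_rem] at h
    split at h
    next d' hd =>
      obtain rfl := Option.some_inj.1 h
      exact try_eq_some hd
    next => exact scan_eq_some h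

lemma scan_ne_none {N f L M α₁ : ℕ} {A : Array ℕ} : ∀ {n i k : ℕ}, i ≤ k → k < i + n →
    (try_ N f L ((α₁ + A.getD k 0) % M)).val ≠ none → (scan N f L M α₁ A n i).val ≠ none
  | 0, _, _, hik, hk, _ => by omega
  | n + 1, i, k, hik, hk, h => by
    simp only [scan, val_bind, val_get, val_add, val_rem]
    split
    next => exact Option.some_ne_none _
    next hnone =>
      have hne : i ≠ k := by
        rintro rfl
        exact h hnone
      exact scan_ne_none (k := k) (Nat.lt_of_le_of_ne hik hne) (by rw [val_add]; omega) h

lemma scan_runsIn {N f L M α₁ : ℕ} {A : Array ℕ} (hN : len N ≤ ℓ) (hf : len f ≤ ℓ)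
    (hl : 4 * (len M + len L) + 4 ≤ ℓ) (h₁ : α₁ < M) (hA : ∀ i, A.getD i 0 < M)
    (hsize : len A.size ≤ ℓ) : ∀ {n i : ℕ}, i + n ≤ A.size →
    (scan N f L M α₁ A n i).RunsIn ℓ (n * (10 * ℓ + 17))
  | 0, _, _ => .pure _
  | n + 1, i, h => by
    have hM : 0 < M := Nat.zero_lt_of_lt h₁
    have lα₁ := len_mono h₁.le
    have lα₂ := len_mono (hA i).le
    have ls := len_add_le α₁ (A.getD i 0)
    have lα := len_mono (Nat.mod_lt (α₁ + A.getD i 0) hM).le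
    have li := len_mono (by omega : i ≤ A.size)
    have ln := len_mono (by omega : n + 1 ≤ A.size)
    have lone := len_one
    rw [scan]
    refine .mono (.read ?_ <| .get ?_ ?_ <| .add ?_ ?_ <| .rem ?_ ?_ <|
      .bind (try_runsIn hN hf ?_) ?rest)
      (by linarith : n * (10 * ℓ + 17) + 1 + _ + 1 + 1 + 1 + 1 ≤ _)
    case rest =>
      split
      · exact .pure _
      · exact .add (by omega) (by omega) (scan_runsIn hN hf hl h₁ hA hsize (by omega))
    all_goals omega

/-- The number of entries of the sorted list `s` that `meet` tries together with `α₁`. -/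
def tries (M Λ : ℕ) (s : List ℕ) (α₁ : ℕ) : ℕ :=
  s.countP (· < Λ - α₁) + (s.countP (· < M + Λ - α₁) - s.countP (· < M - α₁))

lemma meet_eq_some {N f L M Λ d : ℕ} {A : Array ℕ} : ∀ {l : List ℕ},
    (meet N f L M Λ A l).val = some d → d ∣ N ∧ 1 < d ∧ d < N
  | [], h => by simp [meet] at h
  | α₁ :: l, h => by
    simp only [meet, val_bind] at h
    split at h
    next d' hd =>
      obtain rfl := Option.some_inj.1 h
      exact scan_eq_some hd
    next =>
      simp only [val_bind] at h
      split at h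
      next d' hd =>
        obtain rfl := Option.some_inj.1 h
        exact scan_eq_some hd
      next => exact meet_eq_some h

lemma meet_ne_none {N f L M Λ α₁ α₂ : ℕ} {s : List ℕ} (hs : s.Pairwise (· ≤ ·)) (h₂ : α₂ ∈ s)
    (hα : α₂ < Λ - α₁ ∨ (M - α₁ ≤ α₂ ∧ α₂ < M + Λ - α₁))
    (h : (try_ N f L ((α₁ + α₂) % M)).val ≠ none) : ∀ {l : List ℕ}, α₁ ∈ l →
    (meet N f L M Λ s.toArray l).val ≠ none
  | [], h₁ => absurd h₁ List.not_mem_nil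
  | x :: l, h₁ => by
    simp only [meet, val_bind, val_sub, search_val hs]
    split
    next => exact Option.some_ne_none _
    next hnone₁ =>
      simp only [val_bind, val_sub, val_add, search_val hs]
      split
      next => exact Option.some_ne_none _
      next hnone₂ =>
        obtain rfl | h₁ := List.mem_cons.1 h₁
        · exfalso
          obtain ⟨i, hi, hi'⟩ := List.getElem_of_mem h₂
          rw [← List.getD_eq_getElem _ 0 hi] at hi'
          have htry : (try_ N f L ((α₁ + s.toArray.getD i 0) % M)).val ≠ none := by
            simpa [← hi'] using h
          rw [← hi'] at hα
          rw [← lt_countP_iff hs hi, ← not_lt, ← lt_countP_iff hs hi,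
            ← lt_countP_iff hs hi] at hα
          obtain hα | ⟨hge, hlt⟩ := hα
          · exact scan_ne_none (Nat.zero_le i) (by omega) htry hnone₁
          · exact scan_ne_none (not_lt.1 hge) (by omega) htry hnone₂
        · exact meet_ne_none hs h₂ hα h h₁

lemma countP_lt_mono (s : List ℕ) {t u : ℕ} (h : t ≤ u) : s.countP (· < t) ≤ s.countP (· < u) :=
  List.countP_mono_left fun _ _ hz => decide_eq_true ((of_decide_eq_true hz).trans_le h)

lemma getD_toArray_lt {s : List ℕ} {M : ℕ} (hM : 0 < M) (hs : ∀ x ∈ s, x < M) (i : ℕ) :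
    s.toArray.getD i 0 < M := by
  obtain hi | hi := lt_or_ge i s.length
  · simpa [hi] using hs _ (List.getElem_mem hi)
  · simpa [hi] using hM

lemma meet_runsIn {N f L M Λ : ℕ} {s : List ℕ} (hs : s.Pairwise (· ≤ ·)) (hΛ : Λ ≤ M)
    (hN : len N ≤ ℓ) (hf : len f ≤ ℓ) (hl : 4 * (len M + len L) + 4 ≤ ℓ) (hsM : ∀ x ∈ s, x < M)
    (hsize : 2 * len s.length + 3 ≤ ℓ) : ∀ {l : List ℕ}, (∀ x ∈ l, x < M) →
    (meet N f L M Λ s.toArray l).RunsIn ℓ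
      (l.length * (18 * ℓ + 27) + (l.map (tries M Λ s)).sum * (10 * ℓ + 17))
  | [], _ => .pure _
  | x :: l, h => by
    rw [List.forall_mem_cons] at h
    have ih := meet_runsIn hs hΛ hN hf hl hsM hsize h.2
    have hA := getD_toArray_lt (Nat.zero_lt_of_lt h.1) hsM
    have hsearch : ∀ {t : ℕ}, len t ≤ ℓ → (search s.toArray t).RunsIn ℓ (6 * ℓ + 7) := fun ht =>
      search_runsIn (fun i => (len_mono (hA i).le).trans (by omega)) ht hsize
    have hscan : ∀ {n i : ℕ}, i + n ≤ s.length →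
        (scan N f L M x s.toArray n i).RunsIn ℓ (n * (10 * ℓ + 17)) :=
      scan_runsIn hN hf hl h.1 hA (by rw [List.size_toArray]; omega)
    have lx := len_mono h.1.le
    have lΛ := len_mono hΛ
    have ls := len_add_le M Λ
    have lt₁ := len_sub_le Λ x
    have lt₂ := len_sub_le M x
    have lt₃ := len_sub_le (M + Λ) x
    have hn₁ : s.countP (· < Λ - x) ≤ s.length := List.countP_le_length
    have hi₃ : s.countP (· < M + Λ - x) ≤ s.length := List.countP_le_length
    have hi₂ := countP_lt_mono s (by omega : M - x ≤ M + Λ - x)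
    have li₂ := len_mono (hi₂.trans hi₃)
    have li₃ := len_mono hi₃
    rw [meet, List.length_cons, List.map_cons, List.sum_cons, tries]
    simp only [← search_val hs] at *
    refine .mono (.read ?_ <| .sub ?_ ?_ <| .bind (hsearch ?_) <| .bind (hscan ?_) ?rest)
      (by linarith : l.length * (18 * ℓ + 27) + (l.map (tries M Λ s)).sum * (10 * ℓ + 17) +
        ((search s.toArray (M + Λ - x)).val - (search s.toArray (M - x)).val) * (10 * ℓ + 17) +
        (12 * ℓ + 18) + _ + _ + 1 + 1 ≤ _)
    case rest =>
      split
      · exact .pure _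
      · refine .mono (.sub ?_ ?_ <| .bind (hsearch ?_) <| .add ?_ ?_ <| .sub ?_ ?_ <|
          .bind (hsearch ?_) <| .sub ?_ ?_ <| .bind (hscan ?_) (n := l.length * (18 * ℓ + 27) +
            (l.map (tries M Λ s)).sum * (10 * ℓ + 17)) (by split; exacts [.pure _, ih])) (by omega)
        all_goals omega
    all_goals omega

end

/-! ## Sieve sets and weights -/

section IsWeight

variable {m m' N k k' L a b s t w w' : ℕ}

lemma natCast_mem_shiftedSieve (hm : 0 < m) :
    (t : ZMod m) ∈ HypSieve.shiftedSieve N m a b ↔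
      InSieve m N (a * b) (HypSieve.shift N a b) t := by
  have : NeZero m := ⟨hm.ne'⟩
  simp only [HypSieve.shiftedSieve, HypSieve.sieve, HypSieve.hyperbola, Set.mem_ofPred_eq, InSieve,
    ← ZMod.natCast_eq_natCast_iff, Nat.cast_mul, Nat.cast_add]
  constructor
  · rintro ⟨_, ⟨⟨x, y⟩, hxy, rfl⟩, ht⟩
    refine ⟨x.val, y.val, by simpa using hxy, ?_⟩
    rw [ht, ZMod.natCast_zmod_val, ZMod.natCast_zmod_val]
    ring
  · rintro ⟨x, y, hxy, ht⟩
    exact ⟨_, ⟨(x, y), hxy, rfl⟩, by rw [ht]; ring⟩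

lemma mem_smallSieve {M Λ : ℕ} (hM : 0 < M) : s ∈ HypSieve.smallSieve N M a b Λ ↔
    s < Λ ∧ s < M ∧ InSieve M N (a * b) (HypSieve.shift N a b) s := by
  have : NeZero M := ⟨hM.ne'⟩
  simp only [HypSieve.smallSieve, Set.mem_ofPred_eq, ← natCast_mem_shiftedSieve hM]
  constructor
  · rintro ⟨hlt, x, hx, rfl⟩
    exact ⟨hlt, ZMod.val_lt x, by simpa using hx⟩
  · rintro ⟨hlt, hltM, hs⟩
    exact ⟨hlt, _, hs, (ZMod.val_cast_of_lt hltM).symm⟩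

/-- The elements of `N₁` for `(m, m') = (m₁, m₂)` and of `N₂` for `(m, m') = (m₂, m₁)`, described
without the inverse of `m'`: a multiple of `m'` below `m m'` in the sieve set modulo `m`. -/
structure IsWeight (m m' N k L w : ℕ) : Prop where
  lt : w < m * m'
  dvd : m' ∣ w
  inSieve : InSieve m N k L w

lemma IsWeight.congr_coeff (h : IsWeight m m' N k L w) (hk : k ≡ k' [MOD m]) :
    IsWeight m m' N k' L w :=
  ⟨h.lt, h.dvd, h.inSieve.congr_coeff hk⟩

lemma mem_weights (hm : 0 < m) (hm' : 0 < m') (co : m'.Coprime m) :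
    w ∈ HypSieve.weights N m m' a b ↔ IsWeight m m' N (a * b) (HypSieve.shift N a b) w := by
  have : NeZero m := ⟨hm.ne'⟩
  have hinv : (m' : ZMod m) * (m' : ZMod m)⁻¹ = 1 := ZMod.coe_mul_inv_eq_one m' co
  constructor
  · rintro ⟨x, hx, rfl⟩
    refine ⟨Nat.mul_lt_mul_of_pos_right (ZMod.val_lt _) hm', dvd_mul_left _ _,
      (natCast_mem_shiftedSieve hm).1 ?_⟩
    rwa [Nat.cast_mul, ZMod.natCast_zmod_val, mul_assoc, mul_comm _⁻¹, hinv, mul_one]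
  · rintro ⟨hlt, ⟨j, rfl⟩, hj⟩
    refine ⟨_, (natCast_mem_shiftedSieve hm).2 hj, ?_⟩
    rw [mul_comm] at hlt
    rw [Nat.cast_mul, mul_right_comm, hinv, one_mul,
      ZMod.val_cast_of_lt (Nat.lt_of_mul_lt_mul_right hlt), mul_comm]

lemma IsWeight.eq_of_add_modEq {α β α' β' : ℕ} (co : m.Coprime m')
    (hα : IsWeight m m' N k L α) (hβ : IsWeight m' m N k L β)
    (hα' : IsWeight m m' N k L α') (hβ' : IsWeight m' m N k L β')
    (h : α + β ≡ α' + β' [MOD m * m']) : α = α' ∧ β = β' := by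
  have hα₀ : α ≡ α' [MOD m'] :=
    (Nat.modEq_zero_iff_dvd.2 hα.dvd).trans (Nat.modEq_zero_iff_dvd.2 hα'.dvd).symm
  have hβ₀ : β ≡ β' [MOD m] :=
    (Nat.modEq_zero_iff_dvd.2 hβ.dvd).trans (Nat.modEq_zero_iff_dvd.2 hβ'.dvd).symm
  have hαm : α ≡ α' [MOD m] := hβ₀.add_right_cancel (h.of_dvd (dvd_mul_right _ _))
  have hβm : β ≡ β' [MOD m'] := hα₀.add_left_cancel (h.of_dvd (dvd_mul_left _ _))
  exact ⟨((Nat.modEq_and_modEq_iff_modEq_mul co).1 ⟨hαm, hα₀⟩).eq_of_lt_of_lt hα.lt hα'.lt,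
    ((Nat.modEq_and_modEq_iff_modEq_mul co.symm).1 ⟨hβm, hβ₀⟩).eq_of_lt_of_lt hβ.lt hβ'.lt⟩

lemma IsWeight.inSieve_add_mod {α β : ℕ} (co : m.Coprime m') (hα : IsWeight m m' N k L α)
    (hβ : IsWeight m' m N k L β) : InSieve (m * m') N k L ((α + β) % (m * m')) := by
  refine (InSieve.mul co (hα.inSieve.congr ?_) (hβ.inSieve.congr ?_)).congr
    (Nat.mod_modEq _ _).symm
  · simpa using (Nat.modEq_zero_iff_dvd.2 hβ.dvd).symm.add_left α
  · simpa using (Nat.modEq_zero_iff_dvd.2 hα.dvd).symm.add_right β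

lemma exists_isWeight_modEq (hm : 0 < m) (hm' : 0 < m') (co : m.Coprime m')
    (ht : InSieve m N k L t) : ∃ α, IsWeight m m' N k L α ∧ α ≡ t [MOD m] := by
  have hM : 0 < m * m' := Nat.mul_pos hm hm'
  obtain ⟨α, hαt, hα₀⟩ := Nat.chineseRemainder co t 0
  have hred := Nat.mod_modEq α (m * m')
  have hmod : α % (m * m') ≡ t [MOD m] := (hred.of_dvd (dvd_mul_right _ _)).trans hαt
  exact ⟨α % (m * m'), ⟨Nat.mod_lt _ hM,
    Nat.modEq_zero_iff_dvd.1 ((hred.of_dvd (dvd_mul_left _ _)).trans hα₀), ht.congr hmod.symm⟩,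
    hmod⟩

lemma exists_isWeight_add_modEq (hm : 0 < m) (hm' : 0 < m') (co : m.Coprime m')
    (ht : InSieve (m * m') N k L t) :
    ∃ α β, IsWeight m m' N k L α ∧ IsWeight m' m N k L β ∧ α + β ≡ t [MOD m * m'] := by
  obtain ⟨α, hα, hαt⟩ := exists_isWeight_modEq hm hm' co (ht.of_dvd (dvd_mul_right _ _))
  obtain ⟨β, hβ, hβt⟩ := exists_isWeight_modEq hm' hm co.symm (ht.of_dvd (dvd_mul_left _ _))
  refine ⟨α, β, hα, hβ, (Nat.modEq_and_modEq_iff_modEq_mul co).1 ⟨?_, ?_⟩⟩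
  · simpa using hαt.add (Nat.modEq_zero_iff_dvd.2 hβ.dvd)
  · simpa using (Nat.modEq_zero_iff_dvd.2 hα.dvd).add hβt

end IsWeight

section SieveWeights

variable {l : List ℕ} {m' : ℕ}

/-- The unsorted list of weights that the algorithm computes for the moduli in `l`. -/
def sieveWeights (N k L : ℕ) (l : List ℕ) (m' : ℕ) : List ℕ :=
  (weightList l.prod m' (inv m' l.prod).val (chinese l.prod (residues N k L l).val).val).val

lemma mem_sieveWeights (co : l.Pairwise Nat.Coprime) (hl : ∀ r ∈ l, 0 < r) (hm' : 0 < m')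
    (hco : m'.Coprime l.prod) (N k L w : ℕ) :
    w ∈ sieveWeights N k L l m' ↔ IsWeight l.prod m' N k L w := by
  have hm : 0 < l.prod := List.prod_pos hl
  have hinv := inv_val_mul_modEq_one hm hco
  simp only [sieveWeights, weightList_val, List.mem_map, mem_chinese_residues co hl]
  constructor
  · rintro ⟨x, ⟨-, hx⟩, rfl⟩
    refine ⟨Nat.mul_lt_mul_of_pos_right (Nat.mod_lt _ hm) hm', dvd_mul_left _ _, hx.congr ?_⟩
    calc x = x * 1 := (mul_one x).symm
      _ ≡ x * ((inv m' l.prod).val * m') [MOD l.prod] := (hinv.mul_left x).symm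
      _ = x * (inv m' l.prod).val * m' := (mul_assoc _ _ _).symm
      _ ≡ x * (inv m' l.prod).val % l.prod * m' [MOD l.prod] :=
        ((Nat.mod_modEq _ _).mul_right m').symm
  · rintro ⟨hlt, ⟨j, rfl⟩, hj⟩
    rw [mul_comm] at hlt
    refine ⟨m' * j % l.prod, ⟨Nat.mod_lt _ hm, hj.congr (Nat.mod_modEq _ _).symm⟩, ?_⟩
    have hj : m' * j % l.prod * (inv m' l.prod).val ≡ j [MOD l.prod] :=
      calc m' * j % l.prod * (inv m' l.prod).val
          ≡ m' * j * (inv m' l.prod).val [MOD l.prod] := (Nat.mod_modEq _ _).mul_right _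
        _ = (inv m' l.prod).val * m' * j := by ring
        _ ≡ 1 * j [MOD l.prod] := hinv.mul_right j
        _ = j := one_mul j
    rw [hj, Nat.mod_eq_of_lt (Nat.lt_of_mul_lt_mul_right hlt), mul_comm]

lemma nodup_sieveWeights (co : l.Pairwise Nat.Coprime) (hl : ∀ r ∈ l, 0 < r) (hm' : 0 < m')
    (hco : m'.Coprime l.prod) (N k L : ℕ) : (sieveWeights N k L l m').Nodup := by
  have hinv := inv_val_mul_modEq_one (List.prod_pos hl) hco
  have hcoInv : l.prod.Coprime (inv m' l.prod).val :=
    (Nat.coprime_of_mul_modEq_one _ hinv).symm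
  rw [sieveWeights, weightList_val]
  refine List.Nodup.map_on (fun x hx y hy h => ?_) (nodup_chinese_residues co hl N k L)
  rw [mem_chinese_residues co hl] at hx hy
  have hmul : x * (inv m' l.prod).val ≡ y * (inv m' l.prod).val [MOD l.prod] :=
    Nat.eq_of_mul_eq_mul_right hm' h
  exact (Nat.ModEq.cancel_right_of_coprime hcoInv hmul).eq_of_lt_of_lt hx.1 hy.1

lemma length_sieveWeights (N k L : ℕ) (l : List ℕ) (m' : ℕ) :
    (sieveWeights N k L l m').length = (chinese l.prod (residues N k L l).val).val.length := by
  rw [sieveWeights, weightList_val, List.length_map]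

lemma ncard_weights (co : l.Pairwise Nat.Coprime) (hl : ∀ r ∈ l, 0 < r) (hm' : 0 < m')
    (hco : m'.Coprime l.prod) {N a b k : ℕ} (hk : k ≡ a * b [MOD l.prod]) :
    (HypSieve.weights N l.prod m' a b).ncard =
      (sieveWeights N k (HypSieve.shift N a b) l m').length := by
  have heq : HypSieve.weights N l.prod m' a b =
      ((sieveWeights N k (HypSieve.shift N a b) l m').toFinset : Set ℕ) := by
    ext w
    rw [Finset.mem_coe, List.mem_toFinset, mem_sieveWeights co hl hm' hco,
      mem_weights (List.prod_pos hl) hm' hco]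
    exact ⟨fun h => h.congr_coeff hk.symm, fun h => h.congr_coeff hk⟩
  rw [heq, Set.ncard_coe_finset, List.toFinset_card_of_nodup (nodup_sieveWeights co hl hm' hco ..)]

end SieveWeights

/-! ## Lower bounds for the sieve -/

lemma card_linear_add_inv_le_two {F : Type*} [Field F] [Fintype F] [DecidableEq F] {k : F}
    (hk : k ≠ 0) (n c : F) :
    ((Finset.univ.erase (0 : F)).filter fun x => k * x + n * x⁻¹ = c).card ≤ 2 := by
  obtain hempty | ⟨x, hx⟩ := Finset.eq_empty_or_nonempty
    ((Finset.univ.erase (0 : F)).filter fun x => k * x + n * x⁻¹ = c)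
  · rw [hempty]
    exact Nat.zero_le 2
  refine (Finset.card_le_card (t := {x, n * (k * x)⁻¹}) fun y hy => ?_).trans Finset.card_le_two
  simp only [Finset.mem_filter, Finset.mem_erase, Finset.mem_univ, and_true] at hx hy
  obtain ⟨hx₀, hx⟩ := hx
  obtain ⟨hy₀, hy⟩ := hy
  have hroots : (y - x) * (k * x * y - n) = 0 := by
    have h := hx.trans hy.symm
    field_simp at h
    linear_combination -h
  rw [Finset.mem_insert, Finset.mem_singleton]
  refine (mul_eq_zero.1 hroots).imp sub_eq_zero.1 fun h => ?_
  field_simp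
  linear_combination h

lemma pred_le_two_mul_length_residuesBelow {r k : ℕ} (hr : r.Prime) (hk : k.Coprime r) (N L : ℕ) :
    r - 1 ≤ 2 * (residuesBelow r N k L r).val.length := by
  have : Fact r.Prime := ⟨hr⟩
  have hk₀ : (k : ZMod r) ≠ 0 := fun h =>
    hr.one_lt.ne' (Nat.eq_one_of_dvd_coprimes hk ((ZMod.natCast_eq_zero_iff _ _).1 h) dvd_rfl)
  have hcard : (Finset.univ.erase (0 : ZMod r)).card = r - 1 := by
    rw [Finset.card_erase_of_mem (Finset.mem_univ _), Finset.card_univ, ZMod.card]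
  rw [← List.toFinset_card_of_nodup (nodup_residuesBelow r N k L r), ← hcard]
  refine Finset.card_le_mul_card_image_of_maps_to
    (f := fun x : ZMod r => ((k : ZMod r) * x + N * x⁻¹ - L).val) (fun x hx => ?_) 2 (fun t _ => ?_)
  · have hx₀ : x ≠ 0 := Finset.ne_of_mem_erase hx
    rw [List.mem_toFinset, mem_residuesBelow hr.pos]
    refine ⟨ZMod.val_lt _, x.val, ((N : ZMod r) * x⁻¹).val, ?_, ?_⟩ <;>
      rw [← ZMod.natCast_eq_natCast_iff] <;>
      simp only [Nat.cast_mul, Nat.cast_add, ZMod.natCast_zmod_val]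
    · field_simp
    · ring
  · refine (Finset.card_le_card fun x hx => ?_).trans
      (card_linear_add_inv_le_two hk₀ (N : ZMod r) (t + L))
    rw [Finset.mem_filter] at hx ⊢
    refine ⟨hx.1, sub_eq_iff_eq_add.1 ?_⟩
    rw [← hx.2, ZMod.natCast_zmod_val]

lemma prime_le_gcd_six_mul_pow {r k : ℕ} (hr : r.Prime) (hk : k.Coprime r) (N L : ℕ) :
    r ≤ Nat.gcd 6 r * (residuesBelow r N k L r).val.length ^ 3 := by
  have hpred := pred_le_two_mul_length_residuesBelow hr hk N L
  have htwo := hr.two_le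
  generalize (residuesBelow r N k L r).val.length = κ at *
  have hκ : 0 < κ := by omega
  by_cases hdvd : r ∣ 6
  · rw [Nat.gcd_eq_right hdvd]
    exact Nat.le_mul_of_pos_right _ (by positivity)
  · have hκ₂ : 2 ≤ κ := by
      by_contra! hlt
      have : r ≤ 3 := by omega
      interval_cases r <;> exact hdvd (by decide)
    rw [((hr.coprime_iff_not_dvd).2 hdvd).symm, one_mul]
    calc r ≤ 2 * 2 * κ := by omega
      _ ≤ κ * κ * κ := Nat.mul_le_mul_right κ (Nat.mul_le_mul hκ₂ hκ₂)
      _ = κ ^ 3 := by ring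

lemma prod_le_gcd_six_mul_pow {k : ℕ} (N L : ℕ) : ∀ {l : List ℕ}, l.Pairwise Nat.Coprime →
    (∀ r ∈ l, r.Prime) → k.Coprime l.prod → l.prod ≤
      Nat.gcd 6 l.prod * (l.map fun r => (residuesBelow r N k L r).val.length).prod ^ 3
  | [], _, _, _ => by simp
  | r :: l, co, hl, hk => by
    rw [List.pairwise_cons] at co
    rw [List.forall_mem_cons] at hl
    rw [List.prod_cons] at hk
    have hhead := prime_le_gcd_six_mul_pow hl.1 hk.coprime_mul_right_right N L
    have htail := prod_le_gcd_six_mul_pow N L co.2 hl.2 hk.coprime_mul_left_right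
    rw [List.prod_cons, List.map_cons, List.prod_cons,
      Nat.Coprime.gcd_mul 6 (Nat.coprime_list_prod_right_iff.2 co.1), mul_pow, mul_mul_mul_comm]
    exact Nat.mul_le_mul hhead htail

lemma prod_le_length_chinese_pow {k : ℕ} {l : List ℕ} (co : l.Pairwise Nat.Coprime)
    (hl : ∀ r ∈ l, r.Prime) (hk : k.Coprime l.prod) (N L : ℕ) :
    l.prod ≤ 6 * (chinese l.prod (residues N k L l).val).val.length ^ 3 := by
  rw [length_chinese_residues fun r hr => (hl r hr).pos]
  exact (prod_le_gcd_six_mul_pow N L co hl hk).trans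
    (Nat.mul_le_mul_right _ (Nat.gcd_le_left _ (by norm_num)))

/-! ## The size of the modulus -/

lemma primeProd_pos (lo hi : ℕ) : 0 < HypSieve.primeProd lo hi :=
  Finset.prod_pos fun _ hr => (Finset.mem_filter.1 hr).2.pos

lemma mul_primeProd_half_le {n p : ℕ} (hp : p.Prime) (hlo : n / 2 < p) (hhi : p ≤ n) :
    p * HypSieve.primeProd 0 (n / 2) ≤ HypSieve.primeProd 0 n := by
  have hp' : p ∉ (Finset.Ioc 0 (n / 2)).filter Nat.Prime := by
    simp only [Finset.mem_filter, Finset.mem_Ioc]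
    omega
  rw [HypSieve.primeProd, HypSieve.primeProd, ← Finset.prod_insert (f := fun r => r) hp']
  refine Finset.prod_le_prod_of_subset_of_one_le' (Finset.insert_subset ?_ ?_)
    fun r hr _ => (Finset.mem_filter.1 hr).2.one_lt.le
  · exact Finset.mem_filter.2 ⟨Finset.mem_Ioc.2 ⟨hp.pos, hhi⟩, hp⟩
  · exact Finset.filter_subset_filter _ (Finset.Ioc_subset_Ioc_right (Nat.div_le_self n 2))

-- Bertrand's postulate gives a prime in `(n / 2, n]`, that is, one more factor of order `n`.
lemma exists_pow_le_primeProd (J : ℕ) : ∃ C, ∀ n, n ^ J ≤ C * HypSieve.primeProd 0 n := by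
  induction J with
  | zero => exact ⟨1, fun n => by rw [pow_zero, one_mul]; exact primeProd_pos 0 n⟩
  | succ J ih =>
    obtain ⟨C, hC⟩ := ih
    refine ⟨3 ^ (J + 1) * C + 1, fun n => ?_⟩
    obtain hn | hn := Nat.lt_or_ge n 2
    · calc n ^ (J + 1) ≤ 1 := pow_le_one₀ (Nat.zero_le _) (by omega)
        _ ≤ _ := Nat.mul_pos (Nat.succ_pos _) (primeProd_pos 0 n)
    · obtain ⟨p, hp, hlo, hhi⟩ := Nat.exists_prime_lt_and_le_two_mul (n / 2) (by omega)
      calc n ^ (J + 1) ≤ (3 * (n / 2)) ^ (J + 1) := Nat.pow_le_pow_left (by omega) _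
        _ = 3 ^ (J + 1) * ((n / 2) ^ J * (n / 2)) := by rw [mul_pow, pow_succ (n / 2)]
        _ ≤ 3 ^ (J + 1) * (C * HypSieve.primeProd 0 (n / 2) * p) :=
          Nat.mul_le_mul_left _ (Nat.mul_le_mul (hC _) hlo.le)
        _ = 3 ^ (J + 1) * C * (p * HypSieve.primeProd 0 (n / 2)) := by ring
        _ ≤ 3 ^ (J + 1) * C * HypSieve.primeProd 0 n :=
          Nat.mul_le_mul_left _ (mul_primeProd_half_le hp hlo (by omega))
        _ ≤ (3 ^ (J + 1) * C + 1) * HypSieve.primeProd 0 n :=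
          Nat.mul_le_mul_right _ (Nat.le_succ _)

lemma primeProd_le_mul (lo mid hi : ℕ) : HypSieve.primeProd lo hi ≤
    HypSieve.primeProd lo mid * HypSieve.primeProd mid hi := by
  have hdisj : Disjoint ((Finset.Ioc lo mid).filter Nat.Prime)
      ((Finset.Ioc mid hi).filter Nat.Prime) :=
    Finset.disjoint_filter_filter (Finset.Ioc_disjoint_Ioc_of_le le_rfl)
  simp only [HypSieve.primeProd]
  rw [← Finset.prod_union hdisj, ← Finset.filter_union]
  exact Finset.prod_le_prod_of_subset_of_one_le'
    (Finset.filter_subset_filter _ fun x hx => by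
      simp only [Finset.mem_union, Finset.mem_Ioc] at hx ⊢
      omega)
    fun r hr _ => (Finset.mem_filter.1 hr).2.one_lt.le

lemma primeProd_zero_le (B₁ B₂ : ℕ) :
    HypSieve.primeProd 0 B₂ ≤ 2 * (HypSieve.primeProd 2 B₁ * HypSieve.primeProd B₁ B₂) := by
  have htwo : HypSieve.primeProd 0 2 = 2 := by decide
  calc HypSieve.primeProd 0 B₂ ≤ HypSieve.primeProd 0 B₁ * HypSieve.primeProd B₁ B₂ :=
        primeProd_le_mul 0 B₁ B₂
    _ ≤ HypSieve.primeProd 0 2 * HypSieve.primeProd 2 B₁ * HypSieve.primeProd B₁ B₂ :=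
        Nat.mul_le_mul_right _ (primeProd_le_mul 0 2 B₁)
    _ = _ := by rw [htwo, mul_assoc]

/-! ## The number of candidates -/

lemma add_mod_lt_iff {M α β : ℕ} (hα : α < M) (hβ : β < M) (Λ : ℕ) :
    (α + β) % M < Λ ↔ β < Λ - α ∨ M - α ≤ β ∧ β < M + Λ - α := by
  obtain hlt | hge := Nat.lt_or_ge (α + β) M
  · rw [Nat.mod_eq_of_lt hlt]
    omega
  · rw [Nat.mod_eq_sub_mod hge, Nat.mod_eq_of_lt (by omega)]
    omega

lemma tries_eq_countP {M Λ α : ℕ} {s : List ℕ} (hΛ : Λ ≤ M) (hα : α < M) (hs : ∀ x ∈ s, x < M) :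
    tries M Λ s α = s.countP fun x => (α + x) % M < Λ := by
  induction s with
  | nil => rfl
  | cons x s ih =>
    rw [List.forall_mem_cons] at hs
    have hiff := add_mod_lt_iff hα hs.1 Λ
    have hmono : s.countP (· < M - α) ≤ s.countP (· < M + Λ - α) :=
      List.countP_mono_left fun x _ hx => by
        rw [decide_eq_true_eq] at hx ⊢
        omega
    rw [List.countP_cons, ← ih hs.2]
    simp only [tries, List.countP_cons, hiff, decide_eq_true_eq]
    split_ifs <;> omega

lemma sum_countP_eq_card {l s : List ℕ} (hl : l.Nodup) (hs : s.Nodup) (p : ℕ → ℕ → Prop)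
    [∀ x y, Decidable (p x y)] : (l.map fun x => s.countP (p x)).sum =
      ((l.toFinset ×ˢ s.toFinset).filter fun z => p z.1 z.2).card := by
  rw [← List.sum_toFinset _ hl, Finset.card_filter, Finset.sum_product]
  refine Finset.sum_congr rfl fun x _ => ?_
  rw [← Finset.card_filter, List.countP_eq_length_filter,
    ← List.toFinset_card_of_nodup (hs.filter _), List.toFinset_filter]
  simp only [decide_eq_true_eq]

lemma sum_tries_le {N k a b m₁ m₂ Λ : ℕ} {l s : List ℕ} (hm₁ : 0 < m₁) (hm₂ : 0 < m₂)
    (co : m₁.Coprime m₂) (hk : k ≡ a * b [MOD m₁ * m₂]) (hΛ : Λ ≤ m₁ * m₂)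
    (hl : l.Nodup) (hs : s.Nodup)
    (hlw : ∀ α ∈ l, IsWeight m₁ m₂ N k (HypSieve.shift N a b) α)
    (hsw : ∀ β ∈ s, IsWeight m₂ m₁ N k (HypSieve.shift N a b) β) :
    (l.map (tries (m₁ * m₂) Λ s)).sum ≤ (HypSieve.smallSieve N (m₁ * m₂) a b Λ).ncard := by
  have hM : 0 < m₁ * m₂ := Nat.mul_pos hm₁ hm₂
  have hcount : ∀ α ∈ l, tries (m₁ * m₂) Λ s α =
      s.countP fun β => (α + β) % (m₁ * m₂) < Λ := fun α hα =>
    tries_eq_countP hΛ (hlw α hα).lt fun β hβ => mul_comm m₂ m₁ ▸ (hsw β hβ).lt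
  rw [List.map_congr_left hcount, sum_countP_eq_card hl hs, ← Set.ncard_coe_finset]
  refine Set.ncard_le_ncard_of_injOn (fun z => (z.1 + z.2) % (m₁ * m₂)) ?_ ?_
    ((Set.finite_lt_nat Λ).subset fun x hx => hx.1)
  · rintro ⟨α, β⟩ hz
    simp only [Finset.mem_coe, Finset.mem_filter, Finset.mem_product, List.mem_toFinset] at hz
    obtain ⟨⟨hα, hβ⟩, hlt⟩ := hz
    exact (mem_smallSieve hM).2 ⟨hlt, Nat.mod_lt _ hM,
      ((hlw α hα).inSieve_add_mod co (hsw β hβ)).congr_coeff hk⟩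
  · rintro ⟨α, β⟩ hz ⟨α', β'⟩ hz' heq
    simp only [Finset.mem_coe, Finset.mem_filter, Finset.mem_product, List.mem_toFinset] at hz hz'
    exact Prod.ext_iff.2 ((hlw α hz.1.1).eq_of_add_modEq co (hsw β hz.1.2)
      (hlw α' hz'.1.1) (hsw β' hz'.1.2) heq)

/-! ## The weights as sorted lists -/

section SortedWeights

variable {lo hi n r m' : ℕ}

lemma prime_of_mem_primesIn (hr : r ∈ (primesIn lo hi).val) : r.Prime := (mem_primesIn.1 hr).2.2

lemma pos_of_mem_primesIn (hr : r ∈ (primesIn lo hi).val) : 0 < r := (prime_of_mem_primesIn hr).pos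

lemma pairwise_coprime_primesIn (lo hi : ℕ) : (primesIn lo hi).val.Pairwise Nat.Coprime :=
  (nodup_primesIn lo hi).imp_of_mem fun hr hs =>
    (Nat.coprime_primes (prime_of_mem_primesIn hr) (prime_of_mem_primesIn hs)).2

lemma coprime_primeProd (lo mid hi : ℕ) :
    (HypSieve.primeProd lo mid).Coprime (HypSieve.primeProd mid hi) := by
  refine Nat.Coprime.prod_left fun r hr => Nat.Coprime.prod_right fun s hs => ?_
  simp only [Finset.mem_filter, Finset.mem_Ioc] at hr hs
  exact (Nat.coprime_primes hr.2 hs.2).2 (by omega)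

/-- The sorted list `N₁` for `(lo, hi, m') = (2, B₁, m₂)` and `N₂` for
`(lo, hi, m') = (B₁, B₂, m₁)`, as computed by `factor`. -/
def sortedWeights (N k L lo hi m' : ℕ) : List ℕ :=
  (sort (sieveWeights N k L (primesIn lo hi).val m')).val

lemma pairwise_sortedWeights (N k L lo hi m' : ℕ) :
    (sortedWeights N k L lo hi m').Pairwise (· ≤ ·) :=
  pairwise_sort _

lemma length_sortedWeights (N k L lo hi m' : ℕ) :
    (sortedWeights N k L lo hi m').length = (chinese (HypSieve.primeProd lo hi)
      (residues N k L (primesIn lo hi).val).val).val.length := by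
  rw [sortedWeights, (sort_perm _).length_eq, length_sieveWeights, prod_primesIn]

lemma primeProd_le_length_sortedWeights_pow {k : ℕ} (hk : k.Coprime (HypSieve.primeProd lo hi))
    (N L m' : ℕ) :
    HypSieve.primeProd lo hi ≤ 6 * (sortedWeights N k L lo hi m').length ^ 3 := by
  rw [length_sortedWeights, ← prod_primesIn]
  exact prod_le_length_chinese_pow (pairwise_coprime_primesIn lo hi)
    (fun _ => prime_of_mem_primesIn) (by rwa [prod_primesIn]) N L

lemma mem_sieveWeights_primesIn {w : ℕ} (hm' : 0 < m') (co : m'.Coprime (HypSieve.primeProd lo hi))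
    (N k L : ℕ) :
    w ∈ sieveWeights N k L (primesIn lo hi).val m' ↔
      IsWeight (HypSieve.primeProd lo hi) m' N k L w := by
  rw [← prod_primesIn] at co ⊢
  exact mem_sieveWeights (pairwise_coprime_primesIn lo hi) (fun _ => pos_of_mem_primesIn) hm' co
    N k L w

lemma mem_sortedWeights {w : ℕ} (hm' : 0 < m') (co : m'.Coprime (HypSieve.primeProd lo hi))
    (N k L : ℕ) :
    w ∈ sortedWeights N k L lo hi m' ↔ IsWeight (HypSieve.primeProd lo hi) m' N k L w :=
  (sort_perm _).mem_iff.trans (mem_sieveWeights_primesIn hm' co N k L)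

lemma nodup_sortedWeights (hm' : 0 < m') (co : m'.Coprime (HypSieve.primeProd lo hi))
    (N k L : ℕ) : (sortedWeights N k L lo hi m').Nodup :=
  (sort_perm _).nodup_iff.2 <| nodup_sieveWeights (pairwise_coprime_primesIn lo hi)
    (fun _ => pos_of_mem_primesIn) hm' (by rwa [prod_primesIn]) N k L

lemma ncard_weights_primeProd {N a b k : ℕ} (hm' : 0 < m')
    (co : m'.Coprime (HypSieve.primeProd lo hi))
    (hk : k ≡ a * b [MOD HypSieve.primeProd lo hi]) :
    (HypSieve.weights N (HypSieve.primeProd lo hi) m' a b).ncard =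
      (sortedWeights N k (HypSieve.shift N a b) lo hi m').length := by
  rw [← prod_primesIn] at co hk ⊢
  rw [ncard_weights (pairwise_coprime_primesIn lo hi) (fun _ => pos_of_mem_primesIn) hm' co hk,
    sortedWeights, (sort_perm _).length_eq]

lemma length_sortedWeights_le (hm' : 0 < m') (co : m'.Coprime (HypSieve.primeProd lo hi))
    (N k L : ℕ) :
    (sortedWeights N k L lo hi m').length ≤ HypSieve.primeProd lo hi * m' :=
  length_le_of_forall_lt (nodup_sortedWeights hm' co N k L) fun _ hw =>
    ((mem_sortedWeights hm' co N k L).1 hw).lt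

end SortedWeights

/-! ## Correctness -/

lemma factor_val (N Λ B₁ B₂ a b : ℕ) {m₁ m₂ M k L : ℕ} (hm₁ : m₁ = HypSieve.primeProd 2 B₁)
    (hm₂ : m₂ = HypSieve.primeProd B₁ B₂) (hM : M = m₁ * m₂) (hk : k = a * b % M)
    (hL : L = HypSieve.shift N a b) :
    (factor N Λ B₁ B₂ a b).val =
      if 1 < Nat.gcd N M then
        if Nat.gcd N M < N then some (Nat.gcd N M)
        else ((primesIn 2 B₁).val ++ (primesIn B₁ B₂).val).find? (· ∣ N)
      else (meet N (4 * (a * b * N)) L M Λ (sortedWeights N k L B₁ B₂ m₁).toArray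
        (sortedWeights N k L 2 B₁ m₂)).val := by
  subst hk hL hM hm₁ hm₂
  simp only [factor, val_bind, prod_val, val_mul, gcd_val, val_lt, decide_eq_true_eq, val_ite,
    val_pure, sqrtUp_eq_shift, val_rem, toArray_val, Array.empty_append, firstDivisor_val,
    List.find?_append, sortedWeights, sieveWeights, prod_primesIn]
  congr 2
  split <;> simp only [val_pure, firstDivisor_val, *, Option.some_or, Option.none_or]

lemma exists_find?_dvd_eq_some {N : ℕ} {l : List ℕ} (hl : ∀ r ∈ l, r.Prime) (h₁ : 1 < N)
    (hN : ¬ N.Prime) (hdvd : N ∣ l.prod) :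
    ∃ d, l.find? (· ∣ N) = some d ∧ d ∣ N ∧ 1 < d ∧ d < N := by
  have hp := Nat.minFac_prime h₁.ne'
  obtain ⟨r, hr, hpr⟩ := hp.prime.dvd_prod_iff.1 (N.minFac_dvd.trans hdvd)
  obtain rfl := (Nat.prime_dvd_prime_iff_eq hp (hl r hr)).1 hpr
  obtain ⟨d, hd⟩ := Option.isSome_iff_exists.1 <| List.find?_isSome (p := (· ∣ N)).2
    ⟨N.minFac, hr, by simpa using N.minFac_dvd⟩
  have hdN : d ∣ N := by simpa using List.find?_some hd
  have hdp := hl d (List.mem_of_find?_eq_some hd)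
  exact ⟨d, hd, hdN, hdp.one_lt, (Nat.le_of_dvd (by omega) hdN).lt_of_ne fun h => hN (h ▸ hdp)⟩

lemma exists_of_fermatBound_lt {N a b : ℕ} {x : ℝ} (h₁ : 1 < N) (hN : ¬ N.Prime)
    (h : HypSieve.fermatBound N a b < x) : ∃ u v : ℕ, N = u * v ∧ u ≠ 1 ∧ v ≠ 1 ∧
      ((a : ℝ) * u - b * v) ^ 2 / (4 * √((a : ℝ) * b * N)) < x := by
  have hfac := Nat.mul_div_cancel' N.minFac_dvd
  have hp := Nat.minFac_prime h₁.ne'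
  have hcofactor : N / N.minFac ≠ 1 := fun h => hN <| by
    rw [h, mul_one] at hfac
    exact hfac ▸ hp
  obtain ⟨_, ⟨u, v, huv, hu, hv, rfl⟩, hx⟩ := exists_lt_of_csInf_lt
    (by exact ⟨_, _, _, hfac.symm, hp.one_lt.ne', hcofactor, rfl⟩) h
  exact ⟨u, v, huv, hu, hv, hx⟩

lemma two_mul_sqrt_mul_le_add {x y : ℝ} (hx : 0 ≤ x) (hy : 0 ≤ y) : 2 * √(x * y) ≤ x + y := by
  rw [Real.sqrt_mul hx]
  linarith [sq_nonneg (√x - √y), Real.sq_sqrt hx, Real.sq_sqrt hy]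

lemma add_le_two_mul_sqrt_mul_add {x y : ℝ} (hx : 0 < x) (hy : 0 < y) :
    x + y ≤ 2 * √(x * y) + (x - y) ^ 2 / (4 * √(x * y)) := by
  have hw := Real.sq_sqrt (mul_pos hx hy).le
  rw [← sub_le_iff_le_add', le_div_iff₀ (by positivity)]
  linarith [sq_nonneg (x + y - 2 * √(x * y))]

section

variable {M N a b u v L α Λ : ℕ}

lemma shift_le_linear (huv : N = u * v) : HypSieve.shift N a b ≤ a * u + b * v := by
  have hprod : (a : ℝ) * b * N = a * u * (b * v) := by
    rw [huv]
    push_cast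
    ring
  rw [HypSieve.shift, Nat.ceil_le, hprod]
  push_cast
  exact two_mul_sqrt_mul_le_add (by positivity) (by positivity)

lemma linear_lt_shift_add (ha : 0 < a) (hb : 0 < b) (hN : 0 < N) (huv : N = u * v)
    (h : ((a : ℝ) * u - b * v) ^ 2 / (4 * √((a : ℝ) * b * N)) < Λ) :
    a * u + b * v < HypSieve.shift N a b + Λ := by
  have hprod : (a : ℝ) * b * N = a * u * (b * v) := by
    rw [huv]
    push_cast
    ring
  obtain ⟨hu, hv⟩ : 0 < u ∧ 0 < v := by rwa [huv, CanonicallyOrderedAdd.mul_pos] at hN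
  have hceil := Nat.le_ceil (2 * √((a : ℝ) * b * N))
  have hlin : (a : ℝ) * u + b * v ≤ _ :=
    add_le_two_mul_sqrt_mul_add (by positivity) (by positivity)
  rw [← hprod] at hlin
  rw [HypSieve.shift, ← Nat.cast_lt (α := ℝ)]
  push_cast
  linarith

lemma inSieve_linear (hM : 0 < M) (hb : b.Coprime M) (huv : N = u * v)
    (h : α + L = a * u + b * v) : InSieve M N (a * b) L α := by
  have hinv := inv_val_mul_modEq_one hM hb
  refine ⟨u * (inv b M).val, b * v, ?_, ?_⟩
  · convert hinv.mul_left N using 1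
    · rw [huv]
      ring
    · rw [mul_one]
  · rw [h]
    refine Nat.ModEq.add_right _ ?_
    convert hinv.mul_left (a * u) using 1
    · ring
    · rw [mul_one]

lemma gcd_two_mul_mul (hN : Odd N) (hb : b.Coprime N) (huv : N = u * v) :
    Nat.gcd (2 * (b * v)) N = v := by
  rw [← mul_assoc, Nat.Coprime.gcd_mul_left_cancel _ (hN.coprime_two_left.mul_left hb), huv,
    Nat.gcd_mul_left_right]

/-- Here `y = a u - b v`, because `(a u + b v)² - 4 (a u) (b v)` is its square. -/
lemma try_ne_none_of_le (hN : Odd N) (hb : b.Coprime N) (huv : N = u * v) (hu : u ≠ 1) (hv : v ≠ 1)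
    (h : α + L = a * u + b * v) (hle : b * v ≤ a * u) :
    (try_ N (4 * (a * b * N)) L α).val ≠ none := by
  obtain ⟨y, hy⟩ := Nat.exists_eq_add_of_le hle
  obtain ⟨hu₀, hv₀⟩ : 0 < u ∧ 0 < v := by
    have := hN.pos
    rwa [huv, CanonicallyOrderedAdd.mul_pos] at this
  have hgcd : Nat.gcd (α + L - y) N = v := by
    rw [← gcd_two_mul_mul hN hb huv, h, hy]
    congr 1
    omega
  have hsquare : (α + L) * (α + L) - 4 * (a * b * N) = y * y := by
    have hprod : 4 * (a * b * N) = 4 * (a * u * (b * v)) := by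
      rw [huv]
      ring
    rw [h, hprod, hy]
    refine Nat.sub_eq_of_eq_add ?_
    ring
  refine try_ne_none hsquare (by omega) ?_
  rw [hgcd, huv]
  exact lt_mul_of_one_lt_left hv₀ (by omega)

lemma try_ne_none_of_linear (hN : Odd N) (ha : a.Coprime N) (hb : b.Coprime N) (huv : N = u * v)
    (hu : u ≠ 1) (hv : v ≠ 1) (h : α + L = a * u + b * v) :
    (try_ N (4 * (a * b * N)) L α).val ≠ none := by
  obtain hle | hle := le_total (b * v) (a * u)
  · exact try_ne_none_of_le hN hb huv hu hv h hle
  · rw [mul_comm a b]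
    exact try_ne_none_of_le hN ha (huv.trans (mul_comm u v)) hv hu (h.trans (add_comm _ _)) hle

lemma exists_inSieve_try_ne_none (hodd : Odd N) (h₁ : 1 < N) (hN : ¬ N.Prime) (hM : 0 < M)
    (ha : a.Coprime N) (hb : b.Coprime N) (hbM : b.Coprime M)
    (h : HypSieve.fermatBound N a b < Λ) : ∃ α < Λ, InSieve M N (a * b) (HypSieve.shift N a b) α ∧
      (try_ N (4 * (a * b * N)) (HypSieve.shift N a b) α).val ≠ none := by
  have hpos {c : ℕ} (hc : c.Coprime N) : 0 < c :=
    Nat.pos_of_ne_zero fun h => h₁.ne' <| by rwa [h, Nat.coprime_zero_left] at hc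
  obtain ⟨u, v, huv, hu, hv, hx⟩ := exists_of_fermatBound_lt h₁ hN h
  have hlt := linear_lt_shift_add (hpos ha) (hpos hb) (zero_lt_one.trans h₁) huv hx
  have hle := shift_le_linear (a := a) (b := b) huv
  have hα := Nat.sub_add_cancel hle
  exact ⟨a * u + b * v - HypSieve.shift N a b, by omega, inSieve_linear hM hbM huv hα,
    try_ne_none_of_linear hodd ha hb huv hu hv hα⟩

end

section

variable {N Λ B₁ B₂ a b m₁ m₂ k f L : ℕ}

lemma meet_sortedWeights_ne_none {α : ℕ} (hm₁ : m₁ = HypSieve.primeProd 2 B₁)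
    (hm₂ : m₂ = HypSieve.primeProd B₁ B₂) (hΛ : Λ ≤ m₁ * m₂) (hα : α < Λ)
    (hin : InSieve (m₁ * m₂) N k L α)
    (htry : (try_ N f L α).val ≠ none) :
    (meet N f L (m₁ * m₂) Λ (sortedWeights N k L B₁ B₂ m₁).toArray
      (sortedWeights N k L 2 B₁ m₂)).val ≠ none := by
  have hpos₁ : 0 < m₁ := hm₁ ▸ primeProd_pos 2 B₁
  have hpos₂ : 0 < m₂ := hm₂ ▸ primeProd_pos B₁ B₂
  have co : m₁.Coprime m₂ := hm₁ ▸ hm₂ ▸ coprime_primeProd 2 B₁ B₂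
  obtain ⟨α₁, α₂, hα₁, hα₂, hmod⟩ := exists_isWeight_add_modEq hpos₁ hpos₂ co hin
  have hsum : (α₁ + α₂) % (m₁ * m₂) = α := by
    rw [hmod, Nat.mod_eq_of_lt (hα.trans_le hΛ)]
  have hrange := (add_mod_lt_iff hα₁.lt (mul_comm m₂ m₁ ▸ hα₂.lt) Λ).1 (hsum ▸ hα)
  refine meet_ne_none (α₁ := α₁) (α₂ := α₂) (pairwise_sortedWeights ..) ?_ hrange
    (by rwa [hsum]) ?_
  · exact (mem_sortedWeights hpos₁ (hm₂ ▸ co) N k L).2 (hm₂ ▸ hα₂)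
  · exact (mem_sortedWeights hpos₂ (hm₁ ▸ co.symm) N k L).2 (hm₁ ▸ hα₁)

lemma factor_correct (hm₁ : m₁ = HypSieve.primeProd 2 B₁)
    (hm₂ : m₂ = HypSieve.primeProd B₁ B₂) (hΛ : Λ ≤ m₁ * m₂) (hodd : Odd N)
    (h₁ : 1 < N) (hN : ¬ N.Prime)
    (hab : (a * b).Coprime (m₁ * m₂ * N)) (h : HypSieve.fermatBound N a b < Λ) :
    ∃ d, (factor N Λ B₁ B₂ a b).val = some d ∧ d ∣ N ∧ 1 < d ∧ d < N := by
  rw [factor_val N Λ B₁ B₂ a b hm₁ hm₂ rfl rfl rfl]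
  split_ifs with hgt hlt
  · exact ⟨_, rfl, Nat.gcd_dvd_left _ _, hgt, hlt⟩
  · have hgcd : Nat.gcd N (m₁ * m₂) = N :=
      (Nat.gcd_le_left _ (zero_lt_one.trans h₁)).antisymm (not_lt.1 hlt)
    refine exists_find?_dvd_eq_some (fun r hr => ?_) h₁ hN ?_
    · exact (List.mem_append.1 hr).elim prime_of_mem_primesIn prime_of_mem_primesIn
    · rw [List.prod_append, prod_primesIn, prod_primesIn, ← hm₁, ← hm₂]
      exact hgcd ▸ Nat.gcd_dvd_right _ _
  · have hM : 0 < m₁ * m₂ := Nat.mul_pos (hm₁ ▸ primeProd_pos 2 B₁) (hm₂ ▸ primeProd_pos B₁ B₂)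
    have hN' : (a * b).Coprime N := hab.coprime_mul_left_right
    have hM' : (a * b).Coprime (m₁ * m₂) := hab.coprime_mul_right_right
    obtain ⟨α, hα, hin, htry⟩ := exists_inSieve_try_ne_none hodd h₁ hN hM hN'.coprime_mul_right
      hN'.coprime_mul_left hM'.coprime_mul_left h
    obtain ⟨d, hd⟩ := Option.ne_none_iff_exists'.1 <| meet_sortedWeights_ne_none hm₁ hm₂ hΛ hα
      (hin.congr_coeff (Nat.mod_modEq _ _).symm) htry
    exact ⟨d, hd, meet_eq_some hd⟩

end

/-! ## The running time -/

section PrimesIn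

variable {lo hi B N k L m' ℓ : ℕ}

lemma length_primesIn_le (hB : hi < B) : (primesIn lo hi).val.length ≤ B :=
  length_le_of_forall_lt (nodup_primesIn lo hi) fun _ hr => (mem_primesIn.1 hr).2.1.trans_lt hB

lemma length_primesIn_le_len (lo hi : ℕ) :
    (primesIn lo hi).val.length ≤ len (HypSieve.primeProd lo hi) := by
  have hpow : 2 ^ (primesIn lo hi).val.length ≤ (primesIn lo hi).val.prod :=
    List.pow_card_le_prod _ _ fun r hr => (prime_of_mem_primesIn hr).two_le
  rw [prod_primesIn] at hpow
  exact (Nat.lt_size.2 hpow).le.trans (Nat.le_succ _)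

lemma le_pow_four (B : ℕ) : B ≤ (B + 1) ^ 4 :=
  (Nat.le_succ B).trans (Nat.le_self_pow (by norm_num) _)

lemma primesIn_runsIn_pow (hlo : lo ≤ B) (hhi : hi ≤ B) (hl : len B + 3 ≤ ℓ) :
    (primesIn lo hi).RunsIn ℓ (3 * (B + 1) ^ 4) := by
  refine (primesIn_runsIn hl hlo hhi).mono ?_
  calc hi * (3 * (B + 2)) ≤ B * (3 * (B + 2)) := Nat.mul_le_mul_right _ hhi
    _ ≤ 3 * (B + 1) ^ 2 := by nlinarith
    _ ≤ 3 * (B + 1) ^ 4 := by gcongr <;> omega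

lemma prod_primesIn_runsIn (hB : hi < B) (hl : len (HypSieve.primeProd lo hi) ≤ ℓ) :
    (prod (primesIn lo hi).val).RunsIn ℓ (2 * (B + 1) ^ 4) := by
  rw [← prod_primesIn] at hl
  refine (prod_runsIn (fun _ => pos_of_mem_primesIn) hl).mono ?_
  exact Nat.mul_le_mul_left _ ((length_primesIn_le hB).trans (le_pow_four B))

lemma firstDivisor_primesIn_runsIn (hB : hi < B) (hl : len N + len B ≤ ℓ) :
    (firstDivisor N (primesIn lo hi).val).RunsIn ℓ (3 * (B + 1) ^ 4) := by
  refine (firstDivisor_runsIn (by omega) fun r hr => ?_).mono ?_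
  · have := len_mono ((mem_primesIn.1 hr).2.1.trans hB.le)
    omega
  · exact Nat.mul_le_mul_left _ ((length_primesIn_le hB).trans (le_pow_four B))

lemma residues_primesIn_runsIn (hB : hi < B) (hl : 3 * len B + len N + len k + len L ≤ ℓ) :
    (residues N k L (primesIn lo hi).val).RunsIn ℓ (11 * (B + 1) ^ 4) := by
  refine (residues_runsIn hl fun r hr => (mem_primesIn.1 hr).2.1.trans hB.le).mono ?_
  calc (primesIn lo hi).val.length * (11 * (B + 1) ^ 3) ≤ (B + 1) * (11 * (B + 1) ^ 3) :=
        Nat.mul_le_mul_right _ ((length_primesIn_le hB).trans (Nat.le_succ B))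
    _ = 11 * (B + 1) ^ 4 := by ring

lemma map_fst_residues (N k L : ℕ) (l : List ℕ) : (residues N k L l).val.map Prod.fst = l := by
  rw [residues_val, List.map_map]
  exact List.map_id l

lemma chinese_primesIn_runsIn (hB : hi < B) (hl : 4 * len (HypSieve.primeProd lo hi) ≤ ℓ)
    (N k L m' : ℕ) :
    (chinese (HypSieve.primeProd lo hi) (residues N k L (primesIn lo hi).val).val).RunsIn ℓ
      (41 * ((B + 1) ^ 4 * ℓ) + 8 * ((sortedWeights N k L lo hi m').length * ℓ) + 3) := by
  set l := (primesIn lo hi).val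
  have hpos : ∀ r ∈ l, 0 < r := fun _ => pos_of_mem_primesIn
  have hlen : (residues N k L l).val.length = l.length := by
    rw [← List.length_map, map_fst_residues]
  have hcomb : numCombinations (residues N k L l).val = (sortedWeights N k L lo hi m').length := by
    rw [length_sortedWeights, ← prod_primesIn, length_chinese_residues hpos,
      numCombinations_residues]
  have hBl : l.length ≤ B := length_primesIn_le hB
  have hℓl : 4 * l.length ≤ ℓ := (Nat.mul_le_mul_left _ (length_primesIn_le_len lo hi)).trans hl
  have hℓ : 1 ≤ ℓ := by have := len_pos (HypSieve.primeProd lo hi); omega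
  have hpow : B ^ 2 ≤ (B + 1) ^ 4 :=
    (Nat.pow_le_pow_left (Nat.le_succ B) 2).trans (Nat.pow_le_pow_right B.succ_pos (by norm_num))
  have hrun := chinese_runsIn (B := B) (primeProd_pos lo hi) hl
    (prod_primesIn lo hi ▸ admissible_residues hpos N k L) nodup_of_mem_residues
    (by rw [map_fst_residues, prod_primesIn]) (fun p hp => by
      have hfst : p.1 ∈ l := map_fst_residues N k L l ▸ List.mem_map_of_mem hp
      exact ⟨hpos _ hfst, (mem_primesIn.1 hfst).2.1.trans hB.le⟩)
  rw [hlen, hcomb] at hrun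
  refine hrun.mono (Nat.add_le_add_right (Nat.add_le_add ?_ ?_) 3)
  · calc l.length * (16 * ℓ + 18 + 7 * B) ≤ B * (41 * (B * ℓ)) :=
          Nat.mul_le_mul hBl (by nlinarith)
      _ = 41 * (B ^ 2 * ℓ) := by ring
      _ ≤ 41 * ((B + 1) ^ 4 * ℓ) := Nat.mul_le_mul_left _ (Nat.mul_le_mul_right _ hpow)
  · rw [mul_left_comm 8]
    exact Nat.mul_le_mul_left _ (by omega)

lemma weightList_primesIn (lo hi N k L m' : ℕ) :
    (weightList (HypSieve.primeProd lo hi) m' (inv m' (HypSieve.primeProd lo hi)).val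
      (chinese (HypSieve.primeProd lo hi) (residues N k L (primesIn lo hi).val).val).val).val =
      sieveWeights N k L (primesIn lo hi).val m' := by
  rw [sieveWeights, prod_primesIn]

lemma weightList_primesIn_runsIn
    (hl : 2 * len (HypSieve.primeProd lo hi) + len m' ≤ ℓ) (N k L : ℕ) :
    (weightList (HypSieve.primeProd lo hi) m' (inv m' (HypSieve.primeProd lo hi)).val
      (chinese (HypSieve.primeProd lo hi) (residues N k L (primesIn lo hi).val).val).val).RunsIn ℓ
      (5 * (sortedWeights N k L lo hi m').length) := by
  have hm := primeProd_pos lo hi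
  rw [length_sortedWeights, mul_comm 5]
  refine weightList_runsIn hm (inv_lt m' hm).le hl fun x hx => ?_
  rw [← prod_primesIn] at hx ⊢
  exact ((mem_chinese_residues (pairwise_coprime_primesIn lo hi)
    fun _ => pos_of_mem_primesIn).1 hx).1

lemma sort_weightList_primesIn_runsIn (hm' : 0 < m') (co : m'.Coprime (HypSieve.primeProd lo hi))
    (hl : len (HypSieve.primeProd lo hi * m') ≤ ℓ) (N k L : ℕ) :
    (sort (weightList (HypSieve.primeProd lo hi) m' (inv m' (HypSieve.primeProd lo hi)).val
      (chinese (HypSieve.primeProd lo hi)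
        (residues N k L (primesIn lo hi).val).val).val).val).RunsIn ℓ
      (6 * ((sortedWeights N k L lo hi m').length * ℓ)) := by
  rw [weightList_primesIn]
  have hlen : (sieveWeights N k L (primesIn lo hi).val m').length =
      (sortedWeights N k L lo hi m').length := (sort_perm _).length_eq.symm
  refine (sort_runsIn (d := ℓ) ?_ fun w hw => ?_).mono (by rw [hlen]; apply le_of_eq; ring)
  · rw [hlen]
    exact (length_sortedWeights_le hm' co N k L).trans (lt_two_pow_of_len_le hl).le
  · exact (len_mono ((mem_sieveWeights_primesIn hm' co N k L).1 hw).lt.le).trans hl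

end PrimesIn

section Factor

variable {N Λ B₁ B₂ a b m₁ m₂ f k L S ℓ : ℕ}

/-- The part of `factor` that follows the computation of `f = 4abN`, `L` and `k`, for the lists `P₁`
and `P₂` of the primes dividing `m₁` and `m₂`. -/
def meetWeights (N f L k Λ : ℕ) (P₁ P₂ : List ℕ) (m₁ m₂ M : ℕ) : Timed (Option ℕ) := do
  let R₁ ← residues N k L P₁
  let R₂ ← residues N k L P₂
  let X₁ ← chinese m₁ R₁
  let X₂ ← chinese m₂ R₂
  let i₁ ← inv m₂ m₁
  let W₁ ← weightList m₁ m₂ i₁ X₁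
  let N₁ ← sort W₁
  let i₂ ← inv m₁ m₂
  let W₂ ← weightList m₂ m₁ i₂ X₂
  let N₂ ← sort W₂
  let A ← toArray N₂ #[]
  meet N f L M Λ A N₁

/-- The number of pairs of weights that `factor` tries if none of them gives a factor. -/
def numTries (N k L Λ B₁ B₂ m₁ m₂ : ℕ) : ℕ :=
  ((sortedWeights N k L 2 B₁ m₂).map (tries (m₁ * m₂) Λ (sortedWeights N k L B₁ B₂ m₁))).sum

lemma toArray_meet_runsIn (hm₁ : m₁ = HypSieve.primeProd 2 B₁)
    (hm₂ : m₂ = HypSieve.primeProd B₁ B₂) (hΛ : Λ ≤ m₁ * m₂) (hN : len N ≤ ℓ) (hf : len f ≤ ℓ)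
    (hl : 4 * (len (m₁ * m₂) + len L) + 4 ≤ ℓ) :
    (toArray (sortedWeights N k L B₁ B₂ m₁) #[] >>= fun A =>
      meet N f L (m₁ * m₂) Λ A (sortedWeights N k L 2 B₁ m₂)).RunsIn ℓ
      ((sortedWeights N k L 2 B₁ m₂).length * (18 * ℓ + 27) +
        numTries N k L Λ B₁ B₂ m₁ m₂ * (10 * ℓ + 17) +
        (sortedWeights N k L B₁ B₂ m₁).length * 2) := by
  have hpos₁ : 0 < m₁ := hm₁ ▸ primeProd_pos 2 B₁
  have hpos₂ : 0 < m₂ := hm₂ ▸ primeProd_pos B₁ B₂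
  have co : m₁.Coprime m₂ := hm₁ ▸ hm₂ ▸ coprime_primeProd 2 B₁ B₂
  have hN₁ (w) (hw : w ∈ sortedWeights N k L 2 B₁ m₂) : w < m₁ * m₂ :=
    hm₁ ▸ ((mem_sortedWeights hpos₂ (hm₁ ▸ co.symm) N k L).1 hw).lt
  have hN₂ (w) (hw : w ∈ sortedWeights N k L B₁ B₂ m₁) : w < m₁ * m₂ :=
    mul_comm m₂ m₁ ▸ hm₂ ▸ ((mem_sortedWeights hpos₁ (hm₂ ▸ co) N k L).1 hw).lt
  have hsize := len_mono (length_le_of_forall_lt (nodup_sortedWeights hpos₁ (hm₂ ▸ co) N k L) hN₂)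
  refine .bind (toArray_runsIn (fun w hw => (len_mono (hN₂ w hw).le).trans (by omega)) ?_) ?_
  · rw [Array.size_empty, zero_add]
    exact hsize.trans (by omega)
  · rw [toArray_val, Array.empty_append]
    exact meet_runsIn (pairwise_sortedWeights ..) hΛ hN hf (by omega) hN₂ (by omega) hN₁

lemma meetWeights_runsIn (hB : B₁ < B₂) (hm₁ : m₁ = HypSieve.primeProd 2 B₁)
    (hm₂ : m₂ = HypSieve.primeProd B₁ B₂) (hΛ : Λ ≤ m₁ * m₂) (hf : len f ≤ ℓ)
    (hl : 4 * (len (m₁ * m₂) + len (B₂ + 1) + len N + len k + len L) + 4 ≤ ℓ)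
    (hS : (B₂ + 2) ^ 4 + (sortedWeights N k L 2 B₁ m₂).length +
      (sortedWeights N k L B₁ B₂ m₁).length + numTries N k L Λ B₁ B₂ m₁ m₂ ≤ S) :
    (meetWeights N f L k Λ (primesIn 2 B₁).val (primesIn B₁ B₂).val m₁ m₂ (m₁ * m₂)).RunsIn ℓ
      (150 * (S * ℓ)) := by
  have hmeet := toArray_meet_runsIn (N := N) (k := k) (L := L) hm₁ hm₂ hΛ (by omega) hf (by omega)
  have hpos₁ : 0 < m₁ := hm₁ ▸ primeProd_pos 2 B₁
  have hpos₂ : 0 < m₂ := hm₂ ▸ primeProd_pos B₁ B₂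
  have co : m₁.Coprime m₂ := hm₁ ▸ hm₂ ▸ coprime_primeProd 2 B₁ B₂
  have hlm₁ := len_mono (Nat.le_mul_of_pos_right m₁ hpos₂)
  have hlm₂ := len_mono (Nat.le_mul_of_pos_left m₂ hpos₁)
  have hcomm : len (m₂ * m₁) = len (m₁ * m₂) := by rw [mul_comm]
  have hB₁ : B₁ < B₂ + 1 := hB.trans B₂.lt_add_one
  rw [meetWeights]
  subst hm₁ hm₂
  set n₁ := (sortedWeights N k L 2 B₁ (HypSieve.primeProd B₁ B₂)).length
  set n₂ := (sortedWeights N k L B₁ B₂ (HypSieve.primeProd 2 B₁)).length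
  set n := numTries N k L Λ B₁ B₂ (HypSieve.primeProd 2 B₁) (HypSieve.primeProd B₁ B₂)
  refine .mono (.bind (residues_primesIn_runsIn hB₁ ?_) <|
    .bind (residues_primesIn_runsIn B₂.lt_add_one ?_) <|
    .bind (chinese_primesIn_runsIn hB₁ ?_ N k L (HypSieve.primeProd B₁ B₂)) <|
    .bind (chinese_primesIn_runsIn B₂.lt_add_one ?_ N k L (HypSieve.primeProd 2 B₁)) <|
    .bind (inv_runsIn hpos₁ ?_ ?_) <|
    .bind (weightList_primesIn_runsIn ?_ N k L) <|
    .bind (sort_weightList_primesIn_runsIn hpos₂ co.symm ?_ N k L) <|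
    .bind (inv_runsIn hpos₂ ?_ ?_) <|
    .bind (weightList_primesIn_runsIn ?_ N k L) <|
    .bind (sort_weightList_primesIn_runsIn hpos₁ co ?_ N k L)
      (by rw [weightList_primesIn, weightList_primesIn]; exact hmeet)) ?total
  case total =>
    have h₁ : n₁ ≤ n₁ * ℓ := Nat.le_mul_of_pos_right _ (by omega)
    have h₂ : n₂ ≤ n₂ * ℓ := Nat.le_mul_of_pos_right _ (by omega)
    have h₃ : n ≤ n * ℓ := Nat.le_mul_of_pos_right _ (by omega)
    have h₄ : (B₂ + 2) ^ 4 ≤ (B₂ + 2) ^ 4 * ℓ := Nat.le_mul_of_pos_right _ (by omega)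
    have h₅ : ℓ ≤ (B₂ + 2) ^ 4 * ℓ := Nat.le_mul_of_pos_left _ (by positivity)
    have hSℓ := Nat.mul_le_mul_right ℓ hS
    linarith
  all_goals omega

lemma len_shift_le (ha : a ≤ N) (hb : b ≤ N) : len (HypSieve.shift N a b) ≤ 3 * len N + 4 := by
  have hf := len_mul_le 4 (a * b * N)
  have habN := len_mul_le (a * b) N
  have hab := len_mul_le a b
  have hshift := len_mono (sqrtUp_le (4 * (a * b * N)))
  rw [sqrtUp_eq_shift] at hshift
  have := len_mono ha
  have := len_mono hb
  have := len_four
  omega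

/-- The part of `factor` that is run if `N` and `M` are coprime. -/
def sieveAndMeet (N Λ a b : ℕ) (P₁ P₂ : List ℕ) (m₁ m₂ M : ℕ) : Timed (Option ℕ) := do
  let ab ← mul a b
  let abN ← mul ab N
  let f ← mul 4 abN
  let L ← sqrtUp f
  let k ← rem ab M
  meetWeights N f L k Λ P₁ P₂ m₁ m₂ M

lemma sieveAndMeet_runsIn (hB : B₁ < B₂) (hm₁ : m₁ = HypSieve.primeProd 2 B₁)
    (hm₂ : m₂ = HypSieve.primeProd B₁ B₂) (hΛ : Λ ≤ m₁ * m₂) (ha : a ≤ N) (hb : b ≤ N)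
    (hk : k = a * b % (m₁ * m₂)) (hL : L = HypSieve.shift N a b)
    (hl : 24 * (len (m₁ * m₂) + len (B₂ + 1) + len N) + 24 ≤ ℓ)
    (hS : (B₂ + 2) ^ 4 + (sortedWeights N k L 2 B₁ m₂).length +
      (sortedWeights N k L B₁ B₂ m₁).length + numTries N k L Λ B₁ B₂ m₁ m₂ ≤ S) :
    (sieveAndMeet N Λ a b (primesIn 2 B₁).val (primesIn B₁ B₂).val m₁ m₂ (m₁ * m₂)).RunsIn ℓ
      (150 * (S * ℓ) + 6 * ℓ + 8) := by
  have hla := len_mono ha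
  have hlb := len_mono hb
  have hlab := len_mul_le a b
  have hlabN := len_mul_le (a * b) N
  have hlf := len_mul_le 4 (a * b * N)
  have hl4 := len_four
  have hlL : len L ≤ 3 * len N + 4 := hL ▸ len_shift_le ha hb
  have hlk : len k ≤ len (a * b) := hk ▸ len_mod_le _ _
  have hmeet := meetWeights_runsIn (ℓ := ℓ) (f := 4 * (a * b * N)) hB hm₁ hm₂ hΛ (by omega)
    (by omega) hS
  rw [sieveAndMeet]
  refine .mono (.mul ?_ ?_ <| .mul ?_ ?_ <| .mul ?_ ?_ <| .bind (sqrtUp_runsIn ?_) <|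
    .rem (n := 150 * (S * ℓ)) ?_ ?_ (by rwa [sqrtUp_eq_shift, ← hL, ← hk])) ?_
  all_goals omega

/-- The part of `factor` that is run if `1 < g = gcd(N, M)`. -/
def commonFactor (N g : ℕ) (P₁ P₂ : List ℕ) : Timed (Option ℕ) := do
  if (← lt g N) then pure (some g)
  else
    match (← firstDivisor N P₁) with
    | some d => pure (some d)
    | none => firstDivisor N P₂

lemma commonFactor_runsIn {g : ℕ} (hB : B₁ < B₂) (hN : len N + len (B₂ + 1) ≤ ℓ)
    (hg : len g ≤ ℓ) :
    (commonFactor N g (primesIn 2 B₁).val (primesIn B₁ B₂).val).RunsIn ℓ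
      (6 * (B₂ + 2) ^ 4 + 1) := by
  have hB₁ : B₁ < B₂ + 1 := hB.trans B₂.lt_add_one
  refine .ite_lt hg (by omega) (fun _ => .pure _) fun _ => ?_
  refine .mono (.bind (n := 3 * (B₂ + 2) ^ 4) (firstDivisor_primesIn_runsIn hB₁ hN) ?_)
    (by linarith)
  split
  exacts [.pure _, firstDivisor_primesIn_runsIn B₂.lt_add_one hN]

lemma factor_runsIn (hB : B₁ < B₂) (hm₁ : m₁ = HypSieve.primeProd 2 B₁)
    (hm₂ : m₂ = HypSieve.primeProd B₁ B₂) (hΛ : Λ ≤ m₁ * m₂) (ha : a ≤ N) (hb : b ≤ N)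
    (hk : k = a * b % (m₁ * m₂)) (hL : L = HypSieve.shift N a b)
    (hl : 24 * (len (m₁ * m₂) + len (B₂ + 1) + len N) + 24 ≤ ℓ)
    (hS : (B₂ + 2) ^ 4 + (sortedWeights N k L 2 B₁ m₂).length +
      (sortedWeights N k L B₁ B₂ m₁).length + numTries N k L Λ B₁ B₂ m₁ m₂ ≤ S) :
    (factor N Λ B₁ B₂ a b).RunsIn ℓ (200 * (S * ℓ)) := by
  have hpos₁ : 0 < m₁ := hm₁ ▸ primeProd_pos 2 B₁
  have hpos₂ : 0 < m₂ := hm₂ ▸ primeProd_pos B₁ B₂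
  have hlm₁ := len_mono (Nat.le_mul_of_pos_right m₁ hpos₂)
  have hlm₂ := len_mono (Nat.le_mul_of_pos_left m₂ hpos₁)
  have hgcd := len_mono (Nat.gcd_le_right N (Nat.mul_pos hpos₁ hpos₂))
  have hlone := len_one
  have hB₁ : B₁ < B₂ + 1 := hB.trans B₂.lt_add_one
  have hX : 1 ≤ (B₂ + 2) ^ 4 := Nat.one_le_pow _ _ (by omega)
  have hpow : (B₂ + 1 + 1) ^ 4 = (B₂ + 2) ^ 4 := rfl
  have hSℓ : S ≤ S * ℓ := Nat.le_mul_of_pos_right _ (by omega)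
  have hℓ : ℓ ≤ S * ℓ := Nat.le_mul_of_pos_left _ (by omega)
  have hsieve := sieveAndMeet_runsIn hB hm₁ hm₂ hΛ ha hb hk hL hl hS
  have hcommon := commonFactor_runsIn hB (by omega : len N + _ ≤ ℓ)
    (by omega : len (Nat.gcd N (m₁ * m₂)) ≤ ℓ)
  rw [factor]
  refine .mono (.bind (primesIn_runsIn_pow (B := B₂ + 1) ?_ ?_ ?_) <|
    .bind (primesIn_runsIn_pow (B := B₂ + 1) ?_ ?_ ?_) <|
    .bind (prod_primesIn_runsIn hB₁ ?_) <| .bind (prod_primesIn_runsIn B₂.lt_add_one ?_)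
    (n := 170 * (S * ℓ)) ?rest) ?total
  case rest =>
    rw [prod_val, prod_val, prod_primesIn, prod_primesIn, ← hm₁, ← hm₂]
    refine .mono (.mul ?_ ?_ <| .bind (gcd_runsIn ?_ ?_) ?branches)
      (by omega : 160 * (S * ℓ) + 1 + (4 * ℓ + 3) + 1 ≤ _)
    case branches =>
      rw [gcd_val]
      exact .ite_lt (by omega) (by omega) (fun _ => hcommon.mono (by omega))
        fun _ => hsieve.mono (by omega)
    all_goals omega
  all_goals subst hm₁ hm₂; omega

end Factor

/-! ## The bound in terms of the sizes of the sets -/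

section

variable {N Λ B₁ B₂ a b m₁ m₂ k ℓ D S : ℕ}

lemma exists_pow_le_of_primeProd_le (A i : ℕ) {j : ℕ} (hj : j ≠ 0) :
    ∃ D, ∀ B S, HypSieve.primeProd 0 B ≤ A * S ^ j → B ^ i ≤ D * S := by
  obtain ⟨C, hC⟩ := exists_pow_le_primeProd (i * j)
  refine ⟨C * A + 1, fun B S hB => (Nat.pow_le_pow_iff_left hj).1 ?_⟩
  calc (B ^ i) ^ j = B ^ (i * j) := (pow_mul B i j).symm
    _ ≤ C * HypSieve.primeProd 0 B := hC B
    _ ≤ C * (A * S ^ j) := Nat.mul_le_mul_left C hB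
    _ = C * A * S ^ j := (mul_assoc _ _ _).symm
    _ ≤ (C * A + 1) ^ j * S ^ j :=
      Nat.mul_le_mul_right _ ((Nat.le_succ _).trans (Nat.le_self_pow hj _))
    _ = ((C * A + 1) * S) ^ j := (mul_pow _ _ _).symm

lemma mul_primeProd_le (hm₁ : m₁ = HypSieve.primeProd 2 B₁)
    (hm₂ : m₂ = HypSieve.primeProd B₁ B₂) (hab : (a * b).Coprime (m₁ * m₂)) (N : ℕ) :
    m₁ * m₂ ≤
      36 * ((HypSieve.weights N m₁ m₂ a b).ncard + (HypSieve.weights N m₂ m₁ a b).ncard) ^ 6 := by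
  have co : m₁.Coprime m₂ := hm₁ ▸ hm₂ ▸ coprime_primeProd 2 B₁ B₂
  subst hm₁ hm₂
  rw [ncard_weights_primeProd (primeProd_pos _ _) co.symm rfl,
    ncard_weights_primeProd (primeProd_pos _ _) co rfl]
  set n₁ := (sortedWeights N (a * b) (HypSieve.shift N a b) 2 B₁ _).length
  set n₂ := (sortedWeights N (a * b) (HypSieve.shift N a b) B₁ B₂ _).length
  calc HypSieve.primeProd 2 B₁ * HypSieve.primeProd B₁ B₂ ≤ 6 * n₁ ^ 3 * (6 * n₂ ^ 3) :=
        Nat.mul_le_mul (primeProd_le_length_sortedWeights_pow hab.coprime_mul_right_right _ _ _)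
          (primeProd_le_length_sortedWeights_pow hab.coprime_mul_left_right _ _ _)
    _ ≤ 6 * (n₁ + n₂) ^ 3 * (6 * (n₁ + n₂) ^ 3) := by gcongr <;> omega
    _ = 36 * (n₁ + n₂) ^ 6 := by ring

lemma exists_add_two_pow_four_le : ∃ D, ∀ B₁ B₂ S, 0 < B₂ →
    HypSieve.primeProd 2 B₁ * HypSieve.primeProd B₁ B₂ ≤ 36 * S ^ 6 → (B₂ + 2) ^ 4 ≤ D * S := by
  obtain ⟨D, hD⟩ := exists_pow_le_of_primeProd_le 72 4 (by norm_num : 6 ≠ 0)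
  refine ⟨81 * D, fun B₁ B₂ S hB hS => ?_⟩
  have hprod := primeProd_zero_le B₁ B₂
  calc (B₂ + 2) ^ 4 ≤ (3 * B₂) ^ 4 := Nat.pow_le_pow_left (by omega) 4
    _ = 81 * B₂ ^ 4 := by ring
    _ ≤ 81 * (D * S) := Nat.mul_le_mul_left _ (hD B₂ S (by omega))
    _ = 81 * D * S := (mul_assoc _ _ _).symm

lemma numTries_le_ncard (hm₁ : m₁ = HypSieve.primeProd 2 B₁)
    (hm₂ : m₂ = HypSieve.primeProd B₁ B₂) (hΛ : Λ ≤ m₁ * m₂) (hk : k ≡ a * b [MOD m₁ * m₂]) :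
    numTries N k (HypSieve.shift N a b) Λ B₁ B₂ m₁ m₂ ≤
      (HypSieve.smallSieve N (m₁ * m₂) a b Λ).ncard := by
  have co : m₁.Coprime m₂ := hm₁ ▸ hm₂ ▸ coprime_primeProd 2 B₁ B₂
  subst hm₁ hm₂
  have hpos₁ := primeProd_pos 2 B₁
  have hpos₂ := primeProd_pos B₁ B₂
  exact sum_tries_le hpos₁ hpos₂ co hk hΛ (nodup_sortedWeights hpos₂ co.symm _ _ _)
    (nodup_sortedWeights hpos₁ co _ _ _)
    (fun _ => (mem_sortedWeights hpos₂ co.symm _ _ _).1)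
    fun _ => (mem_sortedWeights hpos₁ co _ _ _).1

lemma factor_cost_le (hB : B₁ < B₂) (hm₁ : m₁ = HypSieve.primeProd 2 B₁)
    (hm₂ : m₂ = HypSieve.primeProd B₁ B₂) (hΛ : Λ ≤ m₁ * m₂) (ha : a ≤ N) (hb : b ≤ N)
    (hS : S = (HypSieve.weights N m₁ m₂ a b).ncard + (HypSieve.weights N m₂ m₁ a b).ncard +
      (HypSieve.smallSieve N (m₁ * m₂) a b Λ).ncard)
    (hℓ : ℓ = 24 * (len (m₁ * m₂) + len (B₂ + 1) + len N) + 24) :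
    (factor N Λ B₁ B₂ a b).cost ≤ 400 * (((B₂ + 2) ^ 4 + S) * ℓ ^ 3) := by
  have co : m₁.Coprime m₂ := hm₁ ▸ hm₂ ▸ coprime_primeProd 2 B₁ B₂
  have hk : a * b % (m₁ * m₂) ≡ a * b [MOD m₁ * m₂] := Nat.mod_modEq _ _
  have hk₁ : a * b % (m₁ * m₂) ≡ a * b [MOD m₁] := hk.of_dvd (dvd_mul_right _ _)
  have hk₂ : a * b % (m₁ * m₂) ≡ a * b [MOD m₂] := hk.of_dvd (dvd_mul_left _ _)
  have htries := numTries_le_ncard (N := N) hm₁ hm₂ hΛ hk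
  have hrun := factor_runsIn hB hm₁ hm₂ hΛ ha hb rfl rfl hℓ.ge
    (S := (B₂ + 2) ^ 4 + S) <| by
      subst hm₁ hm₂
      rw [ncard_weights_primeProd (primeProd_pos _ _) co.symm hk₁,
        ncard_weights_primeProd (primeProd_pos _ _) co hk₂] at hS
      omega
  exact hrun.trans_eq (by ring)

lemma len_le_log {n : ℕ} (hn : 0 < n) : (len n : ℝ) ≤ 2 * Real.log n + 2 := by
  obtain ⟨s, hs⟩ : ∃ s, n.size = s + 1 := Nat.exists_eq_add_one.2 (Nat.size_pos.2 hn)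
  have hpow : 2 ^ s ≤ n := Nat.lt_size.1 (by omega)
  have hlog : s * Real.log 2 ≤ Real.log n := by
    rw [← Real.log_pow]
    exact Real.log_le_log (by positivity) (by exact_mod_cast hpow)
  have hlen : (len n : ℝ) = s + 2 := by rw [len, hs]; push_cast; ring
  nlinarith [Real.log_two_gt_d9, Nat.cast_nonneg (α := ℝ) s]

lemma len_le_log_of_le_mul_pow {n j : ℕ} (hn : 0 < n) (h : n ≤ D * S ^ j) :
    (len n : ℝ) ≤ 2 * D + 2 * j * Real.log S + 2 := by
  have hDS : D * S ^ j ≠ 0 := (hn.trans_le h).ne'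
  have hD : (D : ℝ) ≠ 0 := Nat.cast_ne_zero.2 (left_ne_zero_of_mul hDS)
  have hS : (S : ℝ) ^ j ≠ 0 := by exact_mod_cast right_ne_zero_of_mul hDS
  have hlog : Real.log n ≤ D + j * Real.log S :=
    calc Real.log n ≤ Real.log (D * S ^ j) :=
          Real.log_le_log (by exact_mod_cast hn) (by exact_mod_cast h)
      _ = Real.log D + j * Real.log S := by rw [Real.log_mul hD hS, Real.log_pow]
      _ ≤ D + j * Real.log S := by gcongr; exact Real.log_le_self D.cast_nonneg
  linarith [len_le_log hn]

lemma one_le_log (hN : 3 ≤ N) : 1 ≤ Real.log N := by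
  have hN' : (3 : ℝ) ≤ N := by exact_mod_cast hN
  rw [Real.le_log_iff_exp_le (by linarith)]
  linarith [Real.exp_one_lt_d9]

lemma length_bound_le_log {M B : ℕ} (hN : 3 ≤ N) (hM : 0 < M) (hMS : M ≤ 36 * S ^ 6)
    (hBS : (B + 2) ^ 4 ≤ D * S) :
    ((24 * (len M + len (B + 1) + len N) + 24 : ℕ) : ℝ) ≤
      (48 * D + 2000 : ℕ) * (Real.log N + Real.log S) := by
  have hB : B + 1 ≤ D * S ^ 1 := by
    rw [pow_one]
    exact (Nat.le_succ _).trans ((Nat.le_self_pow (by norm_num) _).trans hBS)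
  have hlM := len_le_log_of_le_mul_pow hM hMS
  have hlB := len_le_log_of_le_mul_pow B.succ_pos hB
  have hlN := len_le_log (show 0 < N by omega)
  have hlogN := one_le_log hN
  have hlogS := Real.log_natCast_nonneg S
  have hD : (0 : ℝ) ≤ D := D.cast_nonneg
  push_cast at hlM hlB ⊢
  nlinarith [mul_le_mul_of_nonneg_left hlogN hD, mul_nonneg hD hlogS]

lemma exists_factor_cost_le : ∃ C : ℕ, ∀ N Λ B₁ B₂ a b m₁ m₂ S : ℕ, 3 ≤ N → B₁ < B₂ →
    m₁ = HypSieve.primeProd 2 B₁ → m₂ = HypSieve.primeProd B₁ B₂ → Λ ≤ m₁ * m₂ →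
    a ≤ N → b ≤ N → (a * b).Coprime (m₁ * m₂) →
    S = (HypSieve.weights N m₁ m₂ a b).ncard + (HypSieve.weights N m₂ m₁ a b).ncard +
      (HypSieve.smallSieve N (m₁ * m₂) a b Λ).ncard →
    ((factor N Λ B₁ B₂ a b).cost : ℝ) ≤ C * S * (Real.log N + Real.log S) ^ 3 := by
  obtain ⟨D, hD⟩ := exists_add_two_pow_four_le
  refine ⟨400 * (D + 1) * (48 * D + 2000) ^ 3, ?_⟩
  intro N Λ B₁ B₂ a b m₁ m₂ S hN hB hm₁ hm₂ hΛ ha hb hab hS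
  have hM : 0 < m₁ * m₂ :=
    Nat.mul_pos (hm₁ ▸ primeProd_pos 2 B₁) (hm₂ ▸ primeProd_pos B₁ B₂)
  have hMS : m₁ * m₂ ≤ 36 * S ^ 6 :=
    (mul_primeProd_le hm₁ hm₂ hab N).trans (by gcongr; omega)
  have hBS : (B₂ + 2) ^ 4 ≤ D * S := hD B₁ B₂ S (by omega) (hm₁ ▸ hm₂ ▸ hMS)
  obtain ⟨ℓ, hℓ⟩ : ∃ ℓ, ℓ = 24 * (len (m₁ * m₂) + len (B₂ + 1) + len N) + 24 := ⟨_, rfl⟩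
  have hℓlog := length_bound_le_log hN hM hMS hBS
  rw [← hℓ] at hℓlog
  calc ((factor N Λ B₁ B₂ a b).cost : ℝ) ≤ (400 * (((B₂ + 2) ^ 4 + S) * ℓ ^ 3) : ℕ) := by
        exact_mod_cast factor_cost_le hB hm₁ hm₂ hΛ ha hb hS hℓ
    _ ≤ (400 * ((D * S + S) * ℓ ^ 3) : ℕ) := by gcongr
    _ = 400 * (D + 1) * S * (ℓ : ℝ) ^ 3 := by push_cast; ring
    _ ≤ 400 * (D + 1) * S * ((48 * D + 2000 : ℕ) * (Real.log N + Real.log S)) ^ 3 := by gcongr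
    _ = _ := by push_cast; ring

end

end Tradeoff

theorem mainTheorem9 :
    ∃ C c : ℕ, ∀ N Λ B₁ B₂ a b m₁ m₂ M : ℕ,
      Odd N → 1 < N → ¬ N.Prime →
      B₁ < B₂ →
      m₁ = HypSieve.primeProd 2 B₁ → m₂ = HypSieve.primeProd B₁ B₂ → M = m₁ * m₂ →
      Λ < M →
      a < N → b < N → Nat.Coprime (a * b) (M * N) →
      (HypSieve.fermatBound N a b < (Λ : ℝ) →
        ∃ d : ℕ, (Tradeoff.factor N Λ B₁ B₂ a b).val = some d ∧ d ∣ N ∧ 1 < d ∧ d < N) ∧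
      ∀ S : ℕ,
        S = (HypSieve.weights N m₁ m₂ a b).ncard + (HypSieve.weights N m₂ m₁ a b).ncard +
          (HypSieve.smallSieve N M a b Λ).ncard →
        ((Tradeoff.factor N Λ B₁ B₂ a b).cost : ℝ) ≤
          C * S * (Real.log N + Real.log Λ + Real.log S) ^ c := by
  obtain ⟨C, hC⟩ := Tradeoff.exists_factor_cost_le
  refine ⟨C, 3, fun N Λ B₁ B₂ a b m₁ m₂ M hodd h₁ hN hB hm₁ hm₂ hM hΛ ha hb hab => ?_⟩
  subst hM
  refine ⟨Tradeoff.factor_correct hm₁ hm₂ hΛ.le hodd h₁ hN hab, fun S hS => ?_⟩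
  have hN₃ : 3 ≤ N := by
    obtain ⟨j, rfl⟩ := hodd
    omega
  have hlogΛ := Real.log_natCast_nonneg Λ
  calc ((Tradeoff.factor N Λ B₁ B₂ a b).cost : ℝ)
      ≤ C * S * (Real.log N + Real.log S) ^ 3 :=
        hC N Λ B₁ B₂ a b m₁ m₂ S hN₃ hB hm₁ hm₂ hΛ.le ha.le hb.le hab.coprime_mul_right_right hS
    _ ≤ C * S * (Real.log N + Real.log Λ + Real.log S) ^ 3 := by gcongr; linarith
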